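/- Let $M$ be a connected closed oriented 4-manifold triangulated by a finite simplicial complex $K$, let $\varphi$ be a homomorphism from $\pi_1(M)$ to the group of orientation-preserving isometries of $\mathbb R^4$, and let $f$ be a map from the vertices of the universal cover of $K$ to $\mathbb R^4$ with $f(gx)=\varphi(g)f(x)$ for $g\in\pi_1(M)$, such that the image of every 4-simplex is nondegenerate. This gives every edge $a$ a squared length $L_a$, every 2-face $i$ an area $S_i$, and every 4-simplex $\sigma$ an oriented volume $V_\sigma\neq0$ (positive if $f$ preserves its orientation, negative otherwise). For squared edge lengths varied independently near these values, let the deficit angle be $$\omega_i=-\sum_{\sigma\supset i}\operatorname{sign}(V_\sigma)\,\vartheta_{\sigma,i} \pmod{2\pi},$$ where $\vartheta_{\sigma,i}\in(0,\pi)$ is the inner dihedral angle of $\sigma$ at $i$ computed from the edge lengths of $\sigma$; at the given values $\omega_i=0$. Assume that in every 4-simplex the infinitesimal variations of its ten squared edge lengths are determined by the variations of its ten 2-face areas. Then, conversely, area variations $(dS_i)$ chosen independently determine in each 4-simplex separately the variations of its squared edge lengths (which need not agree on common edges) and hence of its dihedral angles, and so they determine the variations $d\omega_i$ and the variations $$d\Omega_a=\sum_i\frac{\partial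 S_i}{\partial L_a}\,d\omega_i$$ of the deficit angles $\Omega_a=\sum_i\frac{\partial S_i}{\partial L_a}\omega_i$ around the edges. Let $\mathcal B$ be a largest square submatrix of $(\partial\omega_i/\partial L_a)$ with nonzero determinant, let $\mathcal D$ and $\mathcal C$ be the sets of 2-faces and edges that correspond to its rows and columns, and let $\overline{\mathcal D}$ and $\overline{\mathcal C}$ be the complements of these sets in the sets of all 2-faces and of all edges. Consider $$\frac{\prod_{\text{2-faces}}S\;\cdot\;\bigwedge_{\overline{\mathcal D}}dS\;\cdot\;\bigwedge_{\overline{\mathcal C}}dL}{\det\mathcal B\;\cdot\;\prod_{\text{4-simplices}}V},$$ where $\bigwedge_{\overline{\mathcal D}}dS$ is regarded as an exterior form on the space of area variations with all $d\Omega_a=0$, and $\bigwedge_{\overline{\mathcal C}}dL$ as an exterior form on the space of variations of the squared edge lengths with all $d\omega_i=0$. (1) Up to sign, this value does not depend on the choice of $\mathcal C$ and $\mathcal D$ (nor on the orderings of rows, columns and factors). (2) Up to sign, it is invariant under Pachner moves $3\to3$: let a 2-face $ABC$ belong to exactly three 4-simplices $ABCDE$, $ABCEF$, $ABCFD$, let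 $DEF$ not be a 2-face of $K$, and replace these three 4-simplices by $BCDEF$, $CADEF$, $ABDEF$ (with the orientation of the common boundary, the other 4-simplices and $f$ unchanged), the new 4-simplices being nondegenerate and also satisfying the assumption above that area variations determine length variations. Then there is exactly one linear isomorphism between the spaces of area variations with all $d\Omega_a=0$ before and after the move that keeps the components $dS_i$ at all common 2-faces; exactly one linear isomorphism between the spaces of length variations with all $d\omega_i=0$ keeps all components $dL_a$; and under these isomorphisms the values before and after the move coincide up to sign, for any choices of $\mathcal C,\mathcal D$ before and after. -/

import Mathlib

namespace FlatFour

open scoped BigOperators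

/-- Four-dimensional Euclidean space. -/
abbrev E4 : Type := EuclideanSpace ℝ (Fin 4)

/-! ### Simplicial complexes, their realization, edge paths and the universal cover -/

section Complex

variable {V : Type*}

/-- The `n`-simplices of an abstract simplicial complex, as sets of `n + 1` vertices. -/
abbrev Simplex (K : AbstractSimplicialComplex V) (n : ℕ) : Type _ :=
  {s : Finset V // s ∈ K ∧ s.card = n + 1}

noncomputable instance [Finite V] (K : AbstractSimplicialComplex V) (n : ℕ) :
    Fintype (Simplex K n) :=
  Fintype.ofFinite _

/-- The geometric realization of a finite simplicial complex, in barycentric coordinates. -/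
def Realization [Fintype V] (K : AbstractSimplicialComplex V) : Type _ :=
  {x : V → ℝ // x ∈ stdSimplex ℝ V ∧ ∃ s ∈ K, ∀ v, x v ≠ 0 → v ∈ s}

instance [Fintype V] (K : AbstractSimplicialComplex V) : TopologicalSpace (Realization K) :=
  inferInstanceAs (TopologicalSpace (Subtype _))

variable [DecidableEq V]

/-- The 1-skeleton. -/
def skeleton (K : AbstractSimplicialComplex V) : SimpleGraph V where
  Adj u v := u ≠ v ∧ ({u, v} : Finset V) ∈ K
  symm := ⟨fun u v h => ⟨h.1.symm, by rw [Finset.pair_comm]; exact h.2⟩⟩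
  loopless := ⟨fun _ h => h.1 rfl⟩

/-- An edge path of `K`. -/
abbrev EdgePath (K : AbstractSimplicialComplex V) (u v : V) : Type _ := (skeleton K).Walk u v

/-- Homotopy of edge paths relative to the end points: generated by removing backtracking
and by pushing an edge path across a triangle of `K`. -/
inductive Homotopic (K : AbstractSimplicialComplex V) :
    ∀ {u v : V}, EdgePath K u v → EdgePath K u v → Prop
  | refl {u v : V} (p : EdgePath K u v) : Homotopic K p p
  | symm {u v : V} {p q : EdgePath K u v} : Homotopic K p q → Homotopic K q p
  | trans {u v : V} {p q r : EdgePath K u v} :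
      Homotopic K p q → Homotopic K q r → Homotopic K p r
  | cons {u v w : V} (h : (skeleton K).Adj u v) {p q : EdgePath K v w} :
      Homotopic K p q → Homotopic K (.cons h p) (.cons h q)
  | backtrack {u v w : V} (h : (skeleton K).Adj u v) (p : EdgePath K u w) :
      Homotopic K (.cons h (.cons h.symm p)) p
  | triangle {u v w x : V} (huv : (skeleton K).Adj u v) (hvw : (skeleton K).Adj v w)
      (huw : (skeleton K).Adj u w) (ht : ({u, v, w} : Finset V) ∈ K) (p : EdgePath K w x) :
      Homotopic K (.cons huv (.cons hvw p)) (.cons huw p)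

theorem Homotopic.append_left {K : AbstractSimplicialComplex V} {u v w : V} (p : EdgePath K u v)
    {q r : EdgePath K v w} (h : Homotopic K q r) : Homotopic K (p.append q) (p.append r) := by
  induction p with
  | nil => exact h
  | cons e p ih => exact .cons e (ih h)

theorem Homotopic.append_right {K : AbstractSimplicialComplex V} {u v w : V}
    {p q : EdgePath K u v} (h : Homotopic K p q) (r : EdgePath K v w) :
    Homotopic K (p.append r) (q.append r) := by
  induction h with
  | refl p => exact .refl _
  | symm _ ih => exact .symm (ih r)
  | trans _ _ ih₁ ih₂ => exact .trans (ih₁ r) (ih₂ r)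
  | cons e _ ih => exact .cons e (ih r)
  | backtrack e p => exact .backtrack e _
  | triangle h₁ h₂ h₃ ht p => exact .triangle h₁ h₂ h₃ ht _

theorem Homotopic.reverse_append {K : AbstractSimplicialComplex V} {u v : V}
    (p : EdgePath K u v) : Homotopic K (p.reverse.append p) .nil := by
  induction p with
  | nil => exact .refl _
  | cons e p ih =>
    rw [SimpleGraph.Walk.reverse_cons, ← SimpleGraph.Walk.append_assoc]
    exact .trans (.append_left _ (.backtrack e.symm p)) ih

theorem Homotopic.reverse {K : AbstractSimplicialComplex V} {u v : V} {p q : EdgePath K u v}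
    (h : Homotopic K p q) : Homotopic K p.reverse q.reverse := by
  have h₁ : Homotopic K (p.reverse.append (q.append q.reverse)) p.reverse := by
    have := Homotopic.append_left p.reverse (Homotopic.reverse_append q.reverse)
    rwa [SimpleGraph.Walk.reverse_reverse, SimpleGraph.Walk.append_nil] at this
  have h₂ : Homotopic K (p.reverse.append (q.append q.reverse)) q.reverse := by
    rw [SimpleGraph.Walk.append_assoc]
    exact ((Homotopic.append_left p.reverse h.symm).trans
      (Homotopic.reverse_append p)).append_right q.reverse
  exact h₁.symm.trans h₂

/-- Homotopy of edge paths as an equivalence relation. -/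
def homotopySetoid (K : AbstractSimplicialComplex V) (u v : V) : Setoid (EdgePath K u v) where
  r := Homotopic K
  iseqv := ⟨.refl, .symm, .trans⟩

/-- Homotopy classes of edge paths from `u` to `v`. -/
def PathClass (K : AbstractSimplicialComplex V) (u v : V) : Type _ :=
  Quotient (homotopySetoid K u v)

/-- The class of an edge path. -/
def PathClass.mk {K : AbstractSimplicialComplex V} {u v : V} (p : EdgePath K u v) :
    PathClass K u v :=
  Quotient.mk (homotopySetoid K u v) p

/-- Concatenation of classes of edge paths. -/
def PathClass.comp {K : AbstractSimplicialComplex V} {u v w : V} (x : PathClass K u v)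
    (y : PathClass K v w) : PathClass K u w :=
  Quotient.map₂ (sa := homotopySetoid K u v) (sb := homotopySetoid K v w)
    (sc := homotopySetoid K u w) (fun p q => p.append q)
    (fun _ _ h _ _ h' => (Homotopic.append_right h _).trans (Homotopic.append_left _ h')) x y

/-- The class of the reversed edge path. -/
def PathClass.inv {K : AbstractSimplicialComplex V} {u v : V} (x : PathClass K u v) :
    PathClass K v u :=
  Quotient.map (sa := homotopySetoid K u v) (sb := homotopySetoid K v u)
    (fun p => p.reverse) (fun _ _ h => Homotopic.reverse h) x

/-- The fundamental group (edge-path group) based at `v₀`. -/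
abbrev FundGroup (K : AbstractSimplicialComplex V) (v₀ : V) : Type _ := PathClass K v₀ v₀

instance (K : AbstractSimplicialComplex V) (v₀ : V) : Group (FundGroup K v₀) where
  mul x y := PathClass.comp x y
  one := PathClass.mk .nil
  inv x := PathClass.inv x
  mul_assoc := by
    rintro ⟨p⟩ ⟨q⟩ ⟨r⟩
    exact congrArg PathClass.mk (SimpleGraph.Walk.append_assoc p q r).symm
  one_mul := by
    rintro ⟨p⟩
    rfl
  mul_one := by
    rintro ⟨p⟩
    exact congrArg PathClass.mk (SimpleGraph.Walk.append_nil p)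
  inv_mul_cancel := by
    rintro ⟨p⟩
    exact Quotient.sound (s := homotopySetoid K v₀ v₀) (Homotopic.reverse_append p)

/-- The vertices of the universal cover of a connected complex: a vertex of `K` together with a
homotopy class of edge paths from the base vertex. The covering map is `Sigma.fst`. -/
abbrev CoverVertex (K : AbstractSimplicialComplex V) (v₀ : V) : Type _ :=
  Σ v : V, PathClass K v₀ v

/-- The deck action of the fundamental group on the vertices of the universal cover. -/
def deck {K : AbstractSimplicialComplex V} {v₀ : V} (g : FundGroup K v₀)
    (x : CoverVertex K v₀) : CoverVertex K v₀ :=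
  ⟨x.1, PathClass.comp g x.2⟩

/-- The edges of the universal cover. -/
def CoverAdj {K : AbstractSimplicialComplex V} {v₀ : V} (x y : CoverVertex K v₀) : Prop :=
  ∃ (p : EdgePath K v₀ x.1) (h : (skeleton K).Adj x.1 y.1),
    x.2 = PathClass.mk p ∧ y.2 = PathClass.mk (p.concat h)

/-- `x` is an ordering of the vertices of a simplex of the universal cover lying over the
simplex `s` of `K`. -/
def IsLift {K : AbstractSimplicialComplex V} {v₀ : V} {n : ℕ} (s : Simplex K n)
    (x : Fin (n + 1) → CoverVertex K v₀) : Prop :=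
  Finset.univ.image (fun i => (x i).1) = s.1 ∧ ∀ i j, i ≠ j → CoverAdj (x i) (x j)

/-- `t` lists the vertices of some 4-simplex of `K`, each of them once. -/
def IsFourSimplex (K : AbstractSimplicialComplex V) (t : Fin 5 → V) : Prop :=
  Function.Injective t ∧ Finset.univ.image t ∈ K

/-- A consistent orientation of the 4-simplices: every ordering of the vertices of a 4-simplex
is positive or negative, even permutations do not change the sign and odd ones do, and two
4-simplices with a common tetrahedron induce opposite orientations on it. -/
structure Orientation (K : AbstractSimplicialComplex V) where
  sign : (Fin 5 → V) → ℤˣ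
  sign_perm : ∀ (t : Fin 5 → V) (π : Equiv.Perm (Fin 5)), IsFourSimplex K t →
    sign (t ∘ π) = Equiv.Perm.sign π * sign t
  coherent : ∀ (t : Fin 4 → V) (p q : V), p ≠ q → IsFourSimplex K (Matrix.vecCons p t) →
    IsFourSimplex K (Matrix.vecCons q t) →
      sign (Matrix.vecCons p t) = -sign (Matrix.vecCons q t)

end Complex

/-- The oriented volume of the 4-simplex in `ℝ⁴` with vertices `P 0, …, P 4`, in this order. -/
noncomputable def signedVolume (P : Fin 5 → E4) : ℝ :=
  (Matrix.of fun i j : Fin 4 => (P i.succ - P 0) j).det / 24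

/-! ### Flat triangulated manifolds -/

/-- A finite simplicial complex which triangulates a connected oriented 4-manifold, together with
the Euclidean structure given by a representation `φ` of the fundamental group by proper motions
of `ℝ⁴` and an equivariant map `f` of the vertices of the universal cover to `ℝ⁴` under which
every 4-simplex is nondegenerate. -/
structure FlatManifold (V : Type*) [Fintype V] [DecidableEq V] (v₀ : V) where
  K : AbstractSimplicialComplex V
  manifold : Nonempty (ChartedSpace E4 (Realization K))
  connected : (skeleton K).Connected
  o : Orientation K
  φ : FundGroup K v₀ →* (E4 ≃ᵃⁱ[ℝ] E4)
  φ_proper : ∀ g, LinearMap.det ((φ g).linearIsometryEquiv.toLinearEquiv : E4 →ₗ[ℝ] E4) = 1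
  f : CoverVertex K v₀ → E4
  f_deck : ∀ g x, f (deck g x) = φ g (f x)
  nondegenerate : ∀ (σ : Simplex K 4) (x : Fin 5 → CoverVertex K v₀), IsLift σ x →
    signedVolume (f ∘ x) ≠ 0

namespace FlatManifold

variable {V : Type*} [Fintype V] [DecidableEq V] {v₀ : V}

abbrev Edge (T : FlatManifold V v₀) : Type _ := Simplex T.K 1
abbrev Face (T : FlatManifold V v₀) : Type _ := Simplex T.K 2
abbrev Cell (T : FlatManifold V v₀) : Type _ := Simplex T.K 4

open scoped Classical in
/-- The squared lengths of the edges; they do not depend on the lift of the edge. -/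
noncomputable def L₀ (T : FlatManifold V v₀) (a : T.Edge) : ℝ :=
  if h : ∃ x : Fin 2 → CoverVertex T.K v₀, IsLift a x then
    dist (T.f (h.choose 0)) (T.f (h.choose 1)) ^ 2
  else 0

open scoped Classical in
/-- The oriented volume of a 4-simplex: positive if its orientation is preserved by the map to
`ℝ⁴` and negative otherwise. It does not depend on the ordering or on the lift. -/
noncomputable def vol (T : FlatManifold V v₀) (σ : T.Cell) : ℝ :=
  if h : ∃ x : Fin 5 → CoverVertex T.K v₀, IsLift σ x then
    ((T.o.sign fun i => (h.choose i).1 : ℤ) : ℝ) * signedVolume (T.f ∘ h.choose)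
  else 0

/-! Metric values as functions of independent squared edge lengths `L`. -/

open scoped Classical in
/-- The squared distance between two vertices that are joined by an edge. -/
noncomputable def sq (T : FlatManifold V v₀) (L : T.Edge → ℝ) (u v : V) : ℝ :=
  if h : ({u, v} : Finset V) ∈ T.K ∧ ({u, v} : Finset V).card = 1 + 1 then L ⟨{u, v}, h⟩ else 0

/-- The Cayley–Menger determinant of a square array of squared distances. -/
noncomputable def cayleyMenger {ι : Type*} [Fintype ι] [DecidableEq ι] (D : ι → ι → ℝ) : ℝ :=
  (Matrix.of fun a b : Option ι =>
    match a, b with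
    | none, none => (0 : ℝ)
    | none, some _ => 1
    | some _, none => 1
    | some i, some j => D i j).det

/-- The area of a 2-face: `16 S²` is minus its Cayley–Menger determinant. -/
noncomputable def area (T : FlatManifold V v₀) (i : T.Face) (L : T.Edge → ℝ) : ℝ :=
  √(-cayleyMenger fun a b : i.1 => T.sq L a b) / 4

/-- The Cayley–Menger determinant of the tetrahedra `i ∪ {p}` (rows) and `i ∪ {q}` (columns). It is
eight times the inner product of the trivectors `(b - a) ∧ (c - a) ∧ (p - a)` and
`(b - a) ∧ (c - a) ∧ (q - a)`, where `i = {a, b, c}`. -/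
noncomputable def mixedCM (T : FlatManifold V v₀) (i : T.Face) (L : T.Edge → ℝ) (p q : V) : ℝ :=
  cayleyMenger fun a b : Option i.1 => T.sq L (a.elim p (↑)) (b.elim q (↑))

/-- The inner dihedral angle, in `[0, π]`, between the tetrahedra `i ∪ {p}` and `i ∪ {q}`. -/
noncomputable def dihedral (T : FlatManifold V v₀) (i : T.Face) (L : T.Edge → ℝ) (p q : V) : ℝ :=
  Real.arccos (T.mixedCM i L p q / √(T.mixedCM i L p p * T.mixedCM i L q q))

/-- The inner dihedral angle of the 4-simplex `σ` at its 2-face `i`. There are two vertices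
`p, q` of `σ` outside `i`; the sum has the two equal terms for `(p, q)` and `(q, p)`. -/
noncomputable def angle (T : FlatManifold V v₀) (σ : T.Cell) (i : T.Face) (L : T.Edge → ℝ) : ℝ :=
  (∑ pq ∈ (σ.1 \ i.1).offDiag, T.dihedral i L pq.1 pq.2) / 2

/-- The deficit angle around the 2-face `i` (a representative modulo `2π`): minus the algebraic
sum of the dihedral angles, taken with the signs of the 4-simplices. -/
noncomputable def deficit (T : FlatManifold V v₀) (i : T.Face) (L : T.Edge → ℝ) : ℝ :=
  -∑ σ : T.Cell with i.1 ⊆ σ.1, Real.sign (T.vol σ) * T.angle σ i L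

/-! Differentials at the flat point. -/

/-- The matrix `(∂ω_i / ∂L_a)`. -/
noncomputable def dωdL (T : FlatManifold V v₀) : Matrix T.Face T.Edge ℝ :=
  Matrix.of fun i a => fderiv ℝ (T.deficit i) T.L₀ (Pi.single a 1)

/-- The infinitesimal deformations of the squared edge lengths which leave all the deficit angles
at the 2-faces zero. -/
noncomputable def lengthDeformations (T : FlatManifold V v₀) : Submodule ℝ (T.Edge → ℝ) :=
  ⨅ i : T.Face, (fderiv ℝ (T.deficit i) T.L₀).ker

/-- In every 4-simplex, the infinitesimal variations of the ten squared edge lengths are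
determined by those of the ten areas of the 2-faces. -/
def AreasDetermineLengths (T : FlatManifold V v₀) : Prop :=
  ∀ (σ : T.Cell) (l : T.Edge → ℝ),
    (∀ i : T.Face, i.1 ⊆ σ.1 → fderiv ℝ (T.area i) T.L₀ l = 0) →
      ∀ a : T.Edge, a.1 ⊆ σ.1 → l a = 0

/-- The variation of the deficit angle at the 2-face `i` if the squared edge lengths are varied
separately in each 4-simplex, by `l σ` in the 4-simplex `σ`. -/
noncomputable def dω (T : FlatManifold V v₀) (i : T.Face) (l : T.Cell → T.Edge → ℝ) : ℝ :=
  -∑ σ : T.Cell with i.1 ⊆ σ.1, Real.sign (T.vol σ) * fderiv ℝ (T.angle σ i) T.L₀ (l σ)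

/-- The corresponding variation of the deficit angle `Ω_a = ∑ i, (∂S_i / ∂L_a) ω_i` around the
edge `a`. The variations of the coefficients do not enter, as they are multiplied by `ω_i = 0`. -/
noncomputable def dΩ (T : FlatManifold V v₀) (a : T.Edge) (l : T.Cell → T.Edge → ℝ) : ℝ :=
  ∑ i : T.Face, fderiv ℝ (T.area i) T.L₀ (Pi.single a 1) * T.dω i l

/-- The infinitesimal deformations `s` of the areas of the 2-faces which leave all the deficit
angles around edges zero. The variations `l σ` of the squared edge lengths in the 4-simplex `σ`
are those that `s` yields there; they need not agree in neighbouring 4-simplices. -/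
noncomputable def areaDeformations (T : FlatManifold V v₀) : Submodule ℝ (T.Face → ℝ) where
  carrier := {s | ∃ l : T.Cell → T.Edge → ℝ,
    (∀ (σ : T.Cell) (i : T.Face), i.1 ⊆ σ.1 → fderiv ℝ (T.area i) T.L₀ (l σ) = s i) ∧
      ∀ a : T.Edge, T.dΩ a l = 0}
  add_mem' := by
    rintro s s' ⟨l, h, hΩ⟩ ⟨l', h', hΩ'⟩
    refine ⟨l + l', fun σ i hi => ?_, fun a => ?_⟩
    · simp [h σ i hi, h' σ i hi]
    · have := congrArg₂ (· + ·) (hΩ a) (hΩ' a)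
      simp only [dΩ, dω, ← Finset.sum_add_distrib, ← mul_add, ← neg_add, add_zero] at this
      simpa [dΩ, dω] using this
  zero_mem' := ⟨0, by simp, by simp [dΩ, dω]⟩
  smul_mem' := by
    rintro c s ⟨l, h, hΩ⟩
    refine ⟨c • l, fun σ i hi => ?_, fun a => ?_⟩
    · simp [h σ i hi]
    · have := congrArg (c * ·) (hΩ a)
      simp only [dΩ, dω, Finset.mul_sum, mul_neg, mul_zero] at this
      simp only [dΩ, dω, Pi.smul_apply, map_smul, smul_eq_mul, Finset.mul_sum, mul_neg]
      rw [← this]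
      refine Finset.sum_congr rfl fun i _ => ?_
      refine congrArg Neg.neg (Finset.sum_congr rfl fun σ _ => ?_)
      ring

/-- The choice of a largest square submatrix `𝓑` of `(∂ω_i / ∂L_a)` with nonzero determinant. The
rows `𝓓` and the columns `𝓒` of `𝓑` are numbered by `Fin m`; the remaining 2-faces are numbered
by `Fin k` and the remaining edges by `Fin l`. -/
structure Choice (T : FlatManifold V v₀) (m k l : ℕ) where
  rows : Fin m ⊕ Fin k ≃ T.Face
  cols : Fin m ⊕ Fin l ≃ T.Edge
  det_ne_zero : (T.dωdL.submatrix (rows ∘ Sum.inl) (cols ∘ Sum.inl)).det ≠ 0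
  largest : ∀ (n : ℕ) (r : Fin n → T.Face) (c : Fin n → T.Edge),
    (T.dωdL.submatrix r c).det ≠ 0 → n ≤ m

/-- The exterior product of the coordinate forms `dx_{c 0} ∧ … ∧ dx_{c (n-1)}`, restricted to a
subspace `W`. -/
noncomputable def wedge {ι : Type*} (W : Submodule ℝ (ι → ℝ)) {n : ℕ} (c : Fin n → ι) :
    W [⋀^Fin n]→ₗ[ℝ] ℝ :=
  Matrix.detRowAlternating.compLinearMap
    (LinearMap.pi fun j => LinearMap.proj (c j) ∘ₗ W.subtype)

/-- The expression `∏ S ⬝ ⋀ dS ⬝ ⋀ dL / (det 𝓑 ⬝ ∏ V)`, evaluated on area deformations `s` and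
length deformations `u`. -/
noncomputable def value (T : FlatManifold V v₀) {m k l : ℕ} (χ : T.Choice m k l)
    (s : Fin k → T.areaDeformations) (u : Fin l → T.lengthDeformations) : ℝ :=
  (∏ i : T.Face, T.area i T.L₀) *
      wedge T.areaDeformations (χ.rows ∘ Sum.inr) s *
      wedge T.lengthDeformations (χ.cols ∘ Sum.inr) u /
    ((T.dωdL.submatrix (χ.rows ∘ Sum.inl) (χ.cols ∘ Sum.inl)).det * ∏ σ : T.Cell, T.vol σ)

/-- `T'` is obtained from `T` by a Pachner move `3 → 3`: the three 4-simplices `ABCDE`, `ABCEF`,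
`ABCFD` around the 2-face `ABC` are replaced by the three 4-simplices `BCDEF`, `CADEF`, `ABDEF`
around the 2-face `DEF`. The orientations of the other 4-simplices and the images in `ℝ⁴` of the
vertices of the universal cover do not change, and the new 4-simplices induce the same orientation
on the common boundary of the two clusters as the old ones. -/
structure IsMove (T T' : FlatManifold V v₀) (A B C D E F : V) : Prop where
  nodup : [A, B, C, D, E, F].Nodup
  star : ∀ s : Finset V, {A, B, C} ⊆ s →
    (s ∈ T.K ↔ ∃ t : Finset V, t ⊂ {D, E, F} ∧ s = {A, B, C} ∪ t)
  new_face : {D, E, F} ∉ T.K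
  faces : ∀ s : Finset V, s ∈ T'.K ↔ (s ∈ T.K ∧ ¬ {A, B, C} ⊆ s) ∨
    ∃ t : Finset V, t ⊂ {A, B, C} ∧ s = {D, E, F} ∪ t
  orientation_old : ∀ t : Fin 5 → V, IsFourSimplex T.K t → IsFourSimplex T'.K t →
    T'.o.sign t = T.o.sign t
  orientation_new : T'.o.sign ![B, C, D, E, F] = T.o.sign ![A, B, C, D, E]
  map_eq : ∀ (v : V) (p : EdgePath T.K v₀ v) (p' : EdgePath T'.K v₀ v), p.support = p'.support →
    T'.f ⟨v, PathClass.mk p'⟩ = T.f ⟨v, PathClass.mk p⟩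

/-- A linear map between spaces of deformations of simplexwise values on `T` and on `T'` that keeps
the components at the simplices common to the two triangulations. -/
def Compatible {T T' : FlatManifold V v₀} {n : ℕ} {W : Submodule ℝ (Simplex T.K n → ℝ)}
    {W' : Submodule ℝ (Simplex T'.K n → ℝ)} (Φ : W ≃ₗ[ℝ] W') : Prop :=
  ∀ (w : W) (i : Simplex T.K n) (i' : Simplex T'.K n), i.1 = i'.1 → (Φ w).1 i' = w.1 i

end FlatManifold

end FlatFour

/-! Let `A` be the matrix `(∂ω_i / ∂L_a)`. The length deformations are by definition the kernel of
`A`. The area deformations are the kernel of `Aᵀ`: in each 4-simplex the matrix `∑ i, (∂S_i / ∂L_a)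
(∂ϑ_i / ∂L_b)` is symmetric, which is the Schläfli formula in differential form (`schlaefli_symm`),
so `dΩ_a` depends on the area variations `s` alone and equals `(Aᵀ s)_a` (`dΩ_eq`). The value is
thus `∏ S / ∏ V` times a quantity of pure linear algebra: complementary coordinate determinants of
the two kernels, divided by a maximal minor of `A`.

Independence of the choice. For a matrix of full row rank, the complementary minors of a family of
kernel vectors are proportional, up to sign, to the maximal minors of the matrix
(`coordDet_mul_det`). The rows of one maximal minor and the columns of another again select a
maximal minor (`IsMaximalMinor.mix`), so columns and rows can be exchanged one after the other,
using `A` and then `Aᵀ`.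

Invariance under a move. The six vertices are six points of `ℝ⁴`, and their unique affine dependence
has coefficients `β`: the oriented volumes of the new 4-simplices and minus those of the old ones
(`IsMove.isSixPoints`). Hence the change of the signed angle sum at a triangle `i` is the signed sum
of the angles at `i` in the 4-simplices on the six points, and its differential is a multiple of one
fixed linear form, `∑ β_s β_t dL_st`, with the factor `S_i / (48 ∏ β_r)` over the vertices `r`
outside `i` (`IsSixPoints.sum_sign_angle`). The move therefore changes `A` by a matrix of rank one.

The face `ABC` has no 4-simplices after the move and `DEF` has none before, so the old row of `ABC`
and the new row of `DEF` are themselves nonzero multiples of this form. So the new matrix arises by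
rescaling the row `ABC`, renaming it `DEF`, and adding multiples of it to other rows
(`IsMove.isRowOperation`). Such an operation keeps the right kernel, changes only one component of
the left kernel, and multiplies a minor through that row by the rescaling factor. This factor is
`-(S_DEF / S_ABC)` times the product of `β` over `D, E, F` divided by the product over `A, B, C`,
which is exactly how `∏ S / ∏ V` changes. -/

namespace FlatFour

open scoped BigOperators

/-! ### Maximal minors -/

section MaximalMinors

open Matrix

variable {F E : Type*}

/-- The rows `r` and the columns `c` select a largest square submatrix of `A` with nonzero
determinant. -/
structure IsMaximalMinor (A : Matrix F E ℝ) {m : ℕ} (r : Fin m → F) (c : Fin m → E) : Prop where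
  det_ne_zero : (A.submatrix r c).det ≠ 0
  largest : ∀ (n : ℕ) (r' : Fin n → F) (c' : Fin n → E), (A.submatrix r' c').det ≠ 0 → n ≤ m

theorem IsMaximalMinor.size_eq {A : Matrix F E ℝ} {m m' : ℕ} {r : Fin m → F} {c : Fin m → E}
    {r' : Fin m' → F} {c' : Fin m' → E} (h : IsMaximalMinor A r c)
    (h' : IsMaximalMinor A r' c') : m' = m :=
  le_antisymm (h.largest _ _ _ h'.det_ne_zero) (h'.largest _ _ _ h.det_ne_zero)

theorem IsMaximalMinor.transpose {A : Matrix F E ℝ} {m : ℕ} {r : Fin m → F} {c : Fin m → E}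
    (h : IsMaximalMinor A r c) : IsMaximalMinor Aᵀ c r where
  det_ne_zero := by
    rw [← transpose_submatrix, det_transpose]
    exact h.det_ne_zero
  largest n r' c' hn := by
    rw [← transpose_submatrix, det_transpose] at hn
    exact h.largest n c' r' hn

/-- All rows are linear combinations of the rows of a maximal minor. -/
theorem IsMaximalMinor.exists_eq_mul {A : Matrix F E ℝ} {m : ℕ} {r : Fin m → F} {c : Fin m → E}
    (h : IsMaximalMinor A r c) : ∃ P : Matrix F (Fin m) ℝ, A = P * A.submatrix r id := by
  set B := A.submatrix r c with hB
  have hu : IsUnit B.det := isUnit_iff_ne_zero.mpr h.det_ne_zero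
  have : Invertible B := B.invertibleOfIsUnitDet hu
  refine ⟨A.submatrix id c * ⅟B, ?_⟩
  ext i a
  -- Bordering `B` by one more row and column gives a larger minor, which vanishes by maximality.
  -- Its Schur complement with respect to `B` is a single entry, and that this entry is zero is the
  -- required formula for `A i a`.
  have hz : (A.submatrix (Sum.elim r fun _ : Fin 1 => i) (Sum.elim c fun _ : Fin 1 => a)).det
      = 0 := by
    by_contra hne
    have hne' : (A.submatrix ((Sum.elim r fun _ : Fin 1 => i) ∘ finSumFinEquiv.symm)
        ((Sum.elim c fun _ : Fin 1 => a) ∘ finSumFinEquiv.symm)).det ≠ 0 := by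
      rw [← submatrix_submatrix, det_submatrix_equiv_self]
      exact hne
    have := h.largest _ _ _ hne'
    omega
  have hblock : A.submatrix (Sum.elim r fun _ : Fin 1 => i) (Sum.elim c fun _ : Fin 1 => a) =
      fromBlocks B (A.submatrix r fun _ => a) (A.submatrix (fun _ => i) c)
        (A.submatrix (fun _ => i) fun _ => a) := by
    ext (x | x) (y | y) <;> rfl
  rw [hblock, det_fromBlocks₁₁, mul_eq_zero, or_iff_right h.det_ne_zero, det_fin_one] at hz
  have h2 := sub_eq_zero.mp hz
  simpa [mul_apply] using h2

theorem IsMaximalMinor.size_eq_rank [Fintype F] [Fintype E] {A : Matrix F E ℝ} {m : ℕ}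
    {r : Fin m → F} {c : Fin m → E} (h : IsMaximalMinor A r c) : m = A.rank := by
  apply le_antisymm
  · have h1 := rank_submatrix_le A r c
    rwa [rank_of_isUnit _ ((isUnit_iff_isUnit_det _).mpr (isUnit_iff_ne_zero.mpr h.det_ne_zero)),
      Fintype.card_fin] at h1
  · obtain ⟨P, hP⟩ := h.exists_eq_mul
    rw [hP]
    refine (rank_mul_le_left _ _).trans ?_
    simpa using rank_le_card_width P

theorem isMaximalMinor_of_size_eq_rank [Fintype F] [Fintype E] {A : Matrix F E ℝ} {m : ℕ}
    {r : Fin m → F} {c : Fin m → E} (h : (A.submatrix r c).det ≠ 0) (hm : m = A.rank) :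
    IsMaximalMinor A r c where
  det_ne_zero := h
  largest n r' c' hn := by
    have h1 := rank_submatrix_le A r' c'
    rw [rank_of_isUnit _ ((isUnit_iff_isUnit_det _).mpr (isUnit_iff_ne_zero.mpr hn)),
      Fintype.card_fin] at h1
    omega

/-- The rows of one maximal minor and the columns of another one form a maximal minor. -/
theorem IsMaximalMinor.mix {A : Matrix F E ℝ} {m : ℕ} {r r' : Fin m → F} {c c' : Fin m → E}
    (h : IsMaximalMinor A r c) (h' : IsMaximalMinor A r' c') : IsMaximalMinor A r c' where
  det_ne_zero h0 := by
    obtain ⟨P, hP⟩ := h.exists_eq_mul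
    refine h'.det_ne_zero ?_
    -- All rows are combinations of the rows `r`, also after restriction to the columns `c'`; a
    -- singular mixed minor would make the minor of `r'` and `c'` singular.
    have : A.submatrix r' c' = P.submatrix r' id * A.submatrix r c' := by
      conv_lhs => rw [hP]
      rfl
    rw [this, det_mul, h0, mul_zero]
  largest := h.largest

/-- The determinant of the coordinates `c` of the vectors `u`. -/
noncomputable def coordDet {n : ℕ} (c : Fin n → E) (u : Fin n → E → ℝ) : ℝ :=
  (Matrix.of fun i j => u i (c j)).det

/-! ### Complementary minors of a matrix and of its kernel. -/

section Kernel

variable {m l : ℕ}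

/-- Multiply the square matrix with the rows of `R` above the vectors `u`, its columns ordered by
`c`, by the block matrix whose left column is `Rᵀ` and whose right column is `(0, 1)`. The product
is block triangular, since `u Rᵀ = 0`, with the diagonal blocks `R Rᵀ` and the complementary
coordinates of `u`. -/
theorem fromRows_mul_eq (R : Matrix (Fin m) E ℝ) [Fintype E] (u : Fin l → E → ℝ)
    (hu : ∀ j, R *ᵥ u j = 0) (c : Fin m ⊕ Fin l ≃ E) :
    ((fromRows R (of u)).submatrix id c).det * (R.submatrix id (c ∘ Sum.inl)).det =
      (R * Rᵀ).det * coordDet (c ∘ Sum.inr) u := by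
  have hY : (fromBlocks (R.submatrix id (c ∘ Sum.inl))ᵀ 0 (R.submatrix id (c ∘ Sum.inr))ᵀ 1).det =
      (R.submatrix id (c ∘ Sum.inl)).det := by
    rw [det_fromBlocks_zero₁₂, det_one, mul_one, det_transpose]
  rw [← hY, ← det_mul]
  have hX : (fromRows R (of u)).submatrix id c =
      fromBlocks (R.submatrix id (c ∘ Sum.inl)) (R.submatrix id (c ∘ Sum.inr))
        (of fun i j => u i (c (Sum.inl j))) (of fun i j => u i (c (Sum.inr j))) := by
    ext (x | x) (y | y) <;> rfl
  have h11 : R.submatrix id (c ∘ Sum.inl) * (R.submatrix id (c ∘ Sum.inl))ᵀ +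
      R.submatrix id (c ∘ Sum.inr) * (R.submatrix id (c ∘ Sum.inr))ᵀ = R * Rᵀ := by
    ext i j
    simp only [Matrix.add_apply, mul_apply, transpose_apply, submatrix_apply, id, Function.comp]
    rw [← c.sum_comp, Fintype.sum_sum_type]
  have h21 : (of fun i j => u i (c (Sum.inl j)) : Matrix (Fin l) (Fin m) ℝ) *
      (R.submatrix id (c ∘ Sum.inl))ᵀ + (of fun i j => u i (c (Sum.inr j)) :
        Matrix (Fin l) (Fin l) ℝ) * (R.submatrix id (c ∘ Sum.inr))ᵀ = 0 := by
    ext i j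
    have := congrFun (hu i) j
    simp only [mulVec, dotProduct] at this
    rw [← c.sum_comp, Fintype.sum_sum_type] at this
    simp only [Matrix.add_apply, mul_apply, transpose_apply, submatrix_apply, id, Function.comp,
      of_apply]
    rw [Matrix.zero_apply]
    refine Eq.trans ?_ this
    simp only [mul_comm]
  rw [hX, fromBlocks_multiply, h11, h21]
  simp only [Matrix.mul_zero, Matrix.mul_one, zero_add]
  rw [det_fromBlocks_zero₂₁]
  rfl

/-- Both orderings of the columns are compared with the same square matrix of `R` and `u` by
`fromRows_mul_eq`; reordering its columns only costs the sign of a permutation, which does not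
depend on `u`. The common factor `det (R Rᵀ)` cancels because `R` has independent rows. -/
theorem coordDet_mul_det [Fintype E] [DecidableEq E] (R : Matrix (Fin m) E ℝ)
    (c c' : Fin m ⊕ Fin l ≃ E) (hc : (R.submatrix id (c ∘ Sum.inl)).det ≠ 0) :
    ∃ ε : ℤˣ, ∀ u : Fin l → E → ℝ, (∀ j, R *ᵥ u j = 0) →
      coordDet (c' ∘ Sum.inr) u * (R.submatrix id (c ∘ Sum.inl)).det =
        ((ε : ℤ) : ℝ) * (coordDet (c ∘ Sum.inr) u * (R.submatrix id (c' ∘ Sum.inl)).det) := by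
  refine ⟨Equiv.Perm.sign (c'.trans c.symm), fun u hu => ?_⟩
  have h1 := fromRows_mul_eq R u hu c
  have h2 := fromRows_mul_eq R u hu c'
  have h3 : ((fromRows R (of u)).submatrix id c').det =
      ((Equiv.Perm.sign (c'.trans c.symm) : ℤ) : ℝ) *
        ((fromRows R (of u)).submatrix id c).det := by
    rw [← det_permute', submatrix_submatrix]
    congr 2
    ext i
    simp
  have h4 : (R * Rᵀ).det ≠ 0 := by
    have hu : IsUnit (R.submatrix id (c ∘ Sum.inl)) :=
      (isUnit_iff_isUnit_det _).mpr (isUnit_iff_ne_zero.mpr hc)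
    have hinj : Function.Injective fun v : Fin m → ℝ => v ᵥ* R := by
      intro v w hvw
      apply vecMul_injective_of_isUnit hu
      ext i
      exact congrFun hvw (c (Sum.inl i))
    have := PosDef.mul_conjTranspose_self R hinj
    rw [conjTranspose_eq_transpose_of_trivial] at this
    exact this.det_pos.ne'
  apply mul_left_cancel₀ h4
  linear_combination
    -(R.submatrix id (c ∘ Sum.inl)).det * h2 +
      ((Equiv.Perm.sign (c'.trans c.symm) : ℤ) : ℝ) * (R.submatrix id (c' ∘ Sum.inl)).det * h1
      + (R.submatrix id (c ∘ Sum.inl)).det * (R.submatrix id (c' ∘ Sum.inl)).det * h3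

end Kernel

/-! ### Exchange of maximal minors. -/

section Ratio

variable {m k l : ℕ}

/-- Changing the columns of a maximal minor. -/
theorem coordDet_div_det [Fintype E] [DecidableEq E] (A : Matrix F E ℝ) (r : Fin m → F)
    (c c' : Fin m ⊕ Fin l ≃ E)
    (h : IsMaximalMinor A r (c ∘ Sum.inl)) (h' : IsMaximalMinor A r (c' ∘ Sum.inl)) :
    ∃ ε : ℤˣ, ∀ u : Fin l → E → ℝ, (∀ j, A *ᵥ u j = 0) →
      coordDet (c' ∘ Sum.inr) u / (A.submatrix r (c' ∘ Sum.inl)).det =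
        ((ε : ℤ) : ℝ) * (coordDet (c ∘ Sum.inr) u / (A.submatrix r (c ∘ Sum.inl)).det) := by
  obtain ⟨ε, hε⟩ := coordDet_mul_det (A.submatrix r id) c c' h.det_ne_zero
  refine ⟨ε, fun u hu => ?_⟩
  have := hε u fun j => by
    ext i
    exact congrFun (hu j) (r i)
  rw [submatrix_submatrix, submatrix_submatrix] at this
  simp only [Function.comp_id, Function.id_comp] at this
  have h1 := h.det_ne_zero
  have h2 := h'.det_ne_zero
  rw [← mul_div_assoc, div_eq_div_iff h2 h1, this]
  ring

/-- The ratio of complementary coordinate determinants of the two kernels to a maximal minor does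
not depend on the maximal minor, up to a sign. -/
theorem coordDet_ratio_eq [Fintype F] [Fintype E] [DecidableEq F] [DecidableEq E]
    (A : Matrix F E ℝ) (r r' : Fin m ⊕ Fin k ≃ F)
    (c c' : Fin m ⊕ Fin l ≃ E) (h : IsMaximalMinor A (r ∘ Sum.inl) (c ∘ Sum.inl))
    (h' : IsMaximalMinor A (r' ∘ Sum.inl) (c' ∘ Sum.inl)) :
    ∃ ε : ℤˣ, ∀ (s : Fin k → F → ℝ) (u : Fin l → E → ℝ), (∀ j, Aᵀ *ᵥ s j = 0) →
      (∀ j, A *ᵥ u j = 0) →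
      coordDet (r' ∘ Sum.inr) s * coordDet (c' ∘ Sum.inr) u /
          (A.submatrix (r' ∘ Sum.inl) (c' ∘ Sum.inl)).det =
        ((ε : ℤ) : ℝ) * (coordDet (r ∘ Sum.inr) s * coordDet (c ∘ Sum.inr) u /
          (A.submatrix (r ∘ Sum.inl) (c ∘ Sum.inl)).det) := by
  have hm := h.mix h'
  obtain ⟨ε₁, h₁⟩ := coordDet_div_det A (r ∘ Sum.inl) c c' h hm
  obtain ⟨ε₂, h₂⟩ := coordDet_div_det Aᵀ (c' ∘ Sum.inl) r r' hm.transpose h'.transpose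
  refine ⟨ε₁ * ε₂, fun s u hs hu => ?_⟩
  have e₁ := h₁ u hu
  have e₂ := h₂ s hs
  rw [← transpose_submatrix, ← transpose_submatrix, det_transpose, det_transpose] at e₂
  rw [mul_comm, mul_div_assoc, e₂]
  have : coordDet (r ∘ Sum.inr) s * coordDet (c ∘ Sum.inr) u /
      (A.submatrix (r ∘ Sum.inl) (c ∘ Sum.inl)).det = coordDet (r ∘ Sum.inr) s *
      (coordDet (c ∘ Sum.inr) u / (A.submatrix (r ∘ Sum.inl) (c ∘ Sum.inl)).det) := by ring
  rw [this, Units.val_mul, Int.cast_mul]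
  linear_combination ((ε₂ : ℤ) : ℝ) * coordDet (r ∘ Sum.inr) s * e₁

/-- Every nonzero row belongs to some maximal minor. -/
theorem IsMaximalMinor.exists_row (A : Matrix F E ℝ) (r : Fin m ⊕ Fin k ≃ F) (c : Fin m → E)
    (h : IsMaximalMinor A (r ∘ Sum.inl) c) (i : F) (hi : A i ≠ 0) :
    ∃ r' : Fin m ⊕ Fin k ≃ F, IsMaximalMinor A (r' ∘ Sum.inl) c ∧ ∃ d, r' (Sum.inl d) = i := by
  rcases hri : r.symm i with d | d
  · exact ⟨r, h, d, by rw [← hri, Equiv.apply_symm_apply]⟩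
  · have hrd : r (Sum.inr d) = i := by rw [← hri, Equiv.apply_symm_apply]
    obtain ⟨P, hP⟩ := h.exists_eq_mul
    have hrow : ∀ a, A i a = ∑ j, P i j * A (r (Sum.inl j)) a := fun a => by
      conv_lhs => rw [hP]
      rfl
    obtain ⟨j, hj⟩ : ∃ j, P i j ≠ 0 := by
      by_contra! hall
      exact hi (funext fun a => by simp [hrow, hall])
    -- The row `i` replaces a selected row that occurs in it with the nonzero coefficient `P i j`;
    -- the determinant is then multiplied by this coefficient.
    refine ⟨(Equiv.swap (Sum.inl j) (Sum.inr d)).trans r, ⟨?_, h.largest⟩, j, by simp [hrd]⟩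
    have hup : A.submatrix ((Equiv.swap (Sum.inl j) (Sum.inr d)).trans r ∘ Sum.inl) c =
        (A.submatrix (r ∘ Sum.inl) c).updateRow j
          (∑ x, P i x • (A.submatrix (r ∘ Sum.inl) c) x) := by
      ext x y
      rcases eq_or_ne x j with rfl | hx
      · simp [hrd, hrow]
      · rw [updateRow_ne hx]
        simp [Equiv.swap_apply_of_ne_of_ne, hx]
    rw [hup, det_updateRow_sum]
    exact mul_ne_zero hj h.det_ne_zero

end Ratio

/-! ### Row operations with one pivot row. -/

section RowOperation

variable {F' E' : Type*}

/-- `A'` is obtained from `A` by multiplying the row `i₀` by a nonzero factor and adding multiples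
of it to the other rows. -/
structure IsRowOperation (A : Matrix F E ℝ) (A' : Matrix F' E' ℝ) (eF : F ≃ F') (eE : E ≃ E')
    (i₀ : F) (γ : F → ℝ) : Prop where
  ne_zero : γ i₀ ≠ 0
  apply_self : ∀ a, A' (eF i₀) (eE a) = γ i₀ * A i₀ a
  apply_ne : ∀ i, i ≠ i₀ → ∀ a, A' (eF i) (eE a) = A i a + γ i * A i₀ a

variable {A : Matrix F E ℝ} {A' : Matrix F' E' ℝ} {eF : F ≃ F'} {eE : E ≃ E'} {i₀ : F} {γ : F → ℝ}

theorem IsRowOperation.mulVec_eq_zero_iff [Fintype E] [Fintype E']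
    (h : IsRowOperation A A' eF eE i₀ γ) (u : E' → ℝ) :
    A' *ᵥ u = 0 ↔ A *ᵥ (u ∘ eE) = 0 := by
  have h0 : ∀ x, (A' *ᵥ u) x = ∑ a, A' x (eE a) * u (eE a) := fun x =>
    (eE.sum_comp fun b => A' x b * u b).symm
  have h1 : (A' *ᵥ u) (eF i₀) = γ i₀ * (A *ᵥ (u ∘ eE)) i₀ := by
    rw [h0]
    simp only [h.apply_self, mulVec, dotProduct, Finset.mul_sum, mul_assoc, Function.comp]
  have h2 : ∀ i, i ≠ i₀ → (A' *ᵥ u) (eF i) = (A *ᵥ (u ∘ eE)) i + γ i * (A *ᵥ (u ∘ eE)) i₀ := by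
    intro i hi
    rw [h0]
    simp only [h.apply_ne i hi, mulVec, dotProduct, Finset.mul_sum, ← Finset.sum_add_distrib,
      Function.comp]
    exact Finset.sum_congr rfl fun a _ => by ring
  constructor
  · intro hz
    have hz0 : (A *ᵥ (u ∘ eE)) i₀ = 0 := by
      rw [hz] at h1
      simpa [h.ne_zero] using h1.symm
    ext i
    rcases eq_or_ne i i₀ with rfl | hi
    · exact hz0
    · have := h2 i hi
      rw [hz, hz0] at this
      simpa using this.symm
  · intro hz
    ext x
    obtain ⟨i, rfl⟩ := eF.surjective x
    rcases eq_or_ne i i₀ with rfl | hi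
    · rw [h1, hz]
      simp
    · rw [h2 i hi, hz]
      simp

/-- In a left combination of the new rows the row `i₀` of `A` occurs in every term, with total
coefficient `∑ j, γ j * s (eF j)`; the other rows keep their coefficients. So only one component of
a left kernel vector changes. -/
theorem IsRowOperation.vecMul_apply [Fintype F] [Fintype F'] [DecidableEq F]
    (h : IsRowOperation A A' eF eE i₀ γ) (s : F' → ℝ) (a : E) :
    (A'ᵀ *ᵥ s) (eE a) = (Aᵀ *ᵥ fun i => if i = i₀ then ∑ j, γ j * s (eF j) else s (eF i)) a := by
  have h0 : (A'ᵀ *ᵥ s) (eE a) = ∑ i, A' (eF i) (eE a) * s (eF i) :=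
    (eF.sum_comp fun b => A' b (eE a) * s b).symm
  rw [h0]
  simp only [mulVec, dotProduct, transpose_apply]
  rw [← Finset.add_sum_erase _ _ (Finset.mem_univ i₀),
    ← Finset.add_sum_erase Finset.univ (fun i => A i a * _) (Finset.mem_univ i₀), if_pos rfl,
    ← Finset.add_sum_erase _ (fun j => γ j * s (eF j)) (Finset.mem_univ i₀), h.apply_self, mul_add,
    Finset.mul_sum, add_assoc, ← Finset.sum_add_distrib]
  congr 1
  · ring
  · refine Finset.sum_congr rfl fun i hi => ?_
    rw [h.apply_ne i (Finset.ne_of_mem_erase hi), if_neg (Finset.ne_of_mem_erase hi)]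
    ring

/-- The pivot row must be among the selected ones: only then are the added multiples elementary row
operations inside the minor, and the rescaling is what remains. -/
theorem IsRowOperation.det_submatrix (h : IsRowOperation A A' eF eE i₀ γ) {m : ℕ} (r : Fin m → F)
    (hr : Function.Injective r) (c : Fin m → E) (d : Fin m) (hd : r d = i₀) :
    (A'.submatrix (eF ∘ r) (eE ∘ c)).det = γ i₀ * (A.submatrix r c).det := by
  have hupd := det_updateRow_sum (A.submatrix r c) d (Pi.single d (γ i₀))
  rw [Pi.single_eq_same, smul_eq_mul] at hupd
  rw [← hupd]
  have hsum : ∑ x, (Pi.single d (γ i₀) : Fin m → ℝ) x • (A.submatrix r c) x =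
      γ i₀ • (A.submatrix r c) d := by
    rw [Finset.sum_eq_single d] <;> simp +contextual
  rw [hsum]
  refine det_eq_of_forall_row_eq_smul_add_const
    -- The row that is added has already been multiplied by `γ i₀`, which explains the denominator.
    (fun i => if i = d then 0 else γ (r i) / γ i₀) d (by simp) fun i j => ?_
  rcases eq_or_ne i d with rfl | hi
  · simp [hd, h.apply_self]
  · have hne : r i ≠ i₀ := fun h' => hi (hr (h'.trans hd.symm))
    have := h.ne_zero
    simp only [submatrix_apply, Function.comp, h.apply_ne _ hne, updateRow_ne hi, if_neg hi,
      updateRow_self, Pi.smul_apply, smul_eq_mul, hd]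
    field_simp

theorem IsRowOperation.rank_eq [Fintype E] [Fintype E']
    (h : IsRowOperation A A' eF eE i₀ γ) : A'.rank = A.rank := by
  have hA' := LinearMap.finrank_range_add_finrank_ker A'.mulVecLin
  have hA := LinearMap.finrank_range_add_finrank_ker A.mulVecLin
  let e : LinearMap.ker A'.mulVecLin ≃ₗ[ℝ] LinearMap.ker A.mulVecLin :=
    (LinearEquiv.funCongrLeft ℝ ℝ eE).ofSubmodules _ _ (by
      ext u
      rw [Submodule.mem_map_equiv]
      simp only [LinearMap.mem_ker, mulVecLin_apply]
      rw [h.mulVec_eq_zero_iff]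
      rw [show ((LinearEquiv.funCongrLeft ℝ ℝ eE).symm u) ∘ eE = u from
        (LinearEquiv.funCongrLeft ℝ ℝ eE).apply_symm_apply u])
  have h1 := e.finrank_eq
  have h2 : Module.finrank ℝ (E' → ℝ) = Module.finrank ℝ (E → ℝ) := by
    simp [Fintype.card_congr eE]
  simp only [Matrix.rank]
  omega

/-- The effect of a row operation on the ratio of complementary coordinate determinants of the two
kernels to a maximal minor. -/
theorem IsRowOperation.coordDet_ratio_eq [Fintype F] [Fintype E] [DecidableEq F] [DecidableEq E]
    [Fintype F'] [Fintype E'] [DecidableEq F'] [DecidableEq E']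
    (h : IsRowOperation A A' eF eE i₀ γ) (h0 : A i₀ ≠ 0)
    {m k l m' k' l' : ℕ} (r : Fin m ⊕ Fin k ≃ F) (c : Fin m ⊕ Fin l ≃ E)
    (r' : Fin m' ⊕ Fin k' ≃ F') (c' : Fin m' ⊕ Fin l' ≃ E')
    (hm : IsMaximalMinor A (r ∘ Sum.inl) (c ∘ Sum.inl))
    (hm' : IsMaximalMinor A' (r' ∘ Sum.inl) (c' ∘ Sum.inl)) :
    m' = m ∧ ∃ (hk : k' = k) (hl : l' = l) (ε : ℤˣ),
      ∀ (s : Fin k → F → ℝ) (u : Fin l → E → ℝ) (s' : Fin k → F' → ℝ) (u' : Fin l → E' → ℝ),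
      (∀ j, Aᵀ *ᵥ s j = 0) → (∀ j, A *ᵥ u j = 0) → (∀ j, A'ᵀ *ᵥ s' j = 0) →
      (∀ j, A' *ᵥ u' j = 0) → (∀ j i, i ≠ i₀ → s' j (eF i) = s j i) →
      (∀ j a, u' j (eE a) = u j a) →
      coordDet (r' ∘ Sum.inr) (s' ∘ Fin.cast hk) * coordDet (c' ∘ Sum.inr) (u' ∘ Fin.cast hl) /
          (A'.submatrix (r' ∘ Sum.inl) (c' ∘ Sum.inl)).det =
        ((ε : ℤ) : ℝ) * (coordDet (r ∘ Sum.inr) s * coordDet (c ∘ Sum.inr) u /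
          (γ i₀ * (A.submatrix (r ∘ Sum.inl) (c ∘ Sum.inl)).det)) := by
  have hmm : m' = m := by rw [hm.size_eq_rank, hm'.size_eq_rank, h.rank_eq]
  subst hmm
  have hk : k' = k := by
    have h1 := Fintype.card_congr r
    have h2 := Fintype.card_congr r'
    have h3 := Fintype.card_congr eF
    simp at h1 h2
    omega
  have hl : l' = l := by
    have h1 := Fintype.card_congr c
    have h2 := Fintype.card_congr c'
    have h3 := Fintype.card_congr eE
    simp at h1 h2
    omega
  subst hk hl
  -- The minor is moved so that it contains the pivot row. Its determinant is then multiplied by `γ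
  -- i₀`, and the complementary components of left kernel vectors avoid `i₀`, so they agree before
  -- and after.
  obtain ⟨r₁, hr₁, d, hd⟩ := hm.exists_row A r _ i₀ h0
  have hdet := h.det_submatrix (r₁ ∘ Sum.inl) (r₁.injective.comp Sum.inl_injective)
    (c ∘ Sum.inl) d hd
  have hr₁' : IsMaximalMinor A' (r₁.trans eF ∘ Sum.inl) (c.trans eE ∘ Sum.inl) := by
    refine isMaximalMinor_of_size_eq_rank ?_ hm'.size_eq_rank
    exact hdet.trans_ne (mul_ne_zero h.ne_zero hr₁.det_ne_zero)
  obtain ⟨ε₁, h₁⟩ := FlatFour.coordDet_ratio_eq A r r₁ c c hm hr₁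
  obtain ⟨ε₂, h₂⟩ := FlatFour.coordDet_ratio_eq A' (r₁.trans eF) r' (c.trans eE) c' hr₁' hm'
  refine ⟨rfl, rfl, rfl, ε₂ * ε₁, fun s u s' u' hs hu hs' hu' hss huu => ?_⟩
  have e₁ := h₁ s u hs hu
  have e₂ := h₂ s' u' hs' hu'
  have hsd : coordDet (r₁.trans eF ∘ Sum.inr) s' = coordDet (r₁ ∘ Sum.inr) s := by
    unfold coordDet
    congr 1
    ext i j
    refine hss i _ fun h' => ?_
    have := r₁.injective (h'.trans hd.symm)
    simp at this
  have hud : coordDet (c.trans eE ∘ Sum.inr) u' = coordDet (c ∘ Sum.inr) u := by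
    unfold coordDet
    congr 1
    ext i j
    exact huu i _
  have hdet' : (A'.submatrix (r₁.trans eF ∘ Sum.inl) (c.trans eE ∘ Sum.inl)).det =
      γ i₀ * (A.submatrix (r₁ ∘ Sum.inl) (c ∘ Sum.inl)).det := hdet
  rw [hsd, hud, hdet'] at e₂
  have e₃ : ∀ {p q : ℝ}, p / (γ i₀ * q) = (γ i₀)⁻¹ * (p / q) := fun {p q} => by
    rw [div_mul_eq_div_div_swap, div_eq_inv_mul]
  rw [e₃, e₁] at e₂
  rw [e₃, Units.val_mul, Int.cast_mul]
  exact e₂.trans (by ring)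

end RowOperation

end MaximalMinors

/-! ### Cayley–Menger determinants -/

section CayleyMenger

open FlatManifold Matrix

theorem cayleyMenger_reindex {ι κ : Type*} [Fintype ι] [DecidableEq ι] [Fintype κ] [DecidableEq κ]
    (e : ι ≃ κ) (D : κ → κ → ℝ) :
    cayleyMenger (fun a b => D (e a) (e b)) = cayleyMenger D := by
  unfold cayleyMenger
  rw [← det_submatrix_equiv_self (Equiv.optionCongr e)]
  congr 1
  ext (_ | a) (_ | b) <;> rfl

/-- The equivalence that singles out the border and the first point. -/
def borderEquiv (ι : Type*) : Fin 2 ⊕ ι ≃ Option (Option ι) where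
  toFun := Sum.elim ![none, some none] fun i => some (some i)
  invFun
    | none => Sum.inl 0
    | some none => Sum.inl 1
    | some (some i) => Sum.inr i
  left_inv := by
    rintro (a | i)
    · fin_cases a <;> rfl
    · rfl
  right_inv := by rintro (_ | _ | i) <;> rfl

/-- Schur complement of the 2 × 2 block formed by the border and the point `none`, whose determinant
is `-1`. For squared distances the remaining entries are `-2` times the inner products of the
vectors from that point. -/
theorem cayleyMenger_option {ι : Type*} [Fintype ι] [DecidableEq ι]
    (D : Option ι → Option ι → ℝ) :
    cayleyMenger D = -(of fun i j : ι => D (some i) (some j) - D (some i) none - D none (some j) +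
      D none none).det := by
  unfold cayleyMenger
  rw [← det_submatrix_equiv_self (borderEquiv ι)]
  have hinv : !![0, 1; 1, D none none] * !![-D none none, 1; 1, 0] = 1 := by
    ext i j
    fin_cases i <;> fin_cases j <;> simp [mul_apply, Fin.sum_univ_two]
  let _ : Invertible !![0, 1; 1, D none none] := invertibleOfRightInverse _ _ hinv
  trans (fromBlocks !![0, 1; 1, D none none] (of fun a j => ![1, D none (some j)] a)
    (of fun i b => ![1, D (some i) none] b) (of fun i j => D (some i) (some j))).det
  · congr 1
    ext (a | i) (b | j)
    · fin_cases a <;> fin_cases b <;> rfl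
    · fin_cases a <;> rfl
    · fin_cases b <;> rfl
    · rfl
  rw [det_fromBlocks₁₁, det_fin_two_of]
  have : ⅟ !![0, 1; 1, D none none] = !![-D none none, 1; 1, 0] := rfl
  rw [this]
  have hD : (of fun i j => D (some i) (some j)) - (of fun i b => ![1, D (some i) none] b) *
      !![-D none none, 1; 1, 0] * (of fun a j => ![1, D none (some j)] a) =
      of fun i j : ι => D (some i) (some j) - D (some i) none - D none (some j) +
        D none none := by
    ext i j
    simp only [Matrix.sub_apply, mul_apply, Fin.sum_univ_two, of_apply, cons_val_zero, cons_val_one,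
      cons_val', empty_val', cons_val_fin_one]
    ring
  rw [hD]
  ring

theorem cayleyMenger_fin {n : ℕ} (D : Fin (n + 1) → Fin (n + 1) → ℝ) :
    cayleyMenger D = -(of fun i j : Fin n => D i.succ j.succ - D i.succ 0 - D 0 j.succ +
      D 0 0).det := by
  rw [← cayleyMenger_reindex (finSuccEquiv n).symm, cayleyMenger_option]
  simp

variable {V : Type*} [DecidableEq V]

/-- Arrays of squared distances. -/
structure IsDist (D : V → V → ℝ) : Prop where
  symm : ∀ u v, D u v = D v u
  self : ∀ u, D u u = 0

/-- The Cayley–Menger determinant of a finite set of vertices. -/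
noncomputable def cm (i : Finset V) (D : V → V → ℝ) : ℝ :=
  cayleyMenger fun a b : i => D a b

/-- The Cayley–Menger determinant with the rows `i ∪ {p}` and the columns `i ∪ {q}`. -/
noncomputable def mixed (i : Finset V) (p q : V) (D : V → V → ℝ) : ℝ :=
  cayleyMenger fun a b : Option i => D (a.elim p (↑)) (b.elim q (↑))

/-- The inner product of `p - a` and `q - a`. -/
noncomputable def gram (a p q : V) (D : V → V → ℝ) : ℝ := (D a p + D a q - D p q) / 2

theorem cm_eq {n : ℕ} (t : Fin n → V) (ht : Function.Injective t) (D : V → V → ℝ) :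
    cm (Finset.univ.image t) D = cayleyMenger fun a b => D (t a) (t b) := by
  let e : Fin n ≃ (Finset.univ.image t : Finset V) :=
    Equiv.ofBijective (fun a => ⟨t a, Finset.mem_image_of_mem _ (Finset.mem_univ a)⟩)
      ⟨fun a b h => ht (congrArg Subtype.val h), by
        rintro ⟨v, hv⟩
        obtain ⟨a, -, rfl⟩ := Finset.mem_image.mp hv
        exact ⟨a, rfl⟩⟩
  exact (cayleyMenger_reindex e fun a b => D a b).symm

theorem mixed_eq {n : ℕ} (t : Fin n → V) (ht : Function.Injective t) (p q : V)
    (D : V → V → ℝ) : mixed (Finset.univ.image t) p q D =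
      cayleyMenger fun a b : Option (Fin n) => D (a.elim p t) (b.elim q t) := by
  let e : Fin n ≃ (Finset.univ.image t : Finset V) :=
    Equiv.ofBijective (fun a => ⟨t a, Finset.mem_image_of_mem _ (Finset.mem_univ a)⟩)
      ⟨fun a b h => ht (congrArg Subtype.val h), by
        rintro ⟨v, hv⟩
        obtain ⟨a, -, rfl⟩ := Finset.mem_image.mp hv
        exact ⟨a, rfl⟩⟩
  rw [mixed, ← cayleyMenger_reindex (Equiv.optionCongr e)]
  congr 1
  ext (_ | a) (_ | b) <;> rfl

theorem cm_gram {D : V → V → ℝ} (hD : IsDist D) {n : ℕ} (t : Fin (n + 1) → V)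
    (ht : Function.Injective t) : cm (Finset.univ.image t) D =
      -(-2) ^ n * (of fun i j : Fin n => gram (t 0) (t i.succ) (t j.succ) D).det := by
  have h : (of fun i j : Fin n => D (t i.succ) (t j.succ) - D (t i.succ) (t 0) -
      D (t 0) (t j.succ) + D (t 0) (t 0)) =
      (-2 : ℝ) • of fun i j : Fin n => gram (t 0) (t i.succ) (t j.succ) D := by
    ext i j
    simp only [of_apply, Matrix.smul_apply, smul_eq_mul, gram, hD.self, hD.symm (t i.succ) (t 0)]
    ring
  rw [cm_eq t ht, cayleyMenger_fin, h, det_smul, Fintype.card_fin, neg_mul]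

theorem mixed_self {i : Finset V} {q : V} (hq : q ∉ i) (D : V → V → ℝ) :
    mixed i q q D = cm (insert q i) D := by
  let e : Option i ≃ (insert q i : Finset V) := (Finset.subtypeInsertEquivOption hq).symm
  have he : ∀ a, (e a : V) = a.elim q (↑) := by rintro (_ | a) <;> rfl
  rw [cm, ← cayleyMenger_reindex e]
  simp only [he]
  rfl

theorem mixed_comm {D : V → V → ℝ} (hD : IsDist D) (i : Finset V) (p q : V) :
    mixed i p q D = mixed i q p D := by
  unfold mixed cayleyMenger
  rw [← det_transpose]
  congr 1
  ext (_ | a) (_ | b) <;> simp [hD.symm]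

/-! ### Identities for a triangle, a tetrahedron and a 4-simplex in terms of inner products. -/

section Explicit

variable {D : V → V → ℝ} {a b c d e : V}

theorem cm_three (hD : IsDist D) (h : [a, b, c].Nodup) :
    cm {a, b, c} D = -4 * (gram a b b D * gram a c c D - gram a b c D ^ 2) := by
  have ht : Function.Injective ![a, b, c] := by
    rw [← List.nodup_ofFn]
    simpa [List.ofFn_succ] using h
  have hi : Finset.univ.image ![a, b, c] = {a, b, c} := by
    ext
    simp [Fin.exists_fin_succ, eq_comm]
  rw [← hi, cm_eq _ ht, cayleyMenger_fin, det_fin_two]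
  simp [gram, hD.self, hD.symm b a, hD.symm c a, hD.symm c b]
  ring

/-- The determinant of a symmetric bilinear form on the vectors `u, w, x` and `u, w, y`. -/
def det₃ (uu uw ww ux wx uy wy xy : ℝ) : ℝ :=
  (uu * ww - uw ^ 2) * xy - uu * wx * wy - ww * ux * uy + uw * (ux * wy + wx * uy)

theorem mixed_three (hD : IsDist D) (h : [a, b, c].Nodup) (p q : V) :
    mixed {a, b, c} p q D = 8 * det₃ (gram a b b D) (gram a b c D) (gram a c c D) (gram a b p D)
      (gram a c p D) (gram a b q D) (gram a c q D) (gram a p q D) := by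
  have ht : Function.Injective ![a, b, c] := by
    rw [← List.nodup_ofFn]
    simpa [List.ofFn_succ] using h
  have hi : Finset.univ.image ![a, b, c] = {a, b, c} := by
    ext
    simp [Fin.exists_fin_succ, eq_comm]
  let e : Option (Fin 3) ≃ Fin 4 :=
    { toFun := fun x => x.elim 3 (Fin.castSucc)
      invFun := ![some 0, some 1, some 2, none]
      left_inv := by
        rintro (_ | x)
        · rfl
        · fin_cases x <;> rfl
      right_inv := fun x => by fin_cases x <;> rfl }
  have he : (fun x y : Option (Fin 3) => D (x.elim p ![a, b, c]) (y.elim q ![a, b, c])) =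
      fun x y => D (![a, b, c, p] (e x)) (![a, b, c, q] (e y)) := by
    funext x y
    congr 1
    · rcases x with _ | x
      · rfl
      · fin_cases x <;> rfl
    · rcases y with _ | y
      · rfl
      · fin_cases y <;> rfl
  rw [← hi, mixed_eq _ ht, he,
    cayleyMenger_reindex e fun x y => D (![a, b, c, p] x) (![a, b, c, q] y), cayleyMenger_fin,
    det_fin_three]
  simp [gram, det₃, hD.self, hD.symm b a, hD.symm c a, hD.symm c b, hD.symm p]
  ring

theorem cm_four (hD : IsDist D) (h : [a, b, c, d].Nodup) :
    cm {a, b, c, d} D = 8 * det₃ (gram a b b D) (gram a b c D) (gram a c c D) (gram a b d D)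
      (gram a c d D) (gram a b d D) (gram a c d D) (gram a d d D) := by
  have hd : d ∉ ({a, b, c} : Finset V) := by
    simp at h ⊢
    tauto
  have hi : ({a, b, c, d} : Finset V) = insert d {a, b, c} := by
    ext
    simp
    tauto
  have h' : [a, b, c].Nodup := by
    simp at h ⊢
    tauto
  rw [hi, ← mixed_self hd, mixed_three hD h']

/-- Desnanot–Jacobi identity for the Cayley–Menger matrix of a 4-simplex. -/
theorem cm_mul_cm_sub (hD : IsDist D) {p q : V} (h : [a, b, c, p, q].Nodup) :
    cm {a, b, c, p} D * cm {a, b, c, q} D - mixed {a, b, c} p q D ^ 2 =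
      cm {a, b, c} D * cm {a, b, c, p, q} D := by
  have ht : Function.Injective ![a, b, c, p, q] := by
    rw [← List.nodup_ofFn]
    simpa [List.ofFn_succ] using h
  have hi : Finset.univ.image ![a, b, c, p, q] = {a, b, c, p, q} := by
    ext
    simp [Fin.exists_fin_succ, eq_comm]
  have hs : ∀ x y, gram a x y D = gram a y x D := fun x y => by
    rw [gram, gram, hD.symm x y, add_comm (D a x)]
  have h₁ : [a, b, c, p].Nodup := by
    simp at h ⊢
    tauto
  have h₂ : [a, b, c, q].Nodup := by
    simp at h ⊢
    tauto
  have h₃ : [a, b, c].Nodup := by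
    simp at h ⊢
    tauto
  rw [← hi, cm_gram hD _ ht, cm_four hD h₁, cm_four hD h₂, cm_three hD h₃, mixed_three hD h₃,
    det_succ_row_zero]
  simp [Fin.sum_univ_succ, det_fin_three, Fin.succAbove, det₃, hs c b, hs p b, hs q b, hs p c,
    hs q c, hs q p]
  ring

/-- The areas of the tetrahedra of a 4-simplex, projected to the plane of one of them. -/
theorem cm_four_eq_sum_mixed (hD : IsDist D) {p : V} (h : [a, b, c, d, p].Nodup) :
    cm {a, b, c, d} D = mixed {b, c, d} p a D + mixed {a, c, d} p b D + mixed {a, b, d} p c D +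
      mixed {a, b, c} p d D := by
  have h₁ : [a, b, c, d].Nodup := by
    simp at h ⊢
    tauto
  have h₂ : [b, c, d].Nodup := by
    simp at h ⊢
    tauto
  have h₃ : [a, c, d].Nodup := by
    simp at h ⊢
    tauto
  have h₄ : [a, b, d].Nodup := by
    simp at h ⊢
    tauto
  have h₅ : [a, b, c].Nodup := by
    simp at h ⊢
    tauto
  rw [cm_four hD h₁, mixed_three hD h₂, mixed_three hD h₃, mixed_three hD h₄, mixed_three hD h₅]
  simp only [gram, det₃, hD.self, hD.symm b a, hD.symm c a, hD.symm c b, hD.symm d a, hD.symm d b,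
    hD.symm d c, hD.symm p]
  ring

end Explicit

/-! Values for points of a Euclidean space. -/

section Points

variable {D : V → V → ℝ} {n : ℕ} {t : Fin (n + 1) → V} {x : Fin (n + 1) → E4}

theorem gram_eq_inner {V : Type*} {D : V → V → ℝ} {t : Fin (n + 1) → V}
    {x : Fin (n + 1) → E4} (h : ∀ i j, D (t i) (t j) = dist (x i) (x j) ^ 2)
    (i j k : Fin (n + 1)) : gram (t i) (t j) (t k) D = inner ℝ (x j - x i) (x k - x i) := by
  have h1 : x j - x k = (x j - x i) - (x k - x i) := by abel
  have h2 := norm_sub_sq_real (x j - x i) (x k - x i)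
  rw [gram, h, h, h, dist_comm (x i), dist_comm (x i), dist_eq_norm, dist_eq_norm, dist_eq_norm,
    h1, h2]
  ring

theorem cm_eq_gram_det (hD : IsDist D) (ht : Function.Injective t)
    (h : ∀ i j, D (t i) (t j) = dist (x i) (x j) ^ 2) : cm (Finset.univ.image t) D =
      -(-2) ^ n * (Matrix.gram ℝ fun i : Fin n => x i.succ - x 0).det := by
  rw [cm_gram hD t ht]
  congr 2
  ext i j
  exact gram_eq_inner h _ _ _

theorem cm_pos (hD : IsDist D) (ht : Function.Injective t)
    (h : ∀ i j, D (t i) (t j) = dist (x i) (x j) ^ 2) (hx : AffineIndependent ℝ x) :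
    0 < (-1) ^ (n + 1) * cm (Finset.univ.image t) D := by
  rw [cm_eq_gram_det hD ht h]
  have hl : LinearIndependent ℝ fun i : Fin n => x i.succ - x 0 :=
    ((affineIndependent_iff_linearIndependent_vsub ℝ x 0).mp hx).comp
      (fun i : Fin n => ⟨i.succ, Fin.succ_ne_zero i⟩) fun i j hij => by simpa using hij
  have := (posDef_gram_of_linearIndependent hl).det_pos
  have h2 : (-1 : ℝ) ^ (n + 1) * -(-2) ^ n = 2 ^ n := by
    rw [pow_succ, mul_neg_one, neg_mul_neg, ← mul_pow]
    norm_num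
  rw [← mul_assoc, h2]
  positivity

/-- The Gram determinant is the square of the coordinate determinant `24 V`, and `9216 = 2 ^ 4 * 24
^ 2`. -/
theorem cm_eq_volume {t : Fin 5 → V} {x : Fin 5 → E4} (hD : IsDist D) (ht : Function.Injective t)
    (h : ∀ i j, D (t i) (t j) = dist (x i) (x j) ^ 2) :
    cm (Finset.univ.image t) D = -9216 * signedVolume x ^ 2 := by
  rw [cm_eq_gram_det hD ht h]
  have hg : (Matrix.gram ℝ fun i : Fin 4 => x i.succ - x 0) =
      (Matrix.of fun i j : Fin 4 => (x i.succ - x 0) j) *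
        (Matrix.of fun i j : Fin 4 => (x i.succ - x 0) j)ᵀ := by
    ext i j
    simp [Matrix.gram_apply, mul_apply, PiLp.inner_apply, mul_comm]
  rw [hg, det_mul, det_transpose, signedVolume]
  ring

theorem affineIndependent_of_signedVolume_ne_zero {x : Fin 5 → E4} (h : signedVolume x ≠ 0) :
    AffineIndependent ℝ x := by
  have hdet : (Matrix.of fun i j : Fin 4 => (x i.succ - x 0) j).det ≠ 0 := fun h0 => by
    rw [signedVolume, h0, zero_div] at h
    exact h rfl
  have hl : LinearIndependent ℝ fun i : Fin 4 => x i.succ - x 0 := by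
    have := Matrix.linearIndependent_rows_of_det_ne_zero hdet
    exact LinearIndependent.of_comp (WithLp.linearEquiv 2 ℝ (Fin 4 → ℝ)).toLinearMap this
  rw [affineIndependent_iff_linearIndependent_vsub ℝ x 0]
  have he : (fun i : {i : Fin 5 // i ≠ 0} => x i -ᵥ x 0) =
      (fun i : Fin 4 => x i.succ - x 0) ∘ (finSuccAboveEquiv 0).symm := by
    funext i
    obtain ⟨j, rfl⟩ := (finSuccAboveEquiv (0 : Fin 5)).surjective i
    rfl
  rw [he]
  exact hl.comp _ (Equiv.injective _)

end Points

end CayleyMenger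

/-! ### Differentials of areas and dihedral angles -/

section Calculus

open FlatManifold Matrix

theorem IsDist.add_smul {V : Type*} {D x : V → V → ℝ} (hD : IsDist D) (hx : IsDist x) (t : ℝ) :
    IsDist (D + t • x) where
  symm u v := by simp [hD.symm u v, hx.symm u v]
  self u := by simp [hD.self, hx.self]

theorem differentiable_det {X n : Type*} [NormedAddCommGroup X] [NormedSpace ℝ X] [Fintype n]
    [DecidableEq n] {M : X → Matrix n n ℝ} (h : ∀ i j, Differentiable ℝ fun x => M x i j) :
    Differentiable ℝ fun x => (M x).det := by
  simp_rw [det_apply]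
  refine Differentiable.fun_sum fun σ _ => Differentiable.const_smul ?_ _
  induction (Finset.univ : Finset n) using Finset.induction_on with
  | empty => simp
  | insert i s hi ih =>
    simp only [Finset.prod_insert hi]
    exact (h _ _).fun_mul ih

section

variable {V : Type*} [DecidableEq V]

/-- The area of a triangle as a function of an array of squared distances. -/
noncomputable def areaOf (i : Finset V) (D : V → V → ℝ) : ℝ := √(-cm i D) / 4

/-- The dihedral angle between two tetrahedra as a function of an array of squared distances. -/
noncomputable def dihedralOf (i : Finset V) (p q : V) (D : V → V → ℝ) : ℝ :=
  Real.arccos (mixed i p q D / √(mixed i p p D * mixed i q q D))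

/-- The dihedral angle of a 4-simplex as a function of an array of squared distances. -/
noncomputable def angleOf (σ i : Finset V) (D : V → V → ℝ) : ℝ :=
  (∑ pq ∈ (σ \ i).offDiag, dihedralOf i pq.1 pq.2 D) / 2

/-- The simplex `σ` is nondegenerate. -/
structure Nondegenerate (σ : Finset V) (D : V → V → ℝ) : Prop where
  card_eq : σ.card = 5
  isDist : IsDist D
  cm_pos : ∀ s ⊆ σ, s.Nonempty → 0 < (-1) ^ s.card * cm s D

namespace Nondegenerate

variable {σ : Finset V} {D : V → V → ℝ}

theorem card_sdiff (h : Nondegenerate σ D) {p q : V} (hp : p ∈ σ) (hq : q ∈ σ) (hpq : p ≠ q) :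
    (σ \ {p, q}).card = 3 := by
  have hs : ({p, q} : Finset V) ⊆ σ := by
    intro v
    simp only [Finset.mem_insert, Finset.mem_singleton]
    rintro (rfl | rfl) <;> assumption
  rw [Finset.card_sdiff_of_subset hs, h.card_eq, Finset.card_pair hpq]

theorem cm_neg_of_card_three (h : Nondegenerate σ D) {i : Finset V} (hi : i ⊆ σ)
    (hc : i.card = 3) : cm i D < 0 := by
  have := h.cm_pos i hi (Finset.card_pos.mp (by omega))
  rw [hc] at this
  linarith

theorem cm_neg (h : Nondegenerate σ D) : cm σ D < 0 := by
  have := h.cm_pos σ subset_rfl (Finset.card_pos.mp (by rw [h.card_eq]; norm_num))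
  rw [h.card_eq] at this
  linarith

theorem cm_erase_pos (h : Nondegenerate σ D) {p : V} (hp : p ∈ σ) : 0 < cm (σ.erase p) D := by
  have hc : (σ.erase p).card = 4 := by rw [Finset.card_erase_of_mem hp, h.card_eq]
  have := h.cm_pos _ (Finset.erase_subset p σ) (Finset.card_pos.mp (by omega))
  rw [hc] at this
  linarith

end Nondegenerate

/-! ### Triangles of a 4-simplex as complements of pairs of vertices. -/

section Identities

variable {σ : Finset V} {p q : V}

theorem erase_eq_insert_sdiff (hq : q ∈ σ) (hpq : p ≠ q) :
    σ.erase p = insert q (σ \ {p, q}) := by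
  ext v
  by_cases hv : v = q
  · subst hv
    simp [hq, hpq.symm]
  · simp [hv, and_comm]

theorem eq_insert_insert_sdiff (hp : p ∈ σ) (hq : q ∈ σ) :
    σ = insert p (insert q (σ \ {p, q})) := by
  ext v
  by_cases hv : v = q
  · subst hv
    simp [hq]
  · by_cases hv' : v = p
    · subst hv'
      simp [hp]
    · simp [hv, hv']

theorem mixed_sdiff_self (hp : p ∈ σ) (hpq : p ≠ q) (D : V → V → ℝ) :
    mixed (σ \ {p, q}) p p D = cm (σ.erase q) D := by
  rw [mixed_self (by simp), erase_eq_insert_sdiff hp hpq.symm, Finset.pair_comm]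

theorem jacobi_identity (hσ : σ.card = 5) (hp : p ∈ σ) (hq : q ∈ σ) (hpq : p ≠ q)
    {D : V → V → ℝ} (hD : IsDist D) :
    cm (σ.erase p) D * cm (σ.erase q) D - mixed (σ \ {p, q}) p q D ^ 2 =
      cm (σ \ {p, q}) D * cm σ D := by
  have hs : ({p, q} : Finset V) ⊆ σ := by
    simp [Finset.insert_subset_iff, hp, hq]
  have hc : (σ \ {p, q}).card = 3 := by
    rw [Finset.card_sdiff_of_subset hs, hσ, Finset.card_pair hpq]
  have h1 := erase_eq_insert_sdiff hq hpq
  have h2 := erase_eq_insert_sdiff hp hpq.symm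
  have h3 := eq_insert_insert_sdiff hp hq
  rw [Finset.pair_comm] at h2
  have hp' : p ∉ σ \ {p, q} := by simp
  have hq' : q ∉ σ \ {p, q} := by simp
  obtain ⟨a, b, c, hab, hac, hbc, hi⟩ := Finset.card_eq_three.mp hc
  rw [hi] at h1 h2 h3 hp' hq'
  have hn : [a, b, c, p, q].Nodup := by
    simp at hp' hq' ⊢
    grind
  have e1 : (insert q {a, b, c} : Finset V) = {a, b, c, q} := by
    ext
    simp
    tauto
  have e2 : (insert p {a, b, c} : Finset V) = {a, b, c, p} := by
    ext
    simp
    tauto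
  have e3 : (insert p (insert q {a, b, c}) : Finset V) = {a, b, c, p, q} := by
    ext
    simp
    tauto
  rw [hi, h1, h2, h3, e3, e1, e2, ← cm_mul_cm_sub hD hn]
  ring

theorem sum_mixed_eq (hσ : σ.card = 5) (hp : p ∈ σ) {D : V → V → ℝ} (hD : IsDist D) :
    ∑ q ∈ σ.erase p, mixed (σ \ {p, q}) p q D = cm (σ.erase p) D := by
  have hc : (σ.erase p).card = 3 + 1 := by rw [Finset.card_erase_of_mem hp, hσ]
  obtain ⟨a, t, ha, hat, ht⟩ := Finset.card_eq_succ.mp hc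
  obtain ⟨b, c, d, hbc, hbd, hcd, rfl⟩ := Finset.card_eq_three.mp ht
  have hσ' : ∀ q, σ \ {p, q} = ({a, b, c, d} : Finset V).erase q := by
    intro q
    rw [hat]
    ext v
    simp
    tauto
  have hpn : p ∉ ({a, b, c, d} : Finset V) := by
    rw [hat]
    simp
  have hn : [a, b, c, d, p].Nodup := by
    simp at ha hpn ⊢
    grind
  have ha' : ({a, b, c, d} : Finset V).erase a = {b, c, d} := by
    ext v
    simp at hn ⊢
    grind
  have hb' : ({a, b, c, d} : Finset V).erase b = {a, c, d} := by
    ext v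
    simp at hn ⊢
    grind
  have hc' : ({a, b, c, d} : Finset V).erase c = {a, b, d} := by
    ext v
    simp at hn ⊢
    grind
  have hd' : ({a, b, c, d} : Finset V).erase d = {a, b, c} := by
    ext v
    simp at hn ⊢
    grind
  simp only [hσ', ← hat]
  simp at hn
  rw [cm_four_eq_sum_mixed hD (p := p) (by simp; tauto), Finset.sum_insert (by simp; tauto),
    Finset.sum_insert (by simp; tauto), Finset.sum_insert (by simp; tauto), Finset.sum_singleton,
    ha', hb', hc', hd']
  ring

theorem dihedralOf_comm (hD : IsDist D) (i : Finset V) (p q : V) :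
    dihedralOf i p q D = dihedralOf i q p D := by
  rw [dihedralOf, dihedralOf, mixed_comm hD i p q, mul_comm]

theorem sdiff_eq_of_mem_offDiag (hσ : σ.card = 5) {i : Finset V} (hi : i ⊆ σ) (hc : i.card = 3)
    (h : (p, q) ∈ (σ \ i).offDiag) : p ∈ σ ∧ q ∈ σ ∧ p ≠ q ∧ i = σ \ {p, q} := by
  have hc2 : (σ \ i).card = 2 := by
    rw [Finset.card_sdiff_of_subset hi, hσ, hc]
  obtain ⟨a, b, hab, hs⟩ := Finset.card_eq_two.mp hc2
  rw [hs] at h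
  have : i = σ \ {a, b} := by
    rw [← hs, Finset.sdiff_sdiff_eq_self hi]
  have ha : a ∈ σ := (Finset.mem_sdiff.mp (hs ▸ Finset.mem_insert_self a {b})).1
  have hb : b ∈ σ := (Finset.mem_sdiff.mp (hs ▸ (by simp : b ∈ ({a, b} : Finset V)))).1
  grind

end Identities

end

variable {V : Type*} [Fintype V]

/-- Differentials are computed along lines because the identities to be differentiated hold only for
symmetric arrays with zero diagonal. These do not form an open set, but a line in such a direction
stays among them. -/
theorem hasDerivAt_line {F : (V → V → ℝ) → ℝ} {D : V → V → ℝ} (hF : DifferentiableAt ℝ F D)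
    (x : V → V → ℝ) : HasDerivAt (fun t : ℝ => F (D + t • x)) (fderiv ℝ F D x) 0 := by
  have h1 : HasDerivAt (fun t : ℝ => D + t • x) x 0 := by
    simpa using ((hasDerivAt_id (0 : ℝ)).smul_const x).const_add D
  have h2 : HasFDerivAt F (fderiv ℝ F D) (D + (0 : ℝ) • x) := by simpa using hF.hasFDerivAt
  exact h2.comp_hasDerivAt 0 h1

/-- The differentials along arrays of squared distances only depend on the values there. -/
theorem fderiv_congr_dist {F G : (V → V → ℝ) → ℝ} (h : ∀ D, IsDist D → F D = G D)
    {D x : V → V → ℝ} (hD : IsDist D) (hx : IsDist x) (hF : DifferentiableAt ℝ F D)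
    (hG : DifferentiableAt ℝ G D) : fderiv ℝ F D x = fderiv ℝ G D x := by
  have h1 := hasDerivAt_line hF x
  have h2 := hasDerivAt_line hG x
  have : (fun t : ℝ => F (D + t • x)) = fun t : ℝ => G (D + t • x) :=
    funext fun t => h _ (hD.add_smul hx t)
  rw [this] at h1
  exact h1.unique h2

variable [DecidableEq V]

theorem differentiable_cm (i : Finset V) : Differentiable ℝ (cm i) := by
  unfold cm cayleyMenger
  refine differentiable_det fun a b => ?_
  rcases a with _ | a <;> rcases b with _ | b <;> simp only [of_apply] <;> fun_prop

theorem differentiable_mixed (i : Finset V) (p q : V) : Differentiable ℝ (mixed i p q) := by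
  unfold mixed cayleyMenger
  refine differentiable_det fun a b => ?_
  rcases a with _ | a <;> rcases b with _ | b <;> simp only [of_apply] <;> fun_prop

section Derivatives

variable {σ : Finset V} {D : V → V → ℝ}

theorem differentiableAt_areaOf {i : Finset V} (h : cm i D < 0) :
    DifferentiableAt ℝ (areaOf i) D := by
  unfold areaOf
  simp only [div_eq_mul_inv]
  exact (((differentiable_cm i D).fun_neg).sqrt (neg_pos.mpr h).ne').mul_const _

theorem fderiv_areaOf {i : Finset V} (h : cm i D < 0) (x : V → V → ℝ) :
    fderiv ℝ (areaOf i) D x = -fderiv ℝ (cm i) D x / (8 * √(-cm i D)) := by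
  have h1 := hasDerivAt_line (differentiableAt_areaOf h) x
  have h2 := (((hasDerivAt_line (differentiable_cm i D) x).fun_neg).sqrt
    (by simpa using h.ne)).div_const 4
  rw [h1.unique h2]
  simp only [zero_smul, add_zero]
  rw [div_div]
  congr 1
  ring

/-- Derivative of `arccos (m / √(M N))`. -/
theorem hasDerivAt_arccos_div_sqrt {m M N : ℝ → ℝ} {m' M' N' : ℝ} (hm : HasDerivAt m m' 0)
    (hM : HasDerivAt M M' 0) (hN : HasDerivAt N N' 0) (hM0 : 0 < M 0) (hN0 : 0 < N 0)
    (hΔ : 0 < M 0 * N 0 - m 0 ^ 2) :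
    HasDerivAt (fun t => Real.arccos (m t / √(M t * N t)))
      (-(m' - m 0 * (M' / M 0 + N' / N 0) / 2) / √(M 0 * N 0 - m 0 ^ 2)) 0 := by
  have hP : 0 < M 0 * N 0 := mul_pos hM0 hN0
  have hs : 0 < √(M 0 * N 0) := Real.sqrt_pos.mpr hP
  have hsq : √(M 0 * N 0) ^ 2 = M 0 * N 0 := Real.sq_sqrt hP.le
  have hlt : (m 0 / √(M 0 * N 0)) ^ 2 < 1 := by
    rw [div_pow, hsq, div_lt_one hP]
    linarith
  have hab := abs_lt.mp ((sq_lt_one_iff_abs_lt_one _).mp hlt)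
  have h1 := hm.fun_div (((hM.fun_mul hN)).sqrt hP.ne') hs.ne'
  have h2 := (Real.hasDerivAt_arccos hab.1.ne' hab.2.ne).comp (0 : ℝ) h1
  refine h2.congr_deriv ?_
  -- This is the sine of the angle; by `jacobi_identity` its numerator will become the root of the
  -- determinants of the triangle and of the 4-simplex.
  have hr : √(1 - (m 0 / √(M 0 * N 0)) ^ 2) = √(M 0 * N 0 - m 0 ^ 2) / √(M 0 * N 0) := by
    rw [div_pow, hsq, ← Real.sqrt_div hΔ.le]
    congr 1
    field_simp
  rw [hr]
  have hΔs : 0 < √(M 0 * N 0 - m 0 ^ 2) := Real.sqrt_pos.mpr hΔ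
  set s := √(M 0 * N 0) with hsdef
  set Δ := √(M 0 * N 0 - m 0 ^ 2)
  have hNe : N 0 = s ^ 2 / M 0 := by
    rw [hsq]
    field_simp
  rw [hNe]
  field_simp

variable {p q : V}

/-- The cosine lies strictly between `-1` and `1`, since `jacobi_identity` writes the difference in
question as a product of two negative Cayley–Menger determinants. This keeps away from the points
where `arccos` is not differentiable. -/
theorem differentiableAt_dihedralOf (h : Nondegenerate σ D) (hp : p ∈ σ) (hq : q ∈ σ)
    (hpq : p ≠ q) : DifferentiableAt ℝ (dihedralOf (σ \ {p, q}) p q) D := by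
  have hM := h.cm_erase_pos hp
  have hN := h.cm_erase_pos hq
  have hP : 0 < cm (σ.erase q) D * cm (σ.erase p) D := mul_pos hN hM
  have hΔ : 0 < cm (σ \ {p, q}) D * cm σ D := mul_pos_of_neg_of_neg
    (h.cm_neg_of_card_three Finset.sdiff_subset (h.card_sdiff hp hq hpq)) h.cm_neg
  rw [← jacobi_identity h.card_eq hp hq hpq h.isDist] at hΔ
  have h1 : mixed (σ \ {p, q}) p p = cm (σ.erase q) := funext (mixed_sdiff_self hp hpq)
  have h2 : mixed (σ \ {p, q}) q q = cm (σ.erase p) := by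
    rw [Finset.pair_comm]
    exact funext (mixed_sdiff_self hq hpq.symm)
  have hlt : (mixed (σ \ {p, q}) p q D / √(cm (σ.erase q) D * cm (σ.erase p) D)) ^ 2 < 1 := by
    rw [div_pow, Real.sq_sqrt hP.le, div_lt_one hP]
    linarith
  have hab := abs_lt.mp ((sq_lt_one_iff_abs_lt_one _).mp hlt)
  unfold dihedralOf
  rw [h1, h2]
  have hfrac : DifferentiableAt ℝ (fun D => mixed (σ \ {p, q}) p q D /
      √(cm (σ.erase q) D * cm (σ.erase p) D)) D := by
    simp only [div_eq_mul_inv]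
    exact (differentiable_mixed _ _ _ D).fun_mul
      ((((differentiable_cm _ D).fun_mul (differentiable_cm _ D)).sqrt hP.ne').fun_inv
        (Real.sqrt_pos.mpr hP).ne')
  exact DifferentiableAt.comp (g := Real.arccos) D
    (Real.differentiableAt_arccos.mpr ⟨hab.1.ne', hab.2.ne⟩) hfrac

theorem fderiv_dihedralOf (h : Nondegenerate σ D) (hp : p ∈ σ) (hq : q ∈ σ) (hpq : p ≠ q)
    (x : V → V → ℝ) : fderiv ℝ (dihedralOf (σ \ {p, q}) p q) D x =
      -(fderiv ℝ (mixed (σ \ {p, q}) p q) D x - mixed (σ \ {p, q}) p q D *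
        (fderiv ℝ (cm (σ.erase p)) D x / cm (σ.erase p) D +
          fderiv ℝ (cm (σ.erase q)) D x / cm (σ.erase q) D) / 2) /
        √(cm (σ \ {p, q}) D * cm σ D) := by
  have hM := h.cm_erase_pos hp
  have hN := h.cm_erase_pos hq
  have hΔ : 0 < cm (σ \ {p, q}) D * cm σ D := mul_pos_of_neg_of_neg
    (h.cm_neg_of_card_three Finset.sdiff_subset (h.card_sdiff hp hq hpq)) h.cm_neg
  have hj := jacobi_identity h.card_eq hp hq hpq h.isDist
  have h1 : mixed (σ \ {p, q}) p p = cm (σ.erase q) := funext (mixed_sdiff_self hp hpq)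
  have h2 : mixed (σ \ {p, q}) q q = cm (σ.erase p) := by
    rw [Finset.pair_comm]
    exact funext (mixed_sdiff_self hq hpq.symm)
  have e1 := hasDerivAt_line (differentiableAt_dihedralOf h hp hq hpq) x
  have e2 := hasDerivAt_arccos_div_sqrt
    (hasDerivAt_line (differentiable_mixed (σ \ {p, q}) p q D) x)
    (hasDerivAt_line (differentiable_cm (σ.erase q) D) x)
    (hasDerivAt_line (differentiable_cm (σ.erase p) D) x)
    (by simpa using hN) (by simpa using hM) (by
      simp only [zero_smul, add_zero]
      linarith)
  simp only [zero_smul, add_zero] at e2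
  simp only [dihedralOf, h1, h2] at e1 ⊢
  rw [e1.unique e2, ← hj, mul_comm (cm (σ.erase q) D), add_comm (_ / cm (σ.erase q) D)]

theorem differentiableAt_angleOf (h : Nondegenerate σ D) {i : Finset V} (hi : i ⊆ σ)
    (hc : i.card = 3) : DifferentiableAt ℝ (angleOf σ i) D := by
  unfold angleOf
  simp only [div_eq_mul_inv]
  refine DifferentiableAt.mul_const (DifferentiableAt.fun_sum fun pq hpq => ?_) _
  obtain ⟨hp, hq, hne, hi'⟩ := sdiff_eq_of_mem_offDiag h.card_eq hi hc hpq
  have := differentiableAt_dihedralOf h hp hq hne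
  rwa [← hi'] at this

theorem fderiv_angleOf (h : Nondegenerate σ D) {i : Finset V} (hi : i ⊆ σ)
    (hc : i.card = 3) (x : V → V → ℝ) : fderiv ℝ (angleOf σ i) D x =
      (∑ pq ∈ (σ \ i).offDiag, fderiv ℝ (dihedralOf i pq.1 pq.2) D x) / 2 := by
  have h1 := hasDerivAt_line (differentiableAt_angleOf h hi hc) x
  refine h1.unique (HasDerivAt.div_const (HasDerivAt.fun_sum fun pq hpq => ?_) 2)
  obtain ⟨hp, hq, hne, hi'⟩ := sdiff_eq_of_mem_offDiag h.card_eq hi hc hpq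
  have := differentiableAt_dihedralOf h hp hq hne
  rw [← hi'] at this
  exact hasDerivAt_line this x

theorem fderiv_angleOf_sdiff (h : Nondegenerate σ D) (hp : p ∈ σ) (hq : q ∈ σ) (hpq : p ≠ q)
    {x : V → V → ℝ} (hx : IsDist x) : fderiv ℝ (angleOf σ (σ \ {p, q})) D x =
      fderiv ℝ (dihedralOf (σ \ {p, q}) p q) D x := by
  refine fderiv_congr_dist (fun D' hD' => ?_) h.isDist hx
    (differentiableAt_angleOf h Finset.sdiff_subset (h.card_sdiff hp hq hpq))
    (differentiableAt_dihedralOf h hp hq hpq)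
  have hs : σ \ (σ \ {p, q}) = {p, q} := Finset.sdiff_sdiff_eq_self (by
    simp [Finset.insert_subset_iff, hp, hq])
  have ho : ({p, q} : Finset V).offDiag = {(p, q), (q, p)} := by
    ext ⟨a, b⟩
    simp only [Finset.mem_offDiag, Finset.mem_insert, Finset.mem_singleton, Prod.mk.injEq]
    grind
  rw [angleOf, hs, ho, Finset.sum_pair (by grind), dihedralOf_comm hD' _ q p]
  ring

end Derivatives

end Calculus

/-! ### The Schläfli symmetry -/

section Schlaefli

open FlatManifold Matrix

section Algebra

variable {V : Type*} [DecidableEq V]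

theorem sum_sum_erase_comm (σ : Finset V) (g : V → V → ℝ) :
    ∑ p ∈ σ, ∑ q ∈ σ.erase p, g p q = ∑ p ∈ σ, ∑ q ∈ σ.erase p, g q p :=
  Finset.sum_comm' fun p q => by
    simp only [Finset.mem_erase]
    tauto

variable {σ : Finset V} {N : V → ℝ} {m : V → V → ℝ}

/-- The Schläfli formula in disguise. With `N p` the determinant of the facet opposite `p` and `m p
q` the mixed one, the summand is `S_i dϑ_i` at `i = σ \ {p, q}`, up to a factor common to the whole
4-simplex. The relation `∑ q, m p q = N p` says that the projections of the other facets fill the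
facet; with its derivative it makes all three parts of the sum multiples of `∑ N' p`, and these
cancel. -/
theorem sum_sum_angle_variation_eq_zero (hN : ∀ p ∈ σ, N p ≠ 0)
    (hm : ∀ p ∈ σ, ∀ q ∈ σ, m p q = m q p) (hs : ∀ p ∈ σ, ∑ q ∈ σ.erase p, m p q = N p)
    (N' : V → ℝ) (m' : V → V → ℝ) (hs' : ∀ p ∈ σ, ∑ q ∈ σ.erase p, m' p q = N' p) :
    ∑ p ∈ σ, ∑ q ∈ σ.erase p, (m' p q - m p q * (N' p / N p + N' q / N q) / 2) = 0 := by
  have h1 : ∑ p ∈ σ, ∑ q ∈ σ.erase p, m p q * (N' p / N p) = ∑ p ∈ σ, N' p :=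
    Finset.sum_congr rfl fun p hp => by
      rw [← Finset.sum_mul, hs p hp]
      field_simp [hN p hp]
  have h2 : ∑ p ∈ σ, ∑ q ∈ σ.erase p, m p q * (N' q / N q) = ∑ p ∈ σ, N' p := by
    rw [sum_sum_erase_comm, ← h1]
    exact Finset.sum_congr rfl fun p hp => Finset.sum_congr rfl fun q hq => by
      rw [hm p hp q (Finset.mem_of_mem_erase hq)]
  have h3 : ∑ p ∈ σ, ∑ q ∈ σ.erase p, m' p q = ∑ p ∈ σ, N' p := Finset.sum_congr rfl hs'
  have h4 : ∑ p ∈ σ, ∑ q ∈ σ.erase p, (m' p q - m p q * (N' p / N p + N' q / N q) / 2) =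
      ∑ p ∈ σ, ∑ q ∈ σ.erase p, m' p q - (∑ p ∈ σ, ∑ q ∈ σ.erase p, m p q * (N' p / N p)) / 2 -
        (∑ p ∈ σ, ∑ q ∈ σ.erase p, m p q * (N' q / N q)) / 2 := by
    simp only [Finset.sum_div, ← Finset.sum_sub_distrib]
    exact Finset.sum_congr rfl fun p _ => Finset.sum_congr rfl fun q _ => by ring
  rw [h4, h1, h2, h3]
  ring

/-- Antisymmetrize in the two variations. Writing `a₁ = N₁ p / N p + N₁ q / N q`, and likewise `a₂`,
the denominator cancels and each term becomes `a₁ m₂ - a₂ m₁`. The relations `∑ q, m p q = N p` turn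
both halves of the sum into `2 ∑ N₁ N₂ / N`. The constants `κ₁` and `κ₂` multiply sums that vanish
by `sum_sum_angle_variation_eq_zero`. -/
theorem sum_sum_variation_symm (hN : ∀ p ∈ σ, N p ≠ 0)
    (hm : ∀ p ∈ σ, ∀ q ∈ σ, m p q = m q p) (hs : ∀ p ∈ σ, ∑ q ∈ σ.erase p, m p q = N p)
    (hΔ : ∀ p ∈ σ, ∀ q ∈ σ.erase p, N p * N q - m p q ^ 2 ≠ 0)
    (N₁ N₂ : V → ℝ) (m₁ m₂ : V → V → ℝ) (hs₁ : ∀ p ∈ σ, ∑ q ∈ σ.erase p, m₁ p q = N₁ p)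
    (hs₂ : ∀ p ∈ σ, ∑ q ∈ σ.erase p, m₂ p q = N₂ p)
    (hm₁ : ∀ p ∈ σ, ∀ q ∈ σ, m₁ p q = m₁ q p) (hm₂ : ∀ p ∈ σ, ∀ q ∈ σ, m₂ p q = m₂ q p)
    (κ₁ κ₂ : ℝ) :
    ∑ p ∈ σ, ∑ q ∈ σ.erase p,
      ((N₁ p * N q + N p * N₁ q - 2 * m p q * m₁ p q) / (N p * N q - m p q ^ 2) - κ₁) *
        (m₂ p q - m p q * (N₂ p / N p + N₂ q / N q) / 2) =
    ∑ p ∈ σ, ∑ q ∈ σ.erase p,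
      ((N₂ p * N q + N p * N₂ q - 2 * m p q * m₂ p q) / (N p * N q - m p q ^ 2) - κ₂) *
        (m₁ p q - m p q * (N₁ p / N p + N₁ q / N q) / 2) := by
  have hz₁ := sum_sum_angle_variation_eq_zero hN hm hs N₁ m₁ hs₁
  have hz₂ := sum_sum_angle_variation_eq_zero hN hm hs N₂ m₂ hs₂
  have half : ∀ (M n : V → ℝ) (μ : V → V → ℝ), (∀ p ∈ σ, ∑ q ∈ σ.erase p, μ p q = n p) →
      (∀ p ∈ σ, ∀ q ∈ σ, μ p q = μ q p) →
      ∑ p ∈ σ, ∑ q ∈ σ.erase p, (M p / N p + M q / N q) * μ p q =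
        2 * ∑ p ∈ σ, M p * n p / N p := by
    intro M n μ hμ hμs
    have h1 : ∑ p ∈ σ, ∑ q ∈ σ.erase p, M p / N p * μ p q = ∑ p ∈ σ, M p * n p / N p :=
      Finset.sum_congr rfl fun p hp => by
        rw [← Finset.mul_sum, hμ p hp]
        ring
    have h2 : ∑ p ∈ σ, ∑ q ∈ σ.erase p, M q / N q * μ p q = ∑ p ∈ σ, M p * n p / N p := by
      rw [sum_sum_erase_comm, ← h1]
      exact Finset.sum_congr rfl fun p hp => Finset.sum_congr rfl fun q hq => by
        rw [hμs p hp q (Finset.mem_of_mem_erase hq)]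
    simp only [add_mul, Finset.sum_add_distrib, h1, h2]
    ring
  have h₁ := half N₁ N₂ m₂ hs₂ hm₂
  have h₂ := half N₂ N₁ m₁ hs₁ hm₁
  have h₃ : ∑ p ∈ σ, N₁ p * N₂ p / N p = ∑ p ∈ σ, N₂ p * N₁ p / N p :=
    Finset.sum_congr rfl fun p _ => by ring
  rw [h₃] at h₁
  have key : ∑ p ∈ σ, ∑ q ∈ σ.erase p,
      ((N₁ p * N q + N p * N₁ q - 2 * m p q * m₁ p q) / (N p * N q - m p q ^ 2) - κ₁) *
        (m₂ p q - m p q * (N₂ p / N p + N₂ q / N q) / 2) -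
      ∑ p ∈ σ, ∑ q ∈ σ.erase p,
      ((N₂ p * N q + N p * N₂ q - 2 * m p q * m₂ p q) / (N p * N q - m p q ^ 2) - κ₂) *
        (m₁ p q - m p q * (N₁ p / N p + N₁ q / N q) / 2) =
      ∑ p ∈ σ, ∑ q ∈ σ.erase p, (N₁ p / N p + N₁ q / N q) * m₂ p q -
      ∑ p ∈ σ, ∑ q ∈ σ.erase p, (N₂ p / N p + N₂ q / N q) * m₁ p q -
      κ₁ * ∑ p ∈ σ, ∑ q ∈ σ.erase p, (m₂ p q - m p q * (N₂ p / N p + N₂ q / N q) / 2) +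
      κ₂ * ∑ p ∈ σ, ∑ q ∈ σ.erase p, (m₁ p q - m p q * (N₁ p / N p + N₁ q / N q) / 2) := by
    simp only [Finset.mul_sum, ← Finset.sum_sub_distrib, ← Finset.sum_add_distrib]
    refine Finset.sum_congr rfl fun p hp => Finset.sum_congr rfl fun q hq => ?_
    have hp0 := hN p hp
    have hq0 := hN q (Finset.mem_of_mem_erase hq)
    have hd := hΔ p hp q hq
    generalize N p = a at *
    generalize N q = b at *
    generalize m p q = c at *
    have hd' : b * a - c ^ 2 ≠ 0 := by rwa [mul_comm b a]
    field_simp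
    ring
  rw [hz₁, hz₂, h₁, h₂] at key
  linarith

/-- A triangle of a 4-simplex is the complement of a pair of vertices, and it occurs here once for
each order of the pair. -/
theorem sum_powersetCard_offDiag (hσ : σ.card = 5) (F : Finset V → V → V → ℝ) :
    ∑ i ∈ σ.powersetCard 3, ∑ pq ∈ (σ \ i).offDiag, F i pq.1 pq.2 =
      ∑ p ∈ σ, ∑ q ∈ σ.erase p, F (σ \ {p, q}) p q := by
  rw [← Finset.sum_finset_product' σ.offDiag σ (fun p => σ.erase p) (fun pq => by
    simp only [Finset.mem_offDiag, Finset.mem_erase]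
    tauto),
    ← Finset.sum_fiberwise_of_maps_to (s := σ.offDiag) (t := σ.powersetCard 3)
      (g := fun pq => σ \ {pq.1, pq.2})]
  · refine Finset.sum_congr rfl fun i hi => ?_
    obtain ⟨his, hic⟩ := Finset.mem_powersetCard.mp hi
    have hset : {pq ∈ σ.offDiag | σ \ {pq.1, pq.2} = i} = (σ \ i).offDiag := by
      ext ⟨p, q⟩
      rw [Finset.mem_filter]
      constructor
      · rintro ⟨h1, rfl⟩
        simp only [Finset.mem_offDiag, Finset.mem_sdiff] at h1 ⊢
        simp [h1.1, h1.2.1, h1.2.2]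
      · intro h
        obtain ⟨hp, hq, hpq, hi'⟩ := sdiff_eq_of_mem_offDiag hσ his hic h
        exact ⟨Finset.mem_offDiag.mpr ⟨hp, hq, hpq⟩, hi'.symm⟩
    rw [hset]
    refine Finset.sum_congr rfl fun pq hpq => ?_
    obtain ⟨-, -, -, hi'⟩ := sdiff_eq_of_mem_offDiag hσ his hic hpq
    rw [← hi']
  · intro pq h
    obtain ⟨hp, hq, hpq⟩ := Finset.mem_offDiag.mp h
    refine Finset.mem_powersetCard.mpr ⟨Finset.sdiff_subset, ?_⟩
    rw [Finset.card_sdiff_of_subset (by simp [Finset.insert_subset_iff, hp, hq]), hσ,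
      Finset.card_pair hpq]

end Algebra

variable {V : Type*} [Fintype V] [DecidableEq V] {σ : Finset V} {D : V → V → ℝ}

theorem sum_fderiv_mixed (h : Nondegenerate σ D) {x : V → V → ℝ} (hx : IsDist x) {p : V}
    (hp : p ∈ σ) : ∑ q ∈ σ.erase p, fderiv ℝ (mixed (σ \ {p, q}) p q) D x =
      fderiv ℝ (cm (σ.erase p)) D x := by
  rw [← fderiv_congr_dist (fun _ => sum_mixed_eq h.card_eq hp) h.isDist hx
    (DifferentiableAt.fun_sum fun q _ => differentiable_mixed _ p q D) (differentiable_cm _ D)]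
  exact (HasDerivAt.fun_sum fun q _ => hasDerivAt_line (differentiable_mixed _ p q D) x).unique
    (hasDerivAt_line (DifferentiableAt.fun_sum fun q _ => differentiable_mixed _ p q D) x)

theorem fderiv_mixed_comm (h : Nondegenerate σ D) {x : V → V → ℝ} (hx : IsDist x) (p q : V) :
    fderiv ℝ (mixed (σ \ {p, q}) p q) D x = fderiv ℝ (mixed (σ \ {q, p}) q p) D x := by
  rw [Finset.pair_comm q p]
  exact fderiv_congr_dist (fun _ hD => mixed_comm hD _ p q) h.isDist hx
    (differentiable_mixed _ _ _ D) (differentiable_mixed _ _ _ D)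

theorem fderiv_jacobi (h : Nondegenerate σ D) {x : V → V → ℝ} (hx : IsDist x) {p q : V}
    (hp : p ∈ σ) (hq : q ∈ σ) (hpq : p ≠ q) :
    fderiv ℝ (cm (σ.erase p)) D x * cm (σ.erase q) D +
        cm (σ.erase p) D * fderiv ℝ (cm (σ.erase q)) D x -
        2 * mixed (σ \ {p, q}) p q D * fderiv ℝ (mixed (σ \ {p, q}) p q) D x =
      fderiv ℝ (cm (σ \ {p, q})) D x * cm σ D + cm (σ \ {p, q}) D * fderiv ℝ (cm σ) D x := by
  have e1 := ((hasDerivAt_line (differentiable_cm (σ.erase p) D) x).fun_mul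
    (hasDerivAt_line (differentiable_cm (σ.erase q) D) x)).fun_sub
    ((hasDerivAt_line (differentiable_mixed (σ \ {p, q}) p q D) x).fun_pow 2)
  have e2 := (hasDerivAt_line (differentiable_cm (σ \ {p, q}) D) x).fun_mul
    (hasDerivAt_line (differentiable_cm σ D) x)
  simp only [jacobi_identity h.card_eq hp hq hpq (h.isDist.add_smul hx _)] at e1
  have := e1.unique e2
  simp only [zero_smul, add_zero] at this
  rw [← this]
  norm_num

/-- The matrix `∑ i, (∂S_i / ∂L_a) (∂ϑ_i / ∂L_b)` of a 4-simplex is symmetric, which is equivalent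
to the Schläfli formula `∑ i, S_i dϑ_i = 0`. -/
theorem schlaefli_symm (h : Nondegenerate σ D) {x y : V → V → ℝ} (hx : IsDist x)
    (hy : IsDist y) :
    ∑ i ∈ σ.powersetCard 3, fderiv ℝ (areaOf i) D x * fderiv ℝ (angleOf σ i) D y =
      ∑ i ∈ σ.powersetCard 3, fderiv ℝ (areaOf i) D y * fderiv ℝ (angleOf σ i) D x := by
  -- By `fderiv_jacobi` the logarithmic derivative of the determinant of a triangle is that of the
  -- left side of the Jacobi identity minus that of the determinant of the 4-simplex; the latter is
  -- the same for all triangles and plays the role of `κ`. The square roots from the area and from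
  -- the angle combine to the determinant of the triangle itself. The area derivative brings the
  -- factor `8`, and the two orders of each pair double it to `16`.
  have expand : ∀ {x y : V → V → ℝ}, IsDist x → IsDist y →
      ∑ i ∈ σ.powersetCard 3, fderiv ℝ (areaOf i) D x * fderiv ℝ (angleOf σ i) D y =
      (-1 / (16 * √(-cm σ D))) * ∑ p ∈ σ, ∑ q ∈ σ.erase p,
        ((fderiv ℝ (cm (σ.erase p)) D x * cm (σ.erase q) D + cm (σ.erase p) D *
            fderiv ℝ (cm (σ.erase q)) D x - 2 * mixed (σ \ {p, q}) p q D *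
              fderiv ℝ (mixed (σ \ {p, q}) p q) D x) /
          (cm (σ.erase p) D * cm (σ.erase q) D - mixed (σ \ {p, q}) p q D ^ 2) -
            fderiv ℝ (cm σ) D x / cm σ D) *
        (fderiv ℝ (mixed (σ \ {p, q}) p q) D y - mixed (σ \ {p, q}) p q D *
          (fderiv ℝ (cm (σ.erase p)) D y / cm (σ.erase p) D +
            fderiv ℝ (cm (σ.erase q)) D y / cm (σ.erase q) D) / 2) := by
    intro x y hx hy
    have h1 : ∑ i ∈ σ.powersetCard 3, fderiv ℝ (areaOf i) D x * fderiv ℝ (angleOf σ i) D y =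
        (∑ i ∈ σ.powersetCard 3, ∑ pq ∈ (σ \ i).offDiag,
          fderiv ℝ (areaOf i) D x * fderiv ℝ (dihedralOf i pq.1 pq.2) D y) / 2 := by
      rw [Finset.sum_div]
      refine Finset.sum_congr rfl fun i hi => ?_
      obtain ⟨his, hic⟩ := Finset.mem_powersetCard.mp hi
      rw [fderiv_angleOf h his hic, ← mul_div_assoc, Finset.mul_sum]
    rw [h1, sum_powersetCard_offDiag h.card_eq fun i p q =>
      fderiv ℝ (areaOf i) D x * fderiv ℝ (dihedralOf i p q) D y, Finset.sum_div, Finset.mul_sum]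
    refine Finset.sum_congr rfl fun p hp => ?_
    rw [Finset.sum_div, Finset.mul_sum]
    refine Finset.sum_congr rfl fun q hq => ?_
    have hqσ := Finset.mem_of_mem_erase hq
    have hpq : p ≠ q := (Finset.ne_of_mem_erase hq).symm
    have hc := h.cm_neg_of_card_three (i := σ \ {p, q}) Finset.sdiff_subset
      (h.card_sdiff hp hqσ hpq)
    have hK := h.cm_neg
    rw [fderiv_areaOf hc, fderiv_dihedralOf h hp hqσ hpq, fderiv_jacobi h hx hp hqσ hpq,
      jacobi_identity h.card_eq hp hqσ hpq h.isDist]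
    have hsq : √(cm (σ \ {p, q}) D * cm σ D) = √(-cm (σ \ {p, q}) D) * √(-cm σ D) := by
      rw [← Real.sqrt_mul (by linarith), neg_mul_neg]
    rw [hsq]
    have hcs : 0 < √(-cm (σ \ {p, q}) D) := Real.sqrt_pos.mpr (by linarith)
    have hKs : 0 < √(-cm σ D) := Real.sqrt_pos.mpr (by linarith)
    have hcsq : √(-cm (σ \ {p, q}) D) ^ 2 = -cm (σ \ {p, q}) D := Real.sq_sqrt (by linarith)
    generalize fderiv ℝ (mixed (σ \ {p, q}) p q) D y - _ = T
    have e : (fderiv ℝ (cm (σ \ {p, q})) D x * cm σ D + cm (σ \ {p, q}) D * fderiv ℝ (cm σ) D x) /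
        (cm (σ \ {p, q}) D * cm σ D) - fderiv ℝ (cm σ) D x / cm σ D =
        fderiv ℝ (cm (σ \ {p, q})) D x / cm (σ \ {p, q}) D := by
      field_simp [hc.ne, hK.ne]
      ring
    rw [e]
    set s := √(-cm (σ \ {p, q}) D)
    rw [show cm (σ \ {p, q}) D = -s ^ 2 by linarith]
    field_simp
    ring
  rw [expand hx hy, expand hy hx]
  congr 1
  refine sum_sum_variation_symm (N := fun p => cm (σ.erase p) D)
    (m := fun p q => mixed (σ \ {p, q}) p q D) (fun p hp => (h.cm_erase_pos hp).ne') ?_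
    (fun p hp => sum_mixed_eq h.card_eq hp h.isDist) ?_
    (fun p => fderiv ℝ (cm (σ.erase p)) D x) (fun p => fderiv ℝ (cm (σ.erase p)) D y)
    (fun p q => fderiv ℝ (mixed (σ \ {p, q}) p q) D x)
    (fun p q => fderiv ℝ (mixed (σ \ {p, q}) p q) D y)
    (fun p hp => sum_fderiv_mixed h hx hp) (fun p hp => sum_fderiv_mixed h hy hp)
    (fun p _ q _ => fderiv_mixed_comm h hx p q) (fun p _ q _ => fderiv_mixed_comm h hy p q) _ _
  · intro p _ q _
    simp only [Finset.pair_comm q p, mixed_comm h.isDist _ q p]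
  · intro p hp q hq
    have hpq := (Finset.ne_of_mem_erase hq).symm
    have hqσ := Finset.mem_of_mem_erase hq
    rw [jacobi_identity h.card_eq hp hqσ hpq h.isDist]
    exact mul_ne_zero (h.cm_neg_of_card_three Finset.sdiff_subset (h.card_sdiff hp hqσ hpq)).ne
      h.cm_neg.ne

end Schlaefli

/-! ### Six points in four-dimensional space -/

section SixPoints

open FlatManifold Matrix

section Gram

variable {V : Type*} {D : V → V → ℝ}

theorem gram_add_smul (a p q : V) (D x : V → V → ℝ) (t : ℝ) :
    gram a p q (D + t • x) = gram a p q D + t * gram a p q x := by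
  simp only [gram, Pi.add_apply, Pi.smul_apply, smul_eq_mul]
  ring

theorem gram_comm (hD : IsDist D) (a p q : V) : gram a p q D = gram a q p D := by
  rw [gram, gram, hD.symm p q, add_comm (D a p)]

/-- The inner product of `w - a` and of the combination of the vectors `s - a` with the
coefficients `β s`. -/
noncomputable def combGram (β : V → ℝ) (a b c p q r w : V) (D : V → V → ℝ) : ℝ :=
  β b * gram a w b D + β c * gram a w c D + β p * gram a w p D + β q * gram a w q D +
    β r * gram a w r D

theorem combGram_add_smul (β : V → ℝ) (a b c p q r w : V) (D x : V → V → ℝ) (t : ℝ) :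
    combGram β a b c p q r w (D + t • x) =
      combGram β a b c p q r w D + t * combGram β a b c p q r w x := by
  simp only [combGram, gram_add_smul]
  ring

/-- The inner square of the combination of the vectors `s - a` with the coefficients `β s`. -/
noncomputable def combSq (β : V → ℝ) (a b c p q r : V) (D : V → V → ℝ) : ℝ :=
  β b * combGram β a b c p q r b D + β c * combGram β a b c p q r c D +
    β p * combGram β a b c p q r p D + β q * combGram β a b c p q r q D +
    β r * combGram β a b c p q r r D

theorem combSq_add_smul (β : V → ℝ) (a b c p q r : V) (D x : V → V → ℝ) (t : ℝ) :
    combSq β a b c p q r (D + t • x) =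
      combSq β a b c p q r D + t * combSq β a b c p q r x := by
  simp only [combSq, combGram_add_smul]
  ring

variable [DecidableEq V] {β : V → ℝ} {a b c p q r : V}

/-- The mixed determinant is linear in its last vector and ignores components in the plane of the
triangle. The terms at `p, q, r` may thus be completed to the whole combination, which is orthogonal
to the three vectors concerned. -/
theorem mixed_comb_eq_zero (hD : IsDist D) (hn : [a, b, c].Nodup) {v : V}
    (hb : combGram β a b c p q r b D = 0) (hc : combGram β a b c p q r c D = 0)
    (hv : combGram β a b c p q r v D = 0) :
    β p * mixed {a, b, c} v p D + β q * mixed {a, b, c} v q D + β r * mixed {a, b, c} v r D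
      = 0 := by
  rw [mixed_three hD hn, mixed_three hD hn, mixed_three hD hn]
  unfold combGram at hb hc hv
  rw [gram_comm hD a c b] at hc
  rw [gram_comm hD a v b, gram_comm hD a v c] at hv
  unfold det₃
  linear_combination
    8 * (gram a b b D * gram a c c D - gram a b c D ^ 2) * hv +
    8 * (gram a b c D * gram a b v D - gram a b b D * gram a c v D) * hc +
    8 * (gram a b c D * gram a c v D - gram a c c D * gram a b v D) * hb

/-- The same completion in both arguments of the bilinear form, without assuming any dependence; the
form applied twice to the whole combination remains. -/
theorem mixed_comb_comb (hD : IsDist D) (hn : [a, b, c].Nodup) :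
    β p * (β p * mixed {a, b, c} p p D + β q * mixed {a, b, c} p q D +
        β r * mixed {a, b, c} p r D) +
      β q * (β p * mixed {a, b, c} q p D + β q * mixed {a, b, c} q q D +
        β r * mixed {a, b, c} q r D) +
      β r * (β p * mixed {a, b, c} r p D + β q * mixed {a, b, c} r q D +
        β r * mixed {a, b, c} r r D) =
    8 * det₃ (gram a b b D) (gram a b c D) (gram a c c D) (combGram β a b c p q r b D)
      (combGram β a b c p q r c D) (combGram β a b c p q r b D) (combGram β a b c p q r c D)
      (combSq β a b c p q r D) := by
  simp only [mixed_three hD hn, combSq, combGram, det₃, gram_comm hD a c b, gram_comm hD a p b,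
    gram_comm hD a p c, gram_comm hD a q b, gram_comm hD a q c, gram_comm hD a q p,
    gram_comm hD a r b, gram_comm hD a r c, gram_comm hD a r p, gram_comm hD a r q]
  ring

end Gram

variable {V : Type*} [Fintype V] [DecidableEq V] {D : V → V → ℝ} {β : V → ℝ} {a b c p q r : V}

/-- Along the line all inner products with the combination are of first order in `t`. In the
determinant those with `b` and `c` enter quadratically, so the derivative at zero only sees the
inner square, multiplied by the Gram determinant of the triangle. -/
theorem fderiv_mixed_comb_comb (hD : IsDist D) (hn : [a, b, c].Nodup)
    (hb : combGram β a b c p q r b D = 0) (hc : combGram β a b c p q r c D = 0)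
    (hz : combSq β a b c p q r D = 0) {x : V → V → ℝ} (hx : IsDist x) :
    β p * (β p * fderiv ℝ (mixed {a, b, c} p p) D x + β q * fderiv ℝ (mixed {a, b, c} p q) D x +
        β r * fderiv ℝ (mixed {a, b, c} p r) D x) +
      β q * (β p * fderiv ℝ (mixed {a, b, c} q p) D x + β q * fderiv ℝ (mixed {a, b, c} q q) D x +
        β r * fderiv ℝ (mixed {a, b, c} q r) D x) +
      β r * (β p * fderiv ℝ (mixed {a, b, c} r p) D x + β q * fderiv ℝ (mixed {a, b, c} r q) D x +
        β r * fderiv ℝ (mixed {a, b, c} r r) D x) =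
    -2 * cm {a, b, c} D * combSq β a b c p q r x := by
  have hm : ∀ u v, HasDerivAt (fun t : ℝ => mixed {a, b, c} u v (D + t • x))
      (fderiv ℝ (mixed {a, b, c} u v) D x) 0 := fun u v =>
    hasDerivAt_line (differentiable_mixed _ u v D) x
  have h1 := ((((((hm p p).const_mul (β p)).fun_add ((hm p q).const_mul (β q))).fun_add
    ((hm p r).const_mul (β r))).const_mul (β p)).fun_add
    (((((hm q p).const_mul (β p)).fun_add ((hm q q).const_mul (β q))).fun_add
    ((hm q r).const_mul (β r))).const_mul (β q))).fun_add
    (((((hm r p).const_mul (β p)).fun_add ((hm r q).const_mul (β q))).fun_add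
    ((hm r r).const_mul (β r))).const_mul (β r))
  simp only [mixed_comb_comb (hD.add_smul hx _) hn] at h1
  -- The determinant along the line divided by `t`, so that the derivative at zero is `R 0`.
  let R : ℝ → ℝ := fun t => 8 * (((gram a b b D + t * gram a b b x) *
    (gram a c c D + t * gram a c c x) - (gram a b c D + t * gram a b c x) ^ 2) *
      combSq β a b c p q r x - t * ((gram a b b D + t * gram a b b x) *
        combGram β a b c p q r c x ^ 2 + (gram a c c D + t * gram a c c x) *
        combGram β a b c p q r b x ^ 2 - 2 * (gram a b c D + t * gram a b c x) *
        combGram β a b c p q r b x * combGram β a b c p q r c x))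
  have hR : DifferentiableAt ℝ R 0 := by fun_prop
  have h2 := (hasDerivAt_id (0 : ℝ)).fun_mul hR.hasDerivAt
  have h3 : (fun t : ℝ => id t * R t) = fun t : ℝ => 8 * det₃ (gram a b b (D + t • x))
      (gram a b c (D + t • x)) (gram a c c (D + t • x)) (combGram β a b c p q r b (D + t • x))
      (combGram β a b c p q r c (D + t • x)) (combGram β a b c p q r b (D + t • x))
      (combGram β a b c p q r c (D + t • x)) (combSq β a b c p q r (D + t • x)) := by
    funext t
    simp only [gram_add_smul, combGram_add_smul, combSq_add_smul, hb, hc, hz, R, det₃, id]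
    ring
  rw [h3] at h2
  rw [h1.unique h2, cm_three hD hn]
  simp only [R, id]
  ring

/-- After multiplication by `2 β₁ β₂ β₃` the two sides differ by `∑ a_i β_i (M β)_i`, where `a_i` is
the logarithmic derivative of the diagonal entry. This vanishes because `β` is in the kernel of `M`.
-/
theorem sum_angle_variation {M₁₁ M₂₂ M₃₃ M₁₂ M₂₃ M₃₁ N₁₁ N₂₂ N₃₃ N₁₂ N₂₃ N₃₁ β₁ β₂ β₃ : ℝ}
    (h₁ : β₁ * M₁₁ + β₂ * M₁₂ + β₃ * M₃₁ = 0) (h₂ : β₁ * M₁₂ + β₂ * M₂₂ + β₃ * M₂₃ = 0)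
    (h₃ : β₁ * M₃₁ + β₂ * M₂₃ + β₃ * M₃₃ = 0) (hM₁ : M₁₁ ≠ 0) (hM₂ : M₂₂ ≠ 0) (hM₃ : M₃₃ ≠ 0)
    (hβ₁ : β₁ ≠ 0) (hβ₂ : β₂ ≠ 0) (hβ₃ : β₃ ≠ 0) :
    (N₁₂ - M₁₂ * (N₁₁ / M₁₁ + N₂₂ / M₂₂) / 2) / β₃ +
      (N₂₃ - M₂₃ * (N₂₂ / M₂₂ + N₃₃ / M₃₃) / 2) / β₁ +
      (N₃₁ - M₃₁ * (N₃₃ / M₃₃ + N₁₁ / M₁₁) / 2) / β₂ =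
    (β₁ * (β₁ * N₁₁ + β₂ * N₁₂ + β₃ * N₃₁) + β₂ * (β₁ * N₁₂ + β₂ * N₂₂ + β₃ * N₂₃) +
      β₃ * (β₁ * N₃₁ + β₂ * N₂₃ + β₃ * N₃₃)) / (2 * β₁ * β₂ * β₃) := by
  obtain ⟨a₁, rfl⟩ : ∃ a, N₁₁ = a * M₁₁ := ⟨N₁₁ / M₁₁, by field_simp⟩
  obtain ⟨a₂, rfl⟩ : ∃ a, N₂₂ = a * M₂₂ := ⟨N₂₂ / M₂₂, by field_simp⟩
  obtain ⟨a₃, rfl⟩ : ∃ a, N₃₃ = a * M₃₃ := ⟨N₃₃ / M₃₃, by field_simp⟩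
  rw [mul_div_cancel_right₀ _ hM₁, mul_div_cancel_right₀ _ hM₂, mul_div_cancel_right₀ _ hM₃]
  field_simp
  linear_combination -a₁ * β₁ * h₁ - a₂ * β₂ * h₂ - a₃ * β₃ * h₃

theorem fderiv_angleOf_eq {σ i : Finset V} (h : Nondegenerate σ D) (hp : p ∈ σ) (hq : q ∈ σ)
    (hpq : p ≠ q) (hi : σ \ {p, q} = i) {x : V → V → ℝ} (hx : IsDist x) :
    fderiv ℝ (angleOf σ i) D x = -(fderiv ℝ (mixed i p q) D x - mixed i p q D *
      (fderiv ℝ (mixed i p p) D x / mixed i p p D +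
        fderiv ℝ (mixed i q q) D x / mixed i q q D) / 2) / √(cm i D * cm σ D) := by
  have h1 : mixed i p p = cm (σ.erase q) := by
    rw [← hi]
    exact funext (mixed_sdiff_self hp hpq)
  have h2 : mixed i q q = cm (σ.erase p) := by
    rw [← hi, Finset.pair_comm]
    exact funext (mixed_sdiff_self hq hpq.symm)
  have h3 := fderiv_angleOf_sdiff h hp hq hpq hx
  rw [fderiv_dihedralOf h hp hq hpq, hi] at h3
  rw [h3, h1, h2, add_comm (_ / cm (σ.erase p) D)]

theorem sign_div_abs {y : ℝ} (hy : y ≠ 0) : Real.sign y / |y| = 1 / y := by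
  rcases lt_or_gt_of_ne hy with h | h
  · rw [Real.sign_of_neg h, abs_of_neg h, neg_div_neg_eq]
  · rw [Real.sign_of_pos h, abs_of_pos h]

/-- Six points whose affine dependence has the oriented volumes of the six 4-simplices as
coefficients. -/
structure IsSixPoints (P : Finset V) (β : V → ℝ) (D : V → V → ℝ) : Prop where
  card_eq : P.card = 6
  ne_zero : ∀ p ∈ P, β p ≠ 0
  nondegenerate : ∀ p ∈ P, Nondegenerate (P.erase p) D
  cm_eq : ∀ p ∈ P, cm (P.erase p) D = -9216 * β p ^ 2
  sum_eq : ∑ p ∈ P, β p = 0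
  sum_dist : ∃ lam, ∀ w ∈ P, ∑ p ∈ P, β p * D w p = lam

/-- The signed sum of the dihedral angles around a triangle varies proportionally to the
variation of the Cayley–Menger determinant of the six points. -/
theorem IsSixPoints.sum_sign_angle {P : Finset V} (h : IsSixPoints P β D) {i : Finset V}
    (hi : i ⊆ P) (hic : i.card = 3) {x : V → V → ℝ} (hx : IsDist x) :
    ∑ r ∈ P \ i, Real.sign (β r) * fderiv ℝ (angleOf (P.erase r) i) D x =
      areaOf i D * (∑ s ∈ P, ∑ t ∈ P, β s * β t * x s t) / (48 * ∏ r ∈ P \ i, β r) := by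
  have hjc : (P \ i).card = 3 := by rw [Finset.card_sdiff_of_subset hi, h.card_eq, hic]
  have hPi : P = i ∪ P \ i := (Finset.union_sdiff_of_subset hi).symm
  have hdisj : Disjoint i (P \ i) := Finset.disjoint_sdiff
  obtain ⟨p, q, r, hpq, hpr, hqr, hj⟩ := Finset.card_eq_three.mp hjc
  obtain ⟨a, b, c, hab, hac, hbc, rfl⟩ := Finset.card_eq_three.mp hic
  rw [hj] at hPi hdisj ⊢
  have hn : [a, b, c].Nodup := by simp [hab, hac, hbc]
  simp only [Finset.disjoint_insert_right, Finset.disjoint_singleton_right, Finset.mem_insert,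
    Finset.mem_singleton, not_or] at hdisj
  obtain ⟨⟨hpa, hpb, hpc⟩, ⟨hqa, hqb, hqc⟩, ⟨hra, hrb, hrc⟩⟩ := hdisj
  have hsum : ∀ F : V → ℝ, ∑ s ∈ P, F s = F a + F b + F c + F p + F q + F r := by
    intro F
    rw [hPi, Finset.sum_union (by simp [*]), Finset.sum_insert (by simp [*]),
      Finset.sum_insert (by simp [*]), Finset.sum_singleton, Finset.sum_insert (by simp [*]),
      Finset.sum_insert (by simp [*]), Finset.sum_singleton]
    ring
  have ha : a ∈ P := hi (by simp)
  have hb : b ∈ P := hi (by simp)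
  have hc : c ∈ P := hi (by simp)
  have hp : p ∈ P := by rw [hPi]; simp
  have hq : q ∈ P := by rw [hPi]; simp
  have hr : r ∈ P := by rw [hPi]; simp
  have hD := (h.nondegenerate a ha).isDist
  obtain ⟨lam, hlam⟩ := h.sum_dist
  have hs := h.sum_eq
  rw [hsum] at hs
  -- The sums of `β p * D w p` agree at `w` and at `a`, and `∑ β = 0`; together this says that the
  -- dependence is orthogonal to `w - a`.
  have hcomb : ∀ w ∈ P, combGram β a b c p q r w D = 0 := by
    intro w hw
    have e1 := hlam w hw
    have e2 := hlam a ha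
    rw [hsum] at e1 e2
    unfold combGram gram
    rw [hD.symm w a] at e1
    rw [hD.self] at e2
    linear_combination (e2 - e1 + D a w * hs) / 2
  have hz : combSq β a b c p q r D = 0 := by
    simp [combSq, hcomb b hb, hcomb c hc, hcomb p hp, hcomb q hq, hcomb r hr]
  -- Polarization: as the coefficients sum to zero, the inner square of a combination is minus half
  -- of the sum of `β_s β_t` times squared distances. The sum over all of `P` does not prefer the
  -- base point `a`.
  have hQ : combSq β a b c p q r x = -(∑ s ∈ P, ∑ t ∈ P, β s * β t * x s t) / 2 := by
    simp only [hsum]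
    unfold combSq combGram gram
    rw [hx.self, hx.self, hx.self, hx.self, hx.self, hx.self, hx.symm b a, hx.symm c a,
      hx.symm p a, hx.symm q a, hx.symm r a]
    have hβ : β a = -(β b + β c + β p + β q + β r) := by linarith
    rw [hβ]
    ring
  -- The root in the angle derivative is `4 S` times `96 |β w|`, which gives `384`. The orientation
  -- sign divided by `|β w|` is `1 / β w`, so the signed angles fit `sum_angle_variation`.
  have hσ : ∀ {u v w : V}, ({u, v, w} : Finset V) = {p, q, r} → u ≠ v → u ≠ w → v ≠ w →
      Real.sign (β w) * fderiv ℝ (angleOf (P.erase w) {a, b, c}) D x =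
        -(1 / (384 * areaOf {a, b, c} D)) * ((fderiv ℝ (mixed {a, b, c} u v) D x -
          mixed {a, b, c} u v D * (fderiv ℝ (mixed {a, b, c} u u) D x / mixed {a, b, c} u u D +
          fderiv ℝ (mixed {a, b, c} v v) D x / mixed {a, b, c} v v D) / 2) / β w) := by
    intro u v w huvw huv huw hvw
    have hu' : u ∈ P \ {a, b, c} := by rw [hj, ← huvw]; simp
    have hv' : v ∈ P \ {a, b, c} := by rw [hj, ← huvw]; simp
    have hw' : w ∈ P \ {a, b, c} := by rw [hj, ← huvw]; simp
    have hw := (Finset.mem_sdiff.mp hw').1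
    have hset : P.erase w \ {u, v} = {a, b, c} := by
      rw [← Finset.sdiff_sdiff_eq_self hi, hj, ← huvw]
      ext y
      simp
      tauto
    have hnd := h.nondegenerate w hw
    rw [fderiv_angleOf_eq hnd (Finset.mem_erase.mpr ⟨huw, (Finset.mem_sdiff.mp hu').1⟩)
      (Finset.mem_erase.mpr ⟨hvw, (Finset.mem_sdiff.mp hv').1⟩) huv hset hx, h.cm_eq w hw]
    have hneg : cm {a, b, c} D < 0 := by
      refine hnd.cm_neg_of_card_three ?_ hic
      rw [← hset]
      exact Finset.sdiff_subset
    have hsq : √(cm {a, b, c} D * (-9216 * β w ^ 2)) = 384 * areaOf {a, b, c} D * |β w| := by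
      rw [areaOf, show cm {a, b, c} D * (-9216 * β w ^ 2) =
          -cm {a, b, c} D * (96 * β w) ^ 2 by ring,
        Real.sqrt_mul (by linarith), Real.sqrt_sq_eq_abs, abs_mul,
        abs_of_pos (by norm_num : (0 : ℝ) < 96)]
      ring
    rw [hsq]
    have hβw := h.ne_zero w hw
    have hS : areaOf {a, b, c} D ≠ 0 := by
      unfold areaOf
      have := Real.sqrt_pos.mpr (neg_pos.mpr hneg)
      positivity
    have := sign_div_abs hβw
    generalize fderiv ℝ (mixed {a, b, c} u v) D x - _ = T
    calc Real.sign (β w) * (-T / (384 * areaOf {a, b, c} D * |β w|))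
        = -(1 / (384 * areaOf {a, b, c} D)) * (T * (Real.sign (β w) / |β w|)) := by
          have : |β w| ≠ 0 := abs_ne_zero.mpr hβw
          field_simp
      _ = _ := by
          rw [this]
          ring
  have hmp : ∀ {u v w : V}, ({u, v, w} : Finset V) = {p, q, r} → u ≠ v → u ≠ w → v ≠ w →
      mixed {a, b, c} u u D ≠ 0 := by
    intro u v w huvw huv huw hvw
    have hu' : u ∈ P \ {a, b, c} := by rw [hj, ← huvw]; simp
    have hv' : v ∈ P \ {a, b, c} := by rw [hj, ← huvw]; simp
    have hw' : w ∈ P \ {a, b, c} := by rw [hj, ← huvw]; simp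
    have hset : P.erase w \ {u, v} = {a, b, c} := by
      rw [← Finset.sdiff_sdiff_eq_self hi, hj, ← huvw]
      ext y
      simp
      tauto
    rw [← hset, mixed_sdiff_self (Finset.mem_erase.mpr ⟨huw, (Finset.mem_sdiff.mp hu').1⟩) huv]
    exact ((h.nondegenerate w (Finset.mem_sdiff.mp hw').1).cm_erase_pos
      (Finset.mem_erase.mpr ⟨hvw, (Finset.mem_sdiff.mp hv').1⟩)).ne'
  have e1 : ({q, r, p} : Finset V) = {p, q, r} := by
    ext
    simp
    tauto
  have e2 : ({r, p, q} : Finset V) = {p, q, r} := by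
    ext
    simp
    tauto
  have hcomm : ∀ u v, fderiv ℝ (mixed {a, b, c} u v) D x = fderiv ℝ (mixed {a, b, c} v u) D x :=
    fun u v => fderiv_congr_dist (fun _ hD => mixed_comm hD _ u v) hD hx
      (differentiable_mixed _ _ _ D) (differentiable_mixed _ _ _ D)
  have hN := fderiv_mixed_comb_comb hD hn (hcomb b hb) (hcomb c hc) hz hx
  have hM₁ := mixed_comb_eq_zero hD hn (hcomb b hb) (hcomb c hc) (hcomb p hp)
  have hM₂ := mixed_comb_eq_zero hD hn (hcomb b hb) (hcomb c hc) (hcomb q hq)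
  have hM₃ := mixed_comb_eq_zero hD hn (hcomb b hb) (hcomb c hc) (hcomb r hr)
  rw [mixed_comm hD _ p r] at hM₁
  rw [mixed_comm hD _ q p] at hM₂
  rw [mixed_comm hD _ r q] at hM₃
  rw [hcomm p r, hcomm q p, hcomm r q] at hN
  have hT := sum_angle_variation (N₁₁ := fderiv ℝ (mixed {a, b, c} p p) D x)
    (N₂₂ := fderiv ℝ (mixed {a, b, c} q q) D x) (N₃₃ := fderiv ℝ (mixed {a, b, c} r r) D x)
    (N₁₂ := fderiv ℝ (mixed {a, b, c} p q) D x) (N₂₃ := fderiv ℝ (mixed {a, b, c} q r) D x)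
    (N₃₁ := fderiv ℝ (mixed {a, b, c} r p) D x) hM₁ hM₂ hM₃ (hmp rfl hpq hpr hqr)
    (hmp e1 hqr hpq.symm hpr.symm) (hmp e2 hpr.symm hqr.symm hpq) (h.ne_zero p hp)
    (h.ne_zero q hq) (h.ne_zero r hr)
  rw [hN] at hT
  rw [Finset.sum_insert (by simp [*]), Finset.sum_pair hqr, Finset.prod_insert (by simp [*]),
    Finset.prod_pair hqr, hσ e1 hqr hpq.symm hpr.symm, hσ e2 hpr.symm hqr.symm hpq,
    hσ rfl hpq hpr hqr, ← mul_add, ← mul_add]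
  have hcmS : cm {a, b, c} D = -16 * areaOf {a, b, c} D ^ 2 := by
    have hneg : cm {a, b, c} D < 0 := by
      refine (h.nondegenerate r hr).cm_neg_of_card_three ?_ hic
      intro v hv
      refine Finset.mem_erase.mpr ⟨?_, hi hv⟩
      rintro rfl
      simp [*] at hv
    rw [areaOf, div_pow, Real.sq_sqrt (by linarith)]
    ring
  have hS : areaOf {a, b, c} D ≠ 0 := by
    intro h0
    have := (h.nondegenerate r hr).cm_neg_of_card_three (i := {a, b, c}) (by
      intro v hv
      refine Finset.mem_erase.mpr ⟨?_, hi hv⟩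
      rintro rfl
      simp [*] at hv) hic
    rw [hcmS, h0] at this
    norm_num at this
  have hβp := h.ne_zero p hp
  have hβq := h.ne_zero q hq
  have hβr := h.ne_zero r hr
  trans -(1 / (384 * areaOf {a, b, c} D)) *
    (-2 * cm {a, b, c} D * combSq β a b c p q r x / (2 * β p * β q * β r))
  · rw [← hT]
    ring
  · rw [hcmS, hQ]
    field_simp
    ring

end SixPoints

/-! ### Lifts of simplices to the universal cover -/

theorem units_cast_sq (ε : ℤˣ) : ((ε : ℤ) : ℝ) ^ 2 = 1 := by
  rcases Int.units_eq_one_or ε with rfl | rfl <;> simp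

theorem exists_ordering {V : Type*} [DecidableEq V] {s : Finset V} {n : ℕ} (h : s.card = n) :
    ∃ t : Fin n → V, Function.Injective t ∧ Finset.univ.image t = s := by
  let e := Finset.equivFinOfCardEq h
  refine ⟨fun i => e.symm i, Subtype.val_injective.comp e.symm.injective, ?_⟩
  ext v
  simp only [Finset.mem_image, Finset.mem_univ, true_and]
  exact ⟨fun ⟨i, hi⟩ => hi ▸ (e.symm i).2, fun hv => ⟨e ⟨v, hv⟩, by simp⟩⟩

theorem image_univ_mem {V : Type*} [DecidableEq V] {s : Finset V} {n : ℕ} {t : Fin n → V}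
    (h : Finset.univ.image t = s) (i : Fin n) : t i ∈ s :=
  h ▸ Finset.mem_image_of_mem t (Finset.mem_univ i)

section Cover

theorem mem_of_subset {V : Type*} {K : AbstractSimplicialComplex V} {s t : Finset V}
    (hs : s ∈ K) (hts : t ⊆ s) (ht : t.Nonempty) : t ∈ K :=
  (K.isRelLowerSet_faces hs).2 hts ht

variable {V : Type*} [DecidableEq V] {K : AbstractSimplicialComplex V} {v₀ : V}

namespace PathClass

variable {u v w x : V}

theorem comp_assoc (a : PathClass K u v) (b : PathClass K v w) (c : PathClass K w x) :
    (a.comp b).comp c = a.comp (b.comp c) := by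
  induction a using Quotient.inductionOn
  induction b using Quotient.inductionOn
  induction c using Quotient.inductionOn
  exact congrArg PathClass.mk (SimpleGraph.Walk.append_assoc _ _ _).symm

theorem comp_nil (a : PathClass K u v) : a.comp (PathClass.mk .nil) = a := by
  induction a using Quotient.inductionOn
  exact congrArg PathClass.mk (SimpleGraph.Walk.append_nil _)

theorem inv_comp (a : PathClass K u v) : a.inv.comp a = PathClass.mk .nil := by
  induction a using Quotient.inductionOn
  exact Quotient.sound (s := homotopySetoid K v v) (Homotopic.reverse_append _)

/-- The class of an edge. -/
def edge (h : (skeleton K).Adj u v) : PathClass K u v := PathClass.mk (.cons h .nil)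

theorem edge_comp_edge_symm (h : (skeleton K).Adj u v) :
    (edge h).comp (edge h.symm) = PathClass.mk .nil :=
  Quotient.sound (s := homotopySetoid K u u) (.backtrack h .nil)

theorem edge_comp_edge (huv : (skeleton K).Adj u v) (hvw : (skeleton K).Adj v w)
    (huw : (skeleton K).Adj u w) (ht : ({u, v, w} : Finset V) ∈ K) :
    (edge huv).comp (edge hvw) = edge huw :=
  Quotient.sound (s := homotopySetoid K u w) (.triangle huv hvw huw ht .nil)

end PathClass

theorem coverAdj_iff {x y : CoverVertex K v₀} :
    CoverAdj x y ↔ ∃ h : (skeleton K).Adj x.1 y.1, y.2 = x.2.comp (PathClass.edge h) := by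
  constructor
  · rintro ⟨p, h, hx, hy⟩
    refine ⟨h, ?_⟩
    rw [hx, hy]
    rfl
  · rintro ⟨h, hy⟩
    obtain ⟨u, c⟩ := x
    induction c using Quotient.inductionOn with
    | h p => exact ⟨p, h, rfl, hy⟩

theorem CoverAdj.symm {x y : CoverVertex K v₀} (h : CoverAdj x y) : CoverAdj y x := by
  rw [coverAdj_iff] at h ⊢
  obtain ⟨h, hy⟩ := h
  refine ⟨h.symm, ?_⟩
  rw [hy, PathClass.comp_assoc, PathClass.edge_comp_edge_symm, PathClass.comp_nil]

open scoped Classical in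
/-- The neighbour over `w` of the vertex `x` of the universal cover. -/
noncomputable def neighbour (x : CoverVertex K v₀) (w : V) : CoverVertex K v₀ :=
  -- The default value makes `x` the neighbour over its own projection, so a simplex that contains
  -- `x.1` lifts as a whole.
  if h : (skeleton K).Adj x.1 w then ⟨w, x.2.comp (PathClass.edge h)⟩ else x

theorem neighbour_of_adj {x : CoverVertex K v₀} {w : V} (h : (skeleton K).Adj x.1 w) :
    neighbour x w = ⟨w, x.2.comp (PathClass.edge h)⟩ := dif_pos h

theorem neighbour_of_not_adj {x : CoverVertex K v₀} {w : V} (h : ¬(skeleton K).Adj x.1 w) :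
    neighbour x w = x := dif_neg h

theorem neighbour_self (x : CoverVertex K v₀) : neighbour x x.1 = x :=
  neighbour_of_not_adj (SimpleGraph.irrefl _)

theorem adj_of_mem {s : Finset V} (hs : s ∈ K) {u v : V} (hu : u ∈ s) (hv : v ∈ s) (huv : u ≠ v) :
    (skeleton K).Adj u v :=
  ⟨huv, mem_of_subset hs (by simp [Finset.insert_subset_iff, hu, hv]) ⟨u, by simp⟩⟩

theorem neighbour_fst {s : Finset V} (hs : s ∈ K) {x : CoverVertex K v₀} {w : V} (hx : x.1 ∈ s)
    (hw : w ∈ s) : (neighbour x w).1 = w := by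
  by_cases h : x.1 = w
  · subst h
    rw [neighbour_self]
  · rw [neighbour_of_adj (adj_of_mem hs hx hw h)]

theorem coverAdj_neighbour {x : CoverVertex K v₀} {w : V} (h : (skeleton K).Adj x.1 w) :
    CoverAdj x (neighbour x w) := by
  rw [neighbour_of_adj h]
  exact coverAdj_iff.mpr ⟨h, rfl⟩

/-- The triangle with `x`, a face of the same simplex, makes the path through `v` homotopic to the
direct edge to `w`. -/
theorem coverAdj_neighbour_neighbour {s : Finset V} (hs : s ∈ K) {x : CoverVertex K v₀} {v w : V}
    (hx : x.1 ∈ s) (hv : v ∈ s) (hw : w ∈ s) (hvw : v ≠ w) :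
    CoverAdj (neighbour x v) (neighbour x w) := by
  by_cases h : x.1 = v
  · subst h
    rw [neighbour_self]
    exact coverAdj_neighbour (adj_of_mem hs hx hw hvw)
  · by_cases h' : x.1 = w
    · subst h'
      rw [neighbour_self]
      exact (coverAdj_neighbour (adj_of_mem hs hx hv h)).symm
    · have a₁ := adj_of_mem hs hx hv h
      have a₂ := adj_of_mem hs hx hw h'
      rw [neighbour_of_adj a₁, neighbour_of_adj a₂]
      refine coverAdj_iff.mpr ⟨adj_of_mem hs hv hw hvw, ?_⟩
      rw [PathClass.comp_assoc, PathClass.edge_comp_edge a₁ _ a₂]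
      exact mem_of_subset hs (by simp [Finset.insert_subset_iff, hx, hv, hw]) ⟨x.1, by simp⟩

/-- Two neighbours of `x` are joined by an edge also if, instead of the triangle with `x`, the
cone over it from another vertex `d` belongs to the complex. -/
theorem coverAdj_neighbour_of_cone {x : CoverVertex K v₀} {v w d : V}
    (hv : ({x.1, v, d} : Finset V) ∈ K) (hw : ({x.1, w, d} : Finset V) ∈ K)
    (ht : ({v, d, w} : Finset V) ∈ K) (hxv : x.1 ≠ v) (hxw : x.1 ≠ w) (hxd : x.1 ≠ d)
    (hvw : v ≠ w) (hvd : v ≠ d) (hwd : w ≠ d) : CoverAdj (neighbour x v) (neighbour x w) := by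
  have a₁ : (skeleton K).Adj x.1 v := adj_of_mem hv (by simp) (by simp) hxv
  have a₂ : (skeleton K).Adj x.1 w := adj_of_mem hw (by simp) (by simp) hxw
  have a₃ : (skeleton K).Adj x.1 d := adj_of_mem hw (by simp) (by simp) hxd
  have a₄ : (skeleton K).Adj v d := adj_of_mem ht (by simp) (by simp) hvd
  have a₅ : (skeleton K).Adj d w := adj_of_mem ht (by simp) (by simp) hwd.symm
  have a₆ : (skeleton K).Adj v w := adj_of_mem ht (by simp) (by simp) hvw
  rw [neighbour_of_adj a₁, neighbour_of_adj a₂]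
  refine coverAdj_iff.mpr ⟨a₆, ?_⟩
  rw [PathClass.comp_assoc, ← PathClass.edge_comp_edge a₄ a₅ a₆ ht, ← PathClass.comp_assoc
    (PathClass.edge a₁), PathClass.edge_comp_edge a₁ a₄ a₃ hv, PathClass.edge_comp_edge a₃ a₅ a₂]
  rw [show ({x.1, d, w} : Finset V) = {x.1, w, d} by
    ext
    simp
    tauto]
  exact hw

theorem IsLift.injective {n : ℕ} {s : Simplex K n} {x : Fin (n + 1) → CoverVertex K v₀}
    (h : IsLift s x) : Function.Injective fun i => (x i).1 := by
  have hc : (Finset.univ.image fun i => (x i).1).card =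
      (Finset.univ : Finset (Fin (n + 1))).card := by
    rw [h.1, s.2.2, Finset.card_univ, Fintype.card_fin]
  rw [Finset.card_image_iff] at hc
  exact fun i j hij => hc (Finset.mem_coe.mpr (Finset.mem_univ i))
    (Finset.mem_coe.mpr (Finset.mem_univ j)) hij

theorem isLift_neighbour {n : ℕ} (s : Simplex K n) {x : CoverVertex K v₀} (hx : x.1 ∈ s.1)
    (t : Fin (n + 1) → V) (ht : Finset.univ.image t = s.1) :
    IsLift s fun i => neighbour x (t i) := by
  have hmem : ∀ i, t i ∈ s.1 := fun i => ht ▸ Finset.mem_image_of_mem t (Finset.mem_univ i)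
  have hinj : Function.Injective t := by
    have hc : (Finset.univ.image t).card = (Finset.univ : Finset (Fin (n + 1))).card := by
      rw [ht, s.2.2, Finset.card_univ, Fintype.card_fin]
    rw [Finset.card_image_iff] at hc
    exact fun i j hij => hc (Finset.mem_coe.mpr (Finset.mem_univ i))
      (Finset.mem_coe.mpr (Finset.mem_univ j)) hij
  refine ⟨?_, fun i j hij => coverAdj_neighbour_neighbour s.2.1 hx (hmem i) (hmem j)
    fun h => hij (hinj h)⟩
  rw [← ht]
  exact Finset.image_congr fun i _ => neighbour_fst s.2.1 hx (hmem i)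

/-- Two lifts of the same ordering of the vertices differ by a deck transformation. -/
theorem exists_deck_eq {n : ℕ} {v : Fin (n + 1) → V} {c d : ∀ i, PathClass K v₀ (v i)}
    (hc : ∀ i j, i ≠ j → CoverAdj (⟨v i, c i⟩ : CoverVertex K v₀) ⟨v j, c j⟩)
    (hd : ∀ i j, i ≠ j → CoverAdj (⟨v i, d i⟩ : CoverVertex K v₀) ⟨v j, d j⟩) :
    ∃ g : FundGroup K v₀, ∀ i, d i = PathClass.comp g (c i) := by
  have h0 : d 0 = ((d 0).comp (c 0).inv).comp (c 0) := by
    rw [PathClass.comp_assoc, PathClass.inv_comp, PathClass.comp_nil]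
  refine ⟨(d 0).comp (c 0).inv, fun i => ?_⟩
  rcases eq_or_ne i 0 with rfl | hi
  · exact h0
  · obtain ⟨h, hci⟩ := coverAdj_iff.mp (hc 0 i hi.symm)
    obtain ⟨h', hdi⟩ := coverAdj_iff.mp (hd 0 i hi.symm)
    change c i = (c 0).comp (PathClass.edge h) at hci
    change d i = (d 0).comp (PathClass.edge h') at hdi
    rw [hci, ← PathClass.comp_assoc, ← h0, hdi]

/-- This is why lengths and oriented volumes do not depend on the chosen lift: `f` turns a deck
transformation into a proper motion, and a permutation affects orientation and volume alike. -/
theorem IsLift.exists_deck_perm {n : ℕ} {s : Simplex K n} {x y : Fin (n + 1) → CoverVertex K v₀}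
    (hx : IsLift s x) (hy : IsLift s y) :
    ∃ (g : FundGroup K v₀) (π : Equiv.Perm (Fin (n + 1))), ∀ i, y i = deck g (x (π i)) := by
  have hmem : ∀ i, ∃ j, (x j).1 = (y i).1 := fun i => by
    have : (y i).1 ∈ Finset.univ.image fun i => (x i).1 := by
      rw [hx.1, ← hy.1]
      exact Finset.mem_image_of_mem (fun i => (y i).1) (Finset.mem_univ i)
    simpa using this
  choose π hπ using hmem
  have hπi : Function.Injective π := fun i j hij => hy.injective (by
    change (y i).1 = (y j).1
    rw [← hπ, ← hπ, hij])
  have hbij := Finite.injective_iff_bijective.mp hπi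
  have heq : ∀ i, y i = ⟨(x (π i)).1, (hπ i) ▸ (y i).2⟩ := fun i => by
    generalize y i = z, hπ i = h
    obtain ⟨a, b⟩ := z
    change (x (π i)).1 = a at h
    subst h
    rfl
  obtain ⟨g, hg⟩ := exists_deck_eq (v := fun i => (x (π i)).1) (c := fun i => (x (π i)).2)
    (d := fun i => (hπ i) ▸ (y i).2) (fun i j hij => hx.2 _ _ (hπi.ne hij))
    (fun i j hij => by
      have := hy.2 i j hij
      rw [heq i, heq j] at this
      exact this)
  refine ⟨g, Equiv.ofBijective π hbij, fun i => ?_⟩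
  rw [heq i, hg i]
  rfl

end Cover

/-! ### Oriented volume under permutations and proper motions. -/

section SignedVolume

open Matrix

/-- The form with a column of ones treats the five points alike, so permutations of the points
become permutations of rows, and six points can be related by a Laplace expansion. -/
theorem signedVolume_eq_det (P : Fin 5 → E4) : signedVolume P =
    (Matrix.of fun i j : Fin 5 => (Fin.cons 1 (P i) : Fin 5 → ℝ) j).det / 24 := by
  have h : (Matrix.of fun i j : Fin 5 => (Fin.cons 1 (P i) : Fin 5 → ℝ) j).det =
      (Matrix.of fun i j : Fin 5 => (Fin.cases (Fin.cons 1 (P 0)) (fun i : Fin 4 =>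
        Fin.cons 0 (P i.succ - P 0)) i : Fin 5 → ℝ) j).det := by
    refine det_eq_of_forall_row_eq_smul_add_const (Fin.cases 0 fun _ => 1) 0 rfl fun i j => ?_
    refine Fin.cases ?_ (fun i => ?_) i <;> refine Fin.cases ?_ (fun j => ?_) j <;> simp
  rw [h, det_succ_column_zero, Fin.sum_univ_succ]
  simp only [signedVolume]
  simp
  rfl

theorem signedVolume_comp_perm (P : Fin 5 → E4) (π : Equiv.Perm (Fin 5)) :
    signedVolume (P ∘ π) = ((Equiv.Perm.sign π : ℤ) : ℝ) * signedVolume P := by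
  rw [signedVolume_eq_det, signedVolume_eq_det, ← mul_div_assoc, ← det_permute]
  rfl

theorem signedVolume_comp_isometry (φ : E4 ≃ᵃⁱ[ℝ] E4)
    (hφ : LinearMap.det (φ.linearIsometryEquiv.toLinearEquiv : E4 →ₗ[ℝ] E4) = 1) (P : Fin 5 → E4) :
    signedVolume (φ ∘ P) = signedVolume P := by
  set A : E4 →ₗ[ℝ] E4 := (φ.linearIsometryEquiv.toLinearEquiv : E4 →ₗ[ℝ] E4) with hA
  let b := (EuclideanSpace.basisFun (Fin 4) ℝ).toBasis
  have hdiff : ∀ i, (φ ∘ P) i - (φ ∘ P) 0 = A (P i - P 0) := fun i => by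
    have := φ.map_vsub (P i) (P 0)
    exact this.symm
  have hm : (Matrix.of fun i j : Fin 4 => ((φ ∘ P) i.succ - (φ ∘ P) 0) j) =
      (Matrix.of fun i j : Fin 4 => (P i.succ - P 0) j) * (LinearMap.toMatrix b b A)ᵀ := by
    ext i j
    rw [of_apply, hdiff]
    have := congrFun (LinearMap.toMatrix_mulVec_repr b b A (P i.succ - P 0)) j
    have hr : ∀ v : E4, ∀ k, b.repr v k = v k := fun v k => by simp [b]
    rw [hr] at this
    rw [← this]
    simp only [mulVec, dotProduct, mul_apply, transpose_apply, of_apply, hr]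
    exact Finset.sum_congr rfl fun k _ => mul_comm _ _
  rw [signedVolume, signedVolume, hm, det_mul, det_transpose, LinearMap.det_toMatrix, hφ, mul_one]

end SignedVolume

/-! ### Lengths and volumes computed from an arbitrary lift. -/

namespace FlatManifold

variable {V : Type*} [Fintype V] [DecidableEq V] {v₀ : V} (T : FlatManifold V v₀)

theorem L₀_eq (a : T.Edge) {x : Fin 2 → CoverVertex T.K v₀} (hx : IsLift a x) :
    T.L₀ a = dist (T.f (x 0)) (T.f (x 1)) ^ 2 := by
  have h : ∃ x : Fin 2 → CoverVertex T.K v₀, IsLift a x := ⟨x, hx⟩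
  rw [L₀, dif_pos h]
  obtain ⟨g, π, hπ⟩ := hx.exists_deck_perm h.choose_spec
  rw [hπ, hπ, T.f_deck, T.f_deck, (T.φ g).dist_map]
  have : ∀ π : Equiv.Perm (Fin 2), (π 0 = 0 ∧ π 1 = 1) ∨ (π 0 = 1 ∧ π 1 = 0) := by decide
  rcases this π with ⟨h0, h1⟩ | ⟨h0, h1⟩
  · rw [h0, h1]
  · rw [h0, h1, dist_comm]

theorem vol_eq (σ : T.Cell) {x : Fin 5 → CoverVertex T.K v₀} (hx : IsLift σ x) :
    T.vol σ = ((T.o.sign fun i => (x i).1 : ℤ) : ℝ) * signedVolume (T.f ∘ x) := by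
  have h : ∃ x : Fin 5 → CoverVertex T.K v₀, IsLift σ x := ⟨x, hx⟩
  rw [vol, dif_pos h]
  obtain ⟨g, π, hπ⟩ := hx.exists_deck_perm h.choose_spec
  have h1 : (fun i => (h.choose i).1) = (fun i => (x i).1) ∘ π := by
    funext i
    rw [hπ]
    rfl
  have h2 : T.f ∘ h.choose = T.φ g ∘ ((T.f ∘ x) ∘ π) := by
    funext i
    simp only [Function.comp_apply]
    rw [hπ, T.f_deck]
  have h3 : IsFourSimplex T.K fun i => (x i).1 := ⟨hx.injective, by rw [hx.1]; exact σ.2.1⟩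
  rw [h1, h2, signedVolume_comp_isometry _ (T.φ_proper g), signedVolume_comp_perm,
    T.o.sign_perm _ _ h3]
  have : ((Equiv.Perm.sign π : ℤ) : ℝ) * ((Equiv.Perm.sign π : ℤ) : ℝ) = 1 := by
    rw [← Int.cast_mul, ← Units.val_mul, Int.units_mul_self]
    simp
  rw [Units.val_mul, Int.cast_mul]
  linear_combination ((T.o.sign fun i => (x i).1 : ℤ) : ℝ) * signedVolume (T.f ∘ x) * this

theorem exists_coverVertex (u : V) : ∃ x : CoverVertex T.K v₀, x.1 = u := by
  obtain ⟨p⟩ := T.connected.preconnected v₀ u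
  exact ⟨⟨u, PathClass.mk p⟩, rfl⟩

theorem isDist_sq (L : T.Edge → ℝ) : IsDist (T.sq L) where
  symm u v := by
    by_cases h : ({u, v} : Finset V) ∈ T.K ∧ ({u, v} : Finset V).card = 1 + 1
    · have h' := h
      rw [Finset.pair_comm] at h'
      rw [sq, sq, dif_pos h, dif_pos h']
      exact congrArg L (Subtype.ext (Finset.pair_comm u v))
    · have h' := h
      rw [Finset.pair_comm] at h'
      rw [sq, sq, dif_neg h, dif_neg h']
  self u := by simp [sq]

theorem sq_L₀ {x y : CoverVertex T.K v₀} (h : CoverAdj x y) :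
    T.sq T.L₀ x.1 y.1 = dist (T.f x) (T.f y) ^ 2 := by
  obtain ⟨hadj, -⟩ := coverAdj_iff.mp h
  have hc : ({x.1, y.1} : Finset V) ∈ T.K ∧ ({x.1, y.1} : Finset V).card = 1 + 1 :=
    ⟨hadj.2, Finset.card_pair hadj.1⟩
  rw [sq, dif_pos hc]
  refine T.L₀_eq ⟨_, hc⟩ (x := ![x, y]) ⟨?_, ?_⟩
  · ext v
    simp [Fin.exists_fin_two, eq_comm]
  · intro i j hij
    fin_cases i <;> fin_cases j
    · exact absurd rfl hij
    · exact h
    · exact h.symm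
    · exact absurd rfl hij

theorem sq_L₀_neighbour {s : Finset V} (hs : s ∈ T.K) {x : CoverVertex T.K v₀} (hx : x.1 ∈ s)
    {u v : V} (hu : u ∈ s) (hv : v ∈ s) :
    T.sq T.L₀ u v = dist (T.f (neighbour x u)) (T.f (neighbour x v)) ^ 2 := by
  rcases eq_or_ne u v with rfl | huv
  · simp [(T.isDist_sq _).self]
  · rw [← T.sq_L₀ (coverAdj_neighbour_neighbour hs hx hu hv huv), neighbour_fst hs hx hu,
      neighbour_fst hs hx hv]

theorem vol_ne_zero (σ : T.Cell) : T.vol σ ≠ 0 := by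
  have hne : σ.1.Nonempty := Finset.card_pos.mp (by rw [σ.2.2]; norm_num)
  obtain ⟨u, hu⟩ := hne
  obtain ⟨x, rfl⟩ := T.exists_coverVertex u
  obtain ⟨t, hinj, ht⟩ := exists_ordering σ.2.2
  have hl := isLift_neighbour σ hu _ ht
  rw [T.vol_eq σ hl]
  exact mul_ne_zero (by simp) (T.nondegenerate σ _ hl)

theorem affineIndependent_neighbour (σ : T.Cell) {x : CoverVertex T.K v₀} (hx : x.1 ∈ σ.1) :
    AffineIndependent ℝ fun v : σ.1 => T.f (neighbour x v) := by
  obtain ⟨t, hinj, ht⟩ := exists_ordering σ.2.2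
  have hl := isLift_neighbour σ hx _ ht
  have := affineIndependent_of_signedVolume_ne_zero (T.nondegenerate σ _ hl)
  let e : Fin 5 ≃ σ.1 := Equiv.ofBijective (fun i => ⟨t i, image_univ_mem ht i⟩)
    ⟨fun i j hij => hinj (congrArg Subtype.val hij), by
      rintro ⟨v, hv⟩
      rw [← ht] at hv
      obtain ⟨i, -, rfl⟩ := Finset.mem_image.mp hv
      exact ⟨i, rfl⟩⟩
  exact (affineIndependent_equiv e).mp this

theorem cm_sq_L₀_pos (σ : T.Cell) {s : Finset V} (hs : s ⊆ σ.1) (hne : s.Nonempty) :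
    0 < (-1) ^ s.card * cm s (T.sq T.L₀) := by
  obtain ⟨u, hu⟩ := hne
  obtain ⟨n, hn⟩ : ∃ n, s.card = n + 1 :=
    ⟨s.card - 1, (Nat.succ_pred_eq_of_pos (Finset.card_pos.mpr ⟨u, hu⟩)).symm⟩
  obtain ⟨x, rfl⟩ := T.exists_coverVertex u
  obtain ⟨t, hinj, ht⟩ := exists_ordering hn
  have hai : AffineIndependent ℝ fun i => T.f (neighbour x (t i)) := by
    have := (T.affineIndependent_neighbour σ (hs hu)).comp_embedding
      ⟨fun i => (⟨t i, hs (image_univ_mem ht i)⟩ : σ.1), fun i j hij =>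
        hinj (congrArg Subtype.val hij)⟩
    exact this
  have := cm_pos (T.isDist_sq T.L₀) hinj (fun i j => T.sq_L₀_neighbour σ.2.1 (hs hu)
    (hs (image_univ_mem ht i)) (hs (image_univ_mem ht j))) hai
  rw [ht] at this
  rw [hn]
  exact this

theorem nondegenerate_sq (σ : T.Cell) : Nondegenerate σ.1 (T.sq T.L₀) where
  card_eq := σ.2.2
  isDist := T.isDist_sq _
  cm_pos _ hs hne := T.cm_sq_L₀_pos σ hs hne

end FlatManifold

/-! ### Deformations as kernels of the matrix of deficit angles -/

section SimplexSum

variable {V : Type*} [Finite V] [DecidableEq V] {K : AbstractSimplicialComplex V}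

theorem sum_simplex_subset {s : Finset V} (hs : s ∈ K) (n : ℕ) {M : Type*} [AddCommMonoid M]
    (g : Finset V → M) :
    ∑ i : Simplex K n with i.1 ⊆ s, g i.1 = ∑ i ∈ s.powersetCard (n + 1), g i := by
  refine Finset.sum_bij (fun i _ => i.1) (fun i hi => ?_) (fun i _ j _ hij => Subtype.ext hij)
    (fun i hi => ?_) fun _ _ => rfl
  · exact Finset.mem_powersetCard.mpr ⟨(Finset.mem_filter.mp hi).2, i.2.2⟩
  · obtain ⟨h1, h2⟩ := Finset.mem_powersetCard.mp hi
    exact ⟨⟨i, mem_of_subset hs h1 (Finset.card_pos.mp (by omega)), h2⟩, by simpa using h1, rfl⟩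

theorem card_simplex_subset {s : Finset V} (hs : s ∈ K) (n : ℕ) :
    Fintype.card {i : Simplex K n // i.1 ⊆ s} = s.card.choose (n + 1) := by
  rw [Fintype.card_subtype, Finset.card_eq_sum_ones, sum_simplex_subset hs n fun _ => 1,
    ← Finset.card_eq_sum_ones, Finset.card_powersetCard]

end SimplexSum

namespace FlatManifold

open Matrix

variable {V : Type*} [Fintype V] [DecidableEq V] {v₀ : V} (T : FlatManifold V v₀)

/-- The extension of squared edge lengths to an array, as a linear map. -/
noncomputable def sqL : (T.Edge → ℝ) →L[ℝ] (V → V → ℝ) :=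
  LinearMap.toContinuousLinearMap
    { toFun := T.sq
      map_add' := fun x y => by
        ext u v
        by_cases h : ({u, v} : Finset V) ∈ T.K ∧ ({u, v} : Finset V).card = 1 + 1 <;>
          simp only [sq, h, Pi.add_apply, dite_true, dite_false, add_zero, and_self]
      map_smul' := fun c x => by
        ext u v
        by_cases h : ({u, v} : Finset V) ∈ T.K ∧ ({u, v} : Finset V).card = 1 + 1 <;>
          simp only [sq, h, Pi.smul_apply, dite_true, dite_false, smul_zero, and_self,
            RingHom.id_apply] }

variable {T}

theorem fderiv_area {σ : T.Cell} {i : T.Face} (hi : i.1 ⊆ σ.1) (l : T.Edge → ℝ) :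
    fderiv ℝ (T.area i) T.L₀ l = fderiv ℝ (areaOf i.1) (T.sq T.L₀) (T.sq l) := by
  have h : DifferentiableAt ℝ (areaOf i.1) (T.sqL T.L₀) :=
    differentiableAt_areaOf ((T.nondegenerate_sq σ).cm_neg_of_card_three hi i.2.2)
  have h' := fderiv_comp T.L₀ h T.sqL.differentiableAt
  rw [T.sqL.fderiv] at h'
  exact DFunLike.congr_fun h' l

theorem differentiableAt_angle {σ : T.Cell} {i : T.Face} (hi : i.1 ⊆ σ.1) :
    DifferentiableAt ℝ (T.angle σ i) T.L₀ := by
  have h : DifferentiableAt ℝ (angleOf σ.1 i.1) (T.sqL T.L₀) :=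
    differentiableAt_angleOf (T.nondegenerate_sq σ) hi i.2.2
  exact DifferentiableAt.comp T.L₀ h T.sqL.differentiableAt

theorem fderiv_angle {σ : T.Cell} {i : T.Face} (hi : i.1 ⊆ σ.1) (l : T.Edge → ℝ) :
    fderiv ℝ (T.angle σ i) T.L₀ l = fderiv ℝ (angleOf σ.1 i.1) (T.sq T.L₀) (T.sq l) := by
  have h : DifferentiableAt ℝ (angleOf σ.1 i.1) (T.sqL T.L₀) :=
    differentiableAt_angleOf (T.nondegenerate_sq σ) hi i.2.2
  have h' := fderiv_comp T.L₀ h T.sqL.differentiableAt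
  rw [T.sqL.fderiv] at h'
  exact DFunLike.congr_fun h' l

variable (T)

theorem fderiv_deficit (i : T.Face) (l : T.Edge → ℝ) :
    fderiv ℝ (T.deficit i) T.L₀ l = -∑ σ : T.Cell with i.1 ⊆ σ.1,
      Real.sign (T.vol σ) * fderiv ℝ (angleOf σ.1 i.1) (T.sq T.L₀) (T.sq l) := by
  have h : HasFDerivAt (T.deficit i) (-∑ σ : T.Cell with i.1 ⊆ σ.1,
      Real.sign (T.vol σ) • fderiv ℝ (T.angle σ i) T.L₀) T.L₀ :=
    (HasFDerivAt.fun_sum fun σ hσ => ((differentiableAt_angle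
      (Finset.mem_filter.mp hσ).2).hasFDerivAt.const_mul (Real.sign (T.vol σ)))).fun_neg
  rw [h.fderiv]
  simp only [_root_.neg_apply, _root_.sum_apply,
    _root_.smul_apply, smul_eq_mul]
  refine congrArg Neg.neg (Finset.sum_congr rfl fun σ hσ => ?_)
  rw [fderiv_angle (Finset.mem_filter.mp hσ).2]

theorem dωdL_mulVec (u : T.Edge → ℝ) (i : T.Face) :
    (T.dωdL *ᵥ u) i = fderiv ℝ (T.deficit i) T.L₀ u := by
  have h := LinearMap.pi_apply_eq_sum_univ
    (fderiv ℝ (T.deficit i) T.L₀ : (T.Edge → ℝ) →ₗ[ℝ] ℝ) u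
  simp only [ContinuousLinearMap.coe_coe, smul_eq_mul] at h
  rw [h, mulVec, dotProduct]
  refine Finset.sum_congr rfl fun a _ => ?_
  rw [mul_comm, dωdL, of_apply]
  congr 2
  ext b
  simp [Pi.single_apply, eq_comm]

theorem mem_lengthDeformations {u : T.Edge → ℝ} :
    u ∈ T.lengthDeformations ↔ T.dωdL *ᵥ u = 0 := by
  simp only [lengthDeformations, Submodule.mem_iInf, funext_iff, dωdL_mulVec, Pi.zero_apply]
  rfl

/-- Grouped by 4-simplices, both sides are sums of the Schläfli bilinear form, evaluated on the unit
variation of the edge `a` and on `l σ` in the two orders. The symmetry of the form eliminates the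
auxiliary lengths `l` in favour of the areas `s`. -/
theorem dΩ_eq {s : T.Face → ℝ} {l : T.Cell → T.Edge → ℝ}
    (h : ∀ (σ : T.Cell) (i : T.Face), i.1 ⊆ σ.1 → fderiv ℝ (T.area i) T.L₀ (l σ) = s i)
    (a : T.Edge) : T.dΩ a l = (T.dωdLᵀ *ᵥ s) a := by
  set e : T.Edge → ℝ := Pi.single a 1 with he
  have h1 : T.dΩ a l = -∑ σ : T.Cell, Real.sign (T.vol σ) *
      ∑ i : T.Face with i.1 ⊆ σ.1, fderiv ℝ (areaOf i.1) (T.sq T.L₀) (T.sq e) *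
        fderiv ℝ (angleOf σ.1 i.1) (T.sq T.L₀) (T.sq (l σ)) := by
    simp only [dΩ, dω, mul_neg, Finset.sum_neg_distrib, Finset.mul_sum, Finset.sum_filter]
    rw [Finset.sum_comm]
    refine congrArg Neg.neg (Finset.sum_congr rfl fun σ _ => Finset.sum_congr rfl fun i _ => ?_)
    split_ifs with hi
    · rw [fderiv_area hi, fderiv_angle hi]
      ring
    · simp
  have h2 : (T.dωdLᵀ *ᵥ s) a = -∑ σ : T.Cell, Real.sign (T.vol σ) *
      ∑ i : T.Face with i.1 ⊆ σ.1, fderiv ℝ (areaOf i.1) (T.sq T.L₀) (T.sq (l σ)) *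
        fderiv ℝ (angleOf σ.1 i.1) (T.sq T.L₀) (T.sq e) := by
    simp only [mulVec, dotProduct, transpose_apply, dωdL, of_apply, fderiv_deficit, neg_mul,
      Finset.sum_neg_distrib, Finset.mul_sum, Finset.sum_mul, Finset.sum_filter]
    rw [Finset.sum_comm]
    refine congrArg Neg.neg (Finset.sum_congr rfl fun σ _ => Finset.sum_congr rfl fun i _ => ?_)
    split_ifs with hi
    · rw [← h σ i hi, fderiv_area hi]
      ring
    · simp
  rw [h1, h2]
  refine congrArg Neg.neg (Finset.sum_congr rfl fun σ _ => ?_)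
  rw [sum_simplex_subset σ.2.1 2 fun i => fderiv ℝ (areaOf i) (T.sq T.L₀) (T.sq e) *
      fderiv ℝ (angleOf σ.1 i) (T.sq T.L₀) (T.sq (l σ)),
    sum_simplex_subset σ.2.1 2 fun i => fderiv ℝ (areaOf i) (T.sq T.L₀) (T.sq (l σ)) *
      fderiv ℝ (angleOf σ.1 i) (T.sq T.L₀) (T.sq e),
    schlaefli_symm (T.nondegenerate_sq σ) (T.isDist_sq e) (T.isDist_sq (l σ))]

variable {T}

/-- Areas varied independently determine the squared edge lengths of a 4-simplex. -/
theorem AreasDetermineLengths.exists_lengths (hT : T.AreasDetermineLengths) (σ : T.Cell)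
    (s : T.Face → ℝ) : ∃ l : T.Edge → ℝ,
      ∀ i : T.Face, i.1 ⊆ σ.1 → fderiv ℝ (T.area i) T.L₀ l = s i := by
  classical
  let ext : ({a : T.Edge // a.1 ⊆ σ.1} → ℝ) →ₗ[ℝ] (T.Edge → ℝ) :=
    LinearMap.pi fun a => if h : a.1 ⊆ σ.1 then LinearMap.proj ⟨a, h⟩ else 0
  let Λ : ({a : T.Edge // a.1 ⊆ σ.1} → ℝ) →ₗ[ℝ] ({i : T.Face // i.1 ⊆ σ.1} → ℝ) :=
    LinearMap.pi fun i => (fderiv ℝ (T.area i.1) T.L₀ : (T.Edge → ℝ) →ₗ[ℝ] ℝ) ∘ₗ ext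
  have hinj : Function.Injective Λ := by
    rw [injective_iff_map_eq_zero]
    intro l hl
    ext a
    have := hT σ (ext l) (fun i hi => congrFun hl ⟨i, hi⟩) a.1 a.2
    simpa [ext, a.2] using this
  -- A 4-simplex has as many edges as triangles, ten of each, so the injective linear map from
  -- length to area variations is also surjective.
  have hfr : Module.finrank ℝ ({a : T.Edge // a.1 ⊆ σ.1} → ℝ) =
      Module.finrank ℝ ({i : T.Face // i.1 ⊆ σ.1} → ℝ) := by
    rw [Module.finrank_fintype_fun_eq_card, Module.finrank_fintype_fun_eq_card]
    have h1 := card_simplex_subset σ.2.1 1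
    have h2 := card_simplex_subset σ.2.1 2
    rw [σ.2.2] at h1 h2
    exact (by convert h1 : _ = Nat.choose 5 2).trans (by convert h2.symm : Nat.choose 5 3 = _)
  obtain ⟨l, hl⟩ := (LinearMap.injective_iff_surjective_of_finrank_eq_finrank hfr).mp hinj
    fun i => s i.1
  exact ⟨ext l, fun i hi => congrFun hl ⟨i, hi⟩⟩

/-- Every `s` comes from some simplexwise lengths by `exists_lengths`, so the only remaining
condition is the vanishing of `dΩ`, which `dΩ_eq` expresses by `s`. -/
theorem AreasDetermineLengths.mem_areaDeformations (hT : T.AreasDetermineLengths)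
    {s : T.Face → ℝ} : s ∈ T.areaDeformations ↔ T.dωdLᵀ *ᵥ s = 0 := by
  constructor
  · rintro ⟨l, hl, hΩ⟩
    ext a
    rw [← T.dΩ_eq hl, hΩ]
    rfl
  · intro h
    choose l hl using fun σ => hT.exists_lengths σ s
    exact ⟨l, hl, fun a => by rw [T.dΩ_eq hl, h]; rfl⟩

theorem Choice.isMaximalMinor {m k l : ℕ} (χ : T.Choice m k l) :
    IsMaximalMinor T.dωdL (χ.rows ∘ Sum.inl) (χ.cols ∘ Sum.inl) :=
  ⟨χ.det_ne_zero, χ.largest⟩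

theorem value_eq {m k l : ℕ} (χ : T.Choice m k l) (s : Fin k → T.areaDeformations)
    (u : Fin l → T.lengthDeformations) :
    T.value χ s u = (∏ i : T.Face, T.area i T.L₀) / (∏ σ : T.Cell, T.vol σ) *
      (coordDet (χ.rows ∘ Sum.inr) (fun j => (s j).1) *
        coordDet (χ.cols ∘ Sum.inr) (fun j => (u j).1) /
          (T.dωdL.submatrix (χ.rows ∘ Sum.inl) (χ.cols ∘ Sum.inl)).det) := by
  have h1 : wedge T.areaDeformations (χ.rows ∘ Sum.inr) s =
    coordDet (χ.rows ∘ Sum.inr) (fun j => (s j).1) := rfl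
  have h2 : wedge T.lengthDeformations (χ.cols ∘ Sum.inr) u =
    coordDet (χ.cols ∘ Sum.inr) (fun j => (u j).1) := rfl
  rw [value, h1, h2, div_mul_div_comm, mul_comm (∏ σ : T.Cell, T.vol σ), mul_assoc]

/-- The value does not depend on the choice of the maximal minor, up to a sign. -/
theorem AreasDetermineLengths.value_choice (hT : T.AreasDetermineLengths) {m k l m' k' l' : ℕ}
    (χ : T.Choice m k l) (χ' : T.Choice m' k' l') :
    m' = m ∧ ∃ (hk : k' = k) (hl : l' = l) (ε : ℤˣ),
      ∀ (s : Fin k → T.areaDeformations) (u : Fin l → T.lengthDeformations),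
        T.value χ' (s ∘ Fin.cast hk) (u ∘ Fin.cast hl) = ((ε : ℤ) : ℝ) * T.value χ s u := by
  obtain rfl := χ.isMaximalMinor.size_eq χ'.isMaximalMinor
  have hk := Fintype.card_congr (χ'.rows.trans χ.rows.symm)
  have hl := Fintype.card_congr (χ'.cols.trans χ.cols.symm)
  simp only [Fintype.card_sum, Fintype.card_fin, add_right_inj] at hk hl
  subst hk hl
  classical
  obtain ⟨ε, hε⟩ := coordDet_ratio_eq T.dωdL χ.rows χ'.rows χ.cols χ'.cols χ.isMaximalMinor
    χ'.isMaximalMinor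
  refine ⟨rfl, rfl, rfl, ε, fun s u => ?_⟩
  rw [value_eq, value_eq, mul_left_comm]
  exact congrArg _ (hε (fun j => (s j).1) (fun j => (u j).1)
    (fun j => hT.mem_areaDeformations.mp (s j).2) fun j => T.mem_lengthDeformations.mp (u j).2)

end FlatManifold

/-! ### The affine dependence of six points -/

section SixPoints

open Matrix

variable {V : Type*} [DecidableEq V]

/-- Coherence is stated for the exchange of the vertex in position zero. A transposition brings
position `j` there in both orderings, and its sign cancels. -/
theorem Orientation.sign_update {K : AbstractSimplicialComplex V} (o : Orientation K)
    {t : Fin 5 → V} (j : Fin 5) (q : V) (hq : t j ≠ q) (ht : IsFourSimplex K t)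
    (ht' : IsFourSimplex K (Function.update t j q)) :
    o.sign (Function.update t j q) = -o.sign t := by
  have comp : ∀ {t : Fin 5 → V} (π : Equiv.Perm (Fin 5)), IsFourSimplex K t →
      IsFourSimplex K (t ∘ π) := fun {t} π ht => ⟨ht.1.comp π.injective, by
    have : Finset.univ.image (t ∘ π) = Finset.univ.image t := by
      ext v
      simp only [Finset.mem_image, Finset.mem_univ, true_and, Function.comp]
      exact ⟨fun ⟨i, hi⟩ => ⟨π i, hi⟩, fun ⟨i, hi⟩ => ⟨π.symm i, by simpa using hi⟩⟩
    rw [this]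
    exact ht.2⟩
  have h1 : t ∘ Equiv.swap 0 j = vecCons (t j) (fun i => t (Equiv.swap 0 j i.succ)) := by
    funext i
    refine Fin.cases ?_ (fun i => ?_) i <;> simp
  have h2 : Function.update t j q ∘ Equiv.swap 0 j =
      vecCons q (fun i => t (Equiv.swap 0 j i.succ)) := by
    funext i
    refine Fin.cases ?_ (fun i => ?_) i
    · simp
    · have : Equiv.swap 0 j i.succ ≠ j := by
        intro h
        have := (Equiv.swap 0 j).injective (h.trans (Equiv.swap_apply_left 0 j).symm)
        exact Fin.succ_ne_zero i this
      simp [Function.update_of_ne this]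
  have h3 := o.sign_perm _ (Equiv.swap 0 j) ht
  have h4 := o.sign_perm _ (Equiv.swap 0 j) ht'
  have h5 := o.coherent (fun i => t (Equiv.swap 0 j i.succ)) (t j) q hq
    (h1 ▸ comp _ ht) (h2 ▸ comp _ ht')
  rw [← h1, ← h2, h3, h4, ← mul_neg] at h5
  rw [mul_left_cancel h5, neg_neg]

theorem image_succAbove {n : ℕ} {p : Fin (n + 1) → V} (hp : Function.Injective p)
    (m : Fin (n + 1)) :
    Finset.univ.image (p ∘ m.succAbove) = (Finset.univ.image p).erase (p m) := by
  ext v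
  simp only [Finset.mem_image, Finset.mem_univ, true_and, Finset.mem_erase, Function.comp]
  constructor
  · rintro ⟨i, rfl⟩
    exact ⟨fun h => Fin.succAbove_ne m i (hp h), _, rfl⟩
  · rintro ⟨hv, i, rfl⟩
    obtain ⟨j, rfl⟩ := Fin.exists_succAbove_eq (show i ≠ m from fun h => hv (h ▸ rfl))
    exact ⟨j, rfl⟩

/-- Laplace expansion of a 6 × 6 determinant with a repeated column. The index `j = 0` gives the sum
of the coefficients of the affine dependence, the other indices its coordinates in `ℝ⁴`. -/
theorem sum_signedVolume_succAbove (y : Fin 6 → E4) (j : Fin 5) :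
    ∑ k : Fin 6, (-1) ^ (k : ℕ) * signedVolume (y ∘ k.succAbove) *
      (Fin.cons 1 (y k) : Fin 5 → ℝ) j = 0 := by
  have h := det_zero_of_column_eq (M := of fun k : Fin 6 =>
    (Fin.cons ((Fin.cons 1 (y k) : Fin 5 → ℝ) j) (Fin.cons 1 (y k) : Fin 5 → ℝ) : Fin 6 → ℝ))
    (Fin.succ_ne_zero j).symm fun k => by simp
  rw [det_succ_column_zero] at h
  rw [← zero_div (24 : ℝ), ← h, Finset.sum_div]
  refine Finset.sum_congr rfl fun k _ => ?_
  rw [signedVolume_eq_det]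
  have : (of fun k : Fin 6 => (Fin.cons ((Fin.cons 1 (y k) : Fin 5 → ℝ) j)
      (Fin.cons 1 (y k) : Fin 5 → ℝ) : Fin 6 → ℝ)).submatrix k.succAbove Fin.succ =
      of fun i j : Fin 5 => (Fin.cons 1 ((y ∘ k.succAbove) i) : Fin 5 → ℝ) j := by
    ext a b
    simp
  rw [this]
  simp only [of_apply, Fin.cons_zero]
  ring

/-- The signed volumes spanned by five out of six points are the coefficients of the affine
dependence of these points. -/
theorem isSixPoints_of_signedVolume {p : Fin 6 → V} (hp : Function.Injective p) {y : Fin 6 → E4}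
    {ε : ℤˣ} {β : V → ℝ} {D : V → V → ℝ}
    (hβ : ∀ k, β (p k) = ((ε : ℤ) : ℝ) * ((-1) ^ (k : ℕ) * signedVolume (y ∘ k.succAbove)))
    (hD : IsDist D) (hy : ∀ k l, D (p k) (p l) = dist (y k) (y l) ^ 2)
    (hβ0 : ∀ k, β (p k) ≠ 0)
    (hnd : ∀ k, Nondegenerate ((Finset.univ.image p).erase (p k)) D) :
    IsSixPoints (Finset.univ.image p) β D := by
  have hsum : ∀ g : V → ℝ, ∑ v ∈ Finset.univ.image p, g v = ∑ k, g (p k) := fun g =>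
    Finset.sum_image fun i _ j _ h => hp h
  have h1 : ∑ k, β (p k) = 0 := by
    have := sum_signedVolume_succAbove y 0
    simp only [Fin.cons_zero, mul_one] at this
    simp only [hβ, ← Finset.mul_sum, this, mul_zero]
  have h2 : ∀ j, ∑ k, β (p k) * y k j = 0 := fun j => by
    have := sum_signedVolume_succAbove y j.succ
    simp only [Fin.cons_succ] at this
    simp only [hβ, mul_assoc, ← Finset.mul_sum] at this ⊢
    rw [this, mul_zero]
  have h3 : ∀ w : E4, ∑ k, β (p k) * inner ℝ w (y k) = 0 := fun w => by
    simp only [PiLp.inner_apply, Finset.mul_sum]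
    rw [Finset.sum_comm]
    refine Finset.sum_eq_zero fun j _ => ?_
    have : ∀ k, β (p k) * inner ℝ (w j) (y k j) = w j * (β (p k) * y k j) := fun k => by
      simp only [RCLike.inner_apply, conj_trivial]
      ring
    rw [Finset.sum_congr rfl fun k _ => this k, ← Finset.mul_sum, h2, mul_zero]
  have hmem : ∀ v ∈ Finset.univ.image p, ∃ k, p k = v := fun v hv => by simpa using hv
  -- In the expansion of `‖y l - y k‖ ^ 2` the term `‖y l‖ ^ 2` drops out as the coefficients sum to
  -- zero, and the inner products drop out by the dependence; what is left is independent of `l`.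
  refine ⟨?_, ?_, ?_, ?_, ?_, ∑ k, β (p k) * ‖y k‖ ^ 2, ?_⟩
  · rw [Finset.card_image_of_injective _ hp, Finset.card_univ, Fintype.card_fin]
  · intro v hv
    obtain ⟨k, rfl⟩ := hmem v hv
    exact hβ0 k
  · intro v hv
    obtain ⟨k, rfl⟩ := hmem v hv
    exact hnd k
  · intro v hv
    obtain ⟨k, rfl⟩ := hmem v hv
    have := cm_eq_volume hD (hp.comp k.succAbove_right_injective) (x := y ∘ k.succAbove)
      fun i j => hy _ _
    rw [image_succAbove hp] at this
    rw [this, hβ, mul_pow, mul_pow, units_cast_sq, ← pow_mul, mul_comm (k : ℕ), pow_mul]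
    norm_num
  · rw [hsum, h1]
  · intro w hw
    obtain ⟨l, rfl⟩ := hmem w hw
    rw [hsum]
    have : ∀ k, β (p k) * D (p l) (p k) = ‖y l‖ ^ 2 * β (p k) -
        2 * (β (p k) * inner ℝ (y l) (y k)) + β (p k) * ‖y k‖ ^ 2 := fun k => by
      rw [hy, dist_eq_norm, norm_sub_sq_real]
      ring
    rw [Finset.sum_congr rfl fun k _ => this k, Finset.sum_add_distrib, Finset.sum_sub_distrib,
      ← Finset.mul_sum, ← Finset.mul_sum, h1, h3]
    ring

end SixPoints

/-! ### The triangulations before and after a move -/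

theorem image_six {V : Type*} [DecidableEq V] (A B C D E F : V) :
    Finset.univ.image ![A, B, C, D, E, F] = ({A, B, C} : Finset V) ∪ {D, E, F} := by
  ext v
  simp [Fin.exists_fin_succ, eq_comm]
  tauto

namespace FlatManifold

variable {V : Type*} [Fintype V] [DecidableEq V] {v₀ : V} {T T' : FlatManifold V v₀}
  {A B C D E F : V}

namespace IsMove

theorem injective (h : T.IsMove T' A B C D E F) : Function.Injective ![A, B, C, D, E, F] :=
  List.nodup_ofFn.mp (by simpa [List.ofFn_succ] using h.nodup)

theorem disjoint (h : T.IsMove T' A B C D E F) :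
    Disjoint ({A, B, C} : Finset V) {D, E, F} := by
  have := h.nodup
  simp only [List.nodup_cons, List.mem_cons, List.not_mem_nil, not_or] at this
  simp only [Finset.disjoint_insert_left, Finset.disjoint_singleton_left, Finset.mem_insert,
    Finset.mem_singleton]
  tauto

theorem card_old (h : T.IsMove T' A B C D E F) : ({A, B, C} : Finset V).card = 3 := by
  have := h.nodup
  simp only [List.nodup_cons, List.mem_cons, List.not_mem_nil, not_or] at this
  exact Finset.card_eq_three.mpr ⟨A, B, C, by tauto, by tauto, by tauto, rfl⟩

theorem card_new (h : T.IsMove T' A B C D E F) : ({D, E, F} : Finset V).card = 3 := by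
  have := h.nodup
  simp only [List.nodup_cons, List.mem_cons, List.not_mem_nil, not_or] at this
  exact Finset.card_eq_three.mpr ⟨D, E, F, by tauto, by tauto, by tauto, rfl⟩

theorem card_union (h : T.IsMove T' A B C D E F) :
    (({A, B, C} : Finset V) ∪ {D, E, F}).card = 6 := by
  rw [Finset.card_union_of_disjoint h.disjoint, h.card_old, h.card_new]

theorem mem_iff (h : T.IsMove T' A B C D E F) {s : Finset V} (hX : ¬{A, B, C} ⊆ s)
    (hY : ¬{D, E, F} ⊆ s) : s ∈ T'.K ↔ s ∈ T.K := by
  rw [h.faces]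
  constructor
  · rintro (⟨hs, -⟩ | ⟨t, -, rfl⟩)
    · exact hs
    · exact absurd Finset.subset_union_left hY
  · exact fun hs => Or.inl ⟨hs, hX⟩

theorem mem_iff_of_card (h : T.IsMove T' A B C D E F) {s : Finset V} (hs : s.card < 3) :
    s ∈ T'.K ↔ s ∈ T.K :=
  h.mem_iff (fun hX => by have := Finset.card_le_card hX; rw [h.card_old] at this; omega)
    fun hY => by have := Finset.card_le_card hY; rw [h.card_new] at this; omega

theorem not_mem_old (h : T.IsMove T' A B C D E F) {s : Finset V} (hY : {D, E, F} ⊆ s) :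
    s ∉ T.K := fun hs => h.new_face (mem_of_subset hs hY ⟨D, by simp⟩)

theorem not_mem_new (h : T.IsMove T' A B C D E F) {s : Finset V} (hX : {A, B, C} ⊆ s) :
    s ∉ T'.K := by
  rw [h.faces]
  rintro (⟨-, hs⟩ | ⟨t, ht, rfl⟩)
  · exact hs hX
  · exact ht.2 fun v hv => (Finset.mem_union.mp (hX hv)).resolve_left
      (Finset.disjoint_left.mp h.disjoint hv)

theorem erase_mem_old (h : T.IsMove T' A B C D E F) {r : V} (hr : r ∈ ({D, E, F} : Finset V)) :
    (({A, B, C} : Finset V) ∪ {D, E, F}).erase r ∈ T.K := by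
  have hX : r ∉ ({A, B, C} : Finset V) := fun hX => Finset.disjoint_left.mp h.disjoint hX hr
  rw [Finset.erase_union_distrib, Finset.erase_eq_of_notMem hX]
  exact (h.star _ Finset.subset_union_left).mpr ⟨_, Finset.erase_ssubset hr, rfl⟩

theorem erase_mem_new (h : T.IsMove T' A B C D E F) {r : V} (hr : r ∈ ({A, B, C} : Finset V)) :
    (({A, B, C} : Finset V) ∪ {D, E, F}).erase r ∈ T'.K := by
  have hY : r ∉ ({D, E, F} : Finset V) := Finset.disjoint_left.mp h.disjoint hr
  rw [Finset.union_comm, Finset.erase_union_distrib, Finset.erase_eq_of_notMem hY]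
  exact (h.faces _).mpr (Or.inr ⟨_, Finset.erase_ssubset hr, rfl⟩)

theorem card_erase (h : T.IsMove T' A B C D E F) {r : V}
    (hr : r ∈ ({A, B, C} : Finset V) ∪ {D, E, F}) :
    ((({A, B, C} : Finset V) ∪ {D, E, F}).erase r).card = 4 + 1 := by
  rw [Finset.card_erase_of_mem hr, h.card_union]

theorem exists_eq_erase_old (h : T.IsMove T' A B C D E F) {s : Finset V} (hX : {A, B, C} ⊆ s)
    (hs : s ∈ T.K) (hc : s.card = 5) :
    ∃ r ∈ ({D, E, F} : Finset V), s = (({A, B, C} : Finset V) ∪ {D, E, F}).erase r := by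
  obtain ⟨t, ht, rfl⟩ := (h.star s hX).mp hs
  obtain ⟨r, hr, hrt⟩ := Finset.exists_of_ssubset ht
  have hr' : r ∉ ({A, B, C} : Finset V) := fun hX => Finset.disjoint_left.mp h.disjoint hX hr
  refine ⟨r, hr, Finset.eq_of_subset_of_card_le (fun v hv => ?_) ?_⟩
  · refine Finset.mem_erase.mpr ⟨?_, Finset.union_subset_union_right ht.1 hv⟩
    rintro rfl
    simp only [Finset.mem_union, hr', hrt, or_self] at hv
  · rw [h.card_erase (Finset.mem_union_right _ hr), hc]

theorem exists_eq_erase_new (h : T.IsMove T' A B C D E F) {s : Finset V} (hY : {D, E, F} ⊆ s)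
    (hs : s ∈ T'.K) (hc : s.card = 5) :
    ∃ r ∈ ({A, B, C} : Finset V), s = (({A, B, C} : Finset V) ∪ {D, E, F}).erase r := by
  obtain ⟨t, ht, rfl⟩ := ((h.faces s).mp hs).resolve_left fun h' => h.not_mem_old hY h'.1
  obtain ⟨r, hr, hrt⟩ := Finset.exists_of_ssubset ht
  have hr' : r ∉ ({D, E, F} : Finset V) := Finset.disjoint_left.mp h.disjoint hr
  refine ⟨r, hr, Finset.eq_of_subset_of_card_le (fun v hv => ?_) ?_⟩
  · refine Finset.mem_erase.mpr ⟨?_, ?_⟩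
    · rintro rfl
      simp only [Finset.mem_union, hr', hrt, or_self] at hv
    · rw [Finset.union_comm]
      exact Finset.union_subset_union_right ht.1 hv
  · rw [h.card_erase (Finset.mem_union_left _ hr), hc]

theorem skeleton_eq (h : T.IsMove T' A B C D E F) : skeleton T'.K = skeleton T.K := by
  ext u v
  refine and_congr_right fun huv => h.mem_iff_of_card ?_
  rw [Finset.card_pair huv]
  norm_num

/-- The universal covers have corresponding vertices. -/
theorem exists_coverVertex (h : T.IsMove T' A B C D E F) (u : V) :
    ∃ (x : CoverVertex T.K v₀) (x' : CoverVertex T'.K v₀), x.1 = u ∧ x'.1 = u ∧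
      ∀ w, T'.f (neighbour x' w) = T.f (neighbour x w) := by
  obtain ⟨p⟩ := T.connected.preconnected v₀ u
  have hp : p.support = (p.mapLe h.skeleton_eq.ge).support := by simp
  refine ⟨⟨u, PathClass.mk p⟩, ⟨u, PathClass.mk (p.mapLe h.skeleton_eq.ge)⟩, rfl, rfl,
    fun w => ?_⟩
  by_cases hw : (skeleton T.K).Adj u w
  · have hw' : (skeleton T'.K).Adj u w := h.skeleton_eq ▸ hw
    rw [neighbour_of_adj (x := ⟨u, PathClass.mk p⟩) hw,
      neighbour_of_adj (x := ⟨u, PathClass.mk (p.mapLe h.skeleton_eq.ge)⟩) hw']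
    exact h.map_eq w (p.append (.cons hw .nil))
      ((p.mapLe h.skeleton_eq.ge).append (.cons hw' .nil))
      (by simp [SimpleGraph.Walk.support_append])
  · have hw' : ¬(skeleton T'.K).Adj u w := h.skeleton_eq ▸ hw
    rw [neighbour_of_not_adj (x := ⟨u, PathClass.mk p⟩) hw,
      neighbour_of_not_adj (x := ⟨u, PathClass.mk (p.mapLe h.skeleton_eq.ge)⟩) hw']
    exact h.map_eq u p _ hp

theorem sq_L₀_eq (h : T.IsMove T' A B C D E F) : T'.sq T'.L₀ = T.sq T.L₀ := by
  ext u v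
  by_cases hs : ({u, v} : Finset V) ∈ T.K ∧ ({u, v} : Finset V).card = 1 + 1
  · have hs' : ({u, v} : Finset V) ∈ T'.K := (h.mem_iff_of_card (by omega)).mpr hs.1
    obtain ⟨x, x', hx, hx', hf⟩ := h.exists_coverVertex u
    rw [T.sq_L₀_neighbour hs.1 (x := x) (by simp [hx]) (by simp) (by simp),
      T'.sq_L₀_neighbour hs' (x := x') (by simp [hx']) (by simp) (by simp), hf, hf]
  · rw [sq, sq, dif_neg hs, dif_neg]
    rintro ⟨h1, h2⟩
    exact hs ⟨(h.mem_iff_of_card (by omega)).mp h1, h2⟩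

theorem vol_eq (h : T.IsMove T' A B C D E F) {s : Finset V} (hs : s ∈ T.K ∧ s.card = 4 + 1)
    (hs' : s ∈ T'.K ∧ s.card = 4 + 1) : T'.vol ⟨s, hs'⟩ = T.vol ⟨s, hs⟩ := by
  obtain ⟨u, hu⟩ : s.Nonempty := Finset.card_pos.mp (by omega)
  obtain ⟨t, ht, hts⟩ := exists_ordering hs.2
  obtain ⟨x, x', hx, hx', hf⟩ := h.exists_coverVertex u
  subst hx
  rw [T.vol_eq ⟨s, hs⟩ (isLift_neighbour ⟨s, hs⟩ hu t hts),
    T'.vol_eq ⟨s, hs'⟩ (isLift_neighbour ⟨s, hs'⟩ (hx' ▸ hu) t hts)]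
  have h1 : (fun i => (neighbour x (t i)).1) = t :=
    funext fun i => neighbour_fst hs.1 hu (image_univ_mem hts i)
  have h2 : (fun i => (neighbour x' (t i)).1) = t :=
    funext fun i => neighbour_fst hs'.1 (hx' ▸ hu) (image_univ_mem hts i)
  rw [h1, h2, h.orientation_old t ⟨ht, hts ▸ hs.1⟩ ⟨ht, hts ▸ hs'.1⟩]
  have : (T'.f ∘ fun i => neighbour x' (t i)) = T.f ∘ fun i => neighbour x (t i) :=
    funext fun i => hf _
  rw [this]

end IsMove

end FlatManifold

/-! ### The six vertices of a move -/

/-- Omitting two consecutive points of the list gives orderings that differ in a single position.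
The orientation signs alternate, just as the signs in the affine dependence do. -/
theorem Orientation.sign_succAbove {V : Type*} [DecidableEq V] {K : AbstractSimplicialComplex V}
    (o : Orientation K) {p : Fin 6 → V} (hp : Function.Injective p) (k : Fin 5)
    (h : (Finset.univ.image p).erase (p k.castSucc) ∈ K)
    (h' : (Finset.univ.image p).erase (p k.succ) ∈ K) :
    o.sign (p ∘ k.castSucc.succAbove) = -o.sign (p ∘ k.succ.succAbove) := by
  have h1 : ∀ k : Fin 5, k.castSucc.succAbove k = k.succ := by decide
  have h2 : ∀ k : Fin 5, k.succ.succAbove k = k.castSucc := by decide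
  have h3 : ∀ k i : Fin 5, i ≠ k → k.castSucc.succAbove i = k.succ.succAbove i := by decide
  have hu : p ∘ k.castSucc.succAbove =
      Function.update (p ∘ k.succ.succAbove) k (p k.succ) := by
    funext i
    by_cases hi : i = k
    · subst hi
      simp [h1]
    · simp [hi, h3 k i hi]
  have hF : ∀ m : Fin 6, (Finset.univ.image p).erase (p m) ∈ K →
      IsFourSimplex K (p ∘ m.succAbove) := fun m hm =>
    ⟨hp.comp m.succAbove_right_injective, (image_succAbove hp m).symm ▸ hm⟩
  rw [hu]
  refine o.sign_update k _ ?_ (hF _ h') (hu ▸ hF _ h)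
  rw [Function.comp, h2]
  exact hp.ne (Fin.castSucc_lt_succ).ne

namespace FlatManifold

variable {V : Type*} [Fintype V] [DecidableEq V] {v₀ : V}

open scoped Classical in
/-- The oriented volume of a set of vertices, which is zero if the set is not a 4-simplex. -/
noncomputable def volF (T : FlatManifold V v₀) (s : Finset V) : ℝ :=
  if h : s ∈ T.K ∧ s.card = 4 + 1 then T.vol ⟨s, h⟩ else 0

theorem volF_cell (T : FlatManifold V v₀) (σ : T.Cell) : T.volF σ.1 = T.vol σ := dif_pos σ.2

theorem volF_of_not_mem (T : FlatManifold V v₀) {s : Finset V} (h : s ∉ T.K) : T.volF s = 0 :=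
  dif_neg fun h' => h h'.1

theorem volF_erase (T : FlatManifold V v₀) {p : Fin 6 → V} (hp : Function.Injective p)
    {x : Fin 6 → CoverVertex T.K v₀} (hx : ∀ k, (x k).1 = p k)
    (hadj : ∀ k l, k ≠ l → CoverAdj (x k) (x l)) (m : Fin 6)
    (hm : (Finset.univ.image p).erase (p m) ∈ T.K) :
    T.volF ((Finset.univ.image p).erase (p m)) =
      ((T.o.sign (p ∘ m.succAbove) : ℤ) : ℝ) * signedVolume (T.f ∘ x ∘ m.succAbove) := by
  have hc : ((Finset.univ.image p).erase (p m)).card = 4 + 1 := by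
    rw [Finset.card_erase_of_mem (Finset.mem_image_of_mem _ (Finset.mem_univ m)),
      Finset.card_image_of_injective _ hp, Finset.card_univ, Fintype.card_fin]
  rw [volF, dif_pos ⟨hm, hc⟩, T.vol_eq ⟨_, hm, hc⟩ (x := x ∘ m.succAbove) ⟨?_, ?_⟩]
  · have : (fun i => ((x ∘ m.succAbove) i).1) = p ∘ m.succAbove := funext fun i => hx _
    rw [this]
  · refine Eq.trans ?_ (image_succAbove hp m)
    exact Finset.image_congr fun i _ => hx _
  · exact fun i j hij => hadj _ _ (m.succAbove_right_injective.ne hij)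

/-- The change of the oriented volume of the set of all points but one. -/
noncomputable def volDiff (T T' : FlatManifold V v₀) (P : Finset V) (r : V) : ℝ :=
  T'.volF (P.erase r) - T.volF (P.erase r)

variable {T T' : FlatManifold V v₀} {A B C D E F : V}

namespace IsMove

theorem volF_erase_eq_zero (h : T.IsMove T' A B C D E F) {r : V}
    (hr : r ∈ ({A, B, C} : Finset V)) :
    T.volF ((({A, B, C} : Finset V) ∪ {D, E, F}).erase r) = 0 := by
  refine T.volF_of_not_mem (h.not_mem_old ?_)
  refine Finset.subset_erase.mpr ⟨Finset.subset_union_right, ?_⟩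
  exact Finset.disjoint_left.mp h.disjoint hr

theorem volF_erase_eq_zero' (h : T.IsMove T' A B C D E F) {r : V}
    (hr : r ∈ ({D, E, F} : Finset V)) :
    T'.volF ((({A, B, C} : Finset V) ∪ {D, E, F}).erase r) = 0 := by
  refine T'.volF_of_not_mem (h.not_mem_new ?_)
  refine Finset.subset_erase.mpr ⟨Finset.subset_union_left, ?_⟩
  exact Finset.disjoint_right.mp h.disjoint hr

theorem volDiff_old (h : T.IsMove T' A B C D E F) {r : V} (hr : r ∈ ({D, E, F} : Finset V)) :
    T.volDiff T' ({A, B, C} ∪ {D, E, F}) r =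
      -T.volF ((({A, B, C} : Finset V) ∪ {D, E, F}).erase r) := by
  rw [volDiff, h.volF_erase_eq_zero' hr, zero_sub]

theorem volDiff_new (h : T.IsMove T' A B C D E F) {r : V} (hr : r ∈ ({A, B, C} : Finset V)) :
    T.volDiff T' ({A, B, C} ∪ {D, E, F}) r =
      T'.volF ((({A, B, C} : Finset V) ∪ {D, E, F}).erase r) := by
  rw [volDiff, h.volF_erase_eq_zero hr, sub_zero]

/-- The six vertices have a common lift whose points are the same before and after the move.
Coherence fixes the relative signs within the three old and within the three new 4-simplices, and
`orientation_new` links the two groups. With the minus sign at the old volumes, `volDiff` is then a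
global sign times the alternating volumes of the affine dependence. -/
theorem isSixPoints (h : T.IsMove T' A B C D E F) :
    IsSixPoints (({A, B, C} : Finset V) ∪ {D, E, F})
      (T.volDiff T' ({A, B, C} ∪ {D, E, F})) (T.sq T.L₀) := by
  have hp := h.injective
  set p : Fin 6 → V := ![A, B, C, D, E, F] with hpdef
  have himg : Finset.univ.image p = ({A, B, C} : Finset V) ∪ {D, E, F} := image_six A B C D E F
  have hnew : ∀ m : Fin 6, m < 3 → p m ∈ ({A, B, C} : Finset V) := by
    intro m hm
    fin_cases m <;> first | (exact absurd hm (by decide)) | simp [hpdef]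
  have hold : ∀ m : Fin 6, 3 ≤ m → p m ∈ ({D, E, F} : Finset V) := by
    intro m hm
    fin_cases m <;> first | (exact absurd hm (by decide)) | simp [hpdef]
  have hKold : ∀ m : Fin 6, 3 ≤ m → (Finset.univ.image p).erase (p m) ∈ T.K := fun m hm => by
    rw [himg]
    exact h.erase_mem_old (hold m hm)
  have hKnew : ∀ m : Fin 6, m < 3 → (Finset.univ.image p).erase (p m) ∈ T'.K := fun m hm => by
    rw [himg]
    exact h.erase_mem_new (hnew m hm)
  have hmem : ∀ k m : Fin 6, k ≠ m → p k ∈ (Finset.univ.image p).erase (p m) := fun k m hkm =>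
    Finset.mem_erase.mpr ⟨hp.ne hkm, Finset.mem_image_of_mem _ (Finset.mem_univ k)⟩
  obtain ⟨x, x', hx, hx', hf⟩ := h.exists_coverVertex (p 0)
  have hfst : ∀ k, (neighbour x (p k)).1 = p k := fun k => by
    -- An old 4-simplex is obtained by omitting one of the three points `3, 4, 5`, so there is
    -- always one that contains the base point `0` and any two further points.
    obtain ⟨m, hm, hm0, hmk⟩ : ∃ m : Fin 6, 3 ≤ m ∧ 0 ≠ m ∧ k ≠ m := by
      revert k
      decide
    exact neighbour_fst (hKold m hm) (hx ▸ hmem 0 m hm0) (hmem k m hmk)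
  have hadj : ∀ k l, k ≠ l → CoverAdj (neighbour x (p k)) (neighbour x (p l)) := fun k l hkl => by
    obtain ⟨m, hm, hm0, hmk, hml⟩ : ∃ m : Fin 6, 3 ≤ m ∧ 0 ≠ m ∧ k ≠ m ∧ l ≠ m := by
      revert k l
      decide
    exact coverAdj_neighbour_neighbour (hKold m hm) (hx ▸ hmem 0 m hm0) (hmem k m hmk)
      (hmem l m hml) (hp.ne hkl)
  have hfst' : ∀ k, (neighbour x' (p k)).1 = p k := fun k => by
    obtain ⟨m, hm, hm0, hmk⟩ : ∃ m : Fin 6, m < 3 ∧ 0 ≠ m ∧ k ≠ m := by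
      revert k
      decide
    exact neighbour_fst (hKnew m hm) (hx' ▸ hmem 0 m hm0) (hmem k m hmk)
  have htri : ∀ m k l n : Fin 6, m < 3 → k ≠ m → l ≠ m → n ≠ m →
      ({p k, p l, p n} : Finset V) ∈ T'.K := fun m k l n hm hk hl hn =>
    mem_of_subset (hKnew m hm) (by
      intro v hv
      simp only [Finset.mem_insert, Finset.mem_singleton] at hv
      rcases hv with rfl | rfl | rfl
      exacts [hmem k m hk, hmem l m hl, hmem n m hn]) ⟨p k, by simp⟩
  have hadj' : ∀ k l, k ≠ l → CoverAdj (neighbour x' (p k)) (neighbour x' (p l)) :=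
    fun k l hkl => by
    by_cases hm : ∃ m : Fin 6, m < 3 ∧ 0 ≠ m ∧ k ≠ m ∧ l ≠ m
    · obtain ⟨m, hm, hm0, hmk, hml⟩ := hm
      exact coverAdj_neighbour_neighbour (hKnew m hm) (hx' ▸ hmem 0 m hm0) (hmem k m hmk)
        (hmem l m hml) (hp.ne hkl)
    · have hkl' : (k = 1 ∧ l = 2) ∨ (k = 2 ∧ l = 1) := by
        revert k l
        decide
      have h12 : CoverAdj (neighbour x' (p 1)) (neighbour x' (p 2)) := by
        refine coverAdj_neighbour_of_cone (d := p 3) ?_ ?_ ?_ ?_ ?_ ?_ ?_ ?_ ?_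
        · rw [hx']
          exact htri 2 0 1 3 (by decide) (by decide) (by decide) (by decide)
        · rw [hx']
          exact htri 1 0 2 3 (by decide) (by decide) (by decide) (by decide)
        · exact htri 0 1 3 2 (by decide) (by decide) (by decide) (by decide)
        · exact hx' ▸ hp.ne (by decide)
        · exact hx' ▸ hp.ne (by decide)
        · exact hx' ▸ hp.ne (by decide)
        all_goals exact hp.ne (by decide)
      rcases hkl' with ⟨rfl, rfl⟩ | ⟨rfl, rfl⟩
      · exact h12
      · exact h12.symm
  have hvol : ∀ m : Fin 6, 3 ≤ m → T.volF ((Finset.univ.image p).erase (p m)) =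
      ((T.o.sign (p ∘ m.succAbove) : ℤ) : ℝ) *
        signedVolume ((fun k => T.f (neighbour x (p k))) ∘ m.succAbove) := fun m hm =>
    T.volF_erase hp hfst hadj m (hKold m hm)
  have hvol' : ∀ m : Fin 6, m < 3 → T'.volF ((Finset.univ.image p).erase (p m)) =
      ((T'.o.sign (p ∘ m.succAbove) : ℤ) : ℝ) *
        signedVolume ((fun k => T.f (neighbour x (p k))) ∘ m.succAbove) := fun m hm => by
    rw [T'.volF_erase hp hfst' hadj' m (hKnew m hm)]
    have : T'.f ∘ (fun k => neighbour x' (p k)) ∘ m.succAbove =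
        (fun k => T.f (neighbour x (p k))) ∘ m.succAbove := funext fun i => hf _
    rw [this]
  have hs5 : p ∘ (Fin.last 5).succAbove = ![A, B, C, D, E] := by
    funext i
    fin_cases i <;> rfl
  have hs0 : p ∘ (0 : Fin 6).succAbove = ![B, C, D, E, F] := by
    funext i
    fin_cases i <;> rfl
  have hs4 : T.o.sign (p ∘ (4 : Fin 6).succAbove) = -T.o.sign (p ∘ (Fin.last 5).succAbove) :=
    T.o.sign_succAbove hp 4 (hKold 4 (by decide)) (hKold 5 (by decide))
  have hs3 : T.o.sign (p ∘ (3 : Fin 6).succAbove) = -T.o.sign (p ∘ (4 : Fin 6).succAbove) :=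
    T.o.sign_succAbove hp 3 (hKold 3 (by decide)) (hKold 4 (by decide))
  have hs1 : T'.o.sign (p ∘ (0 : Fin 6).succAbove) = -T'.o.sign (p ∘ (1 : Fin 6).succAbove) :=
    T'.o.sign_succAbove hp 0 (hKnew 0 (by decide)) (hKnew 1 (by decide))
  have hs2 : T'.o.sign (p ∘ (1 : Fin 6).succAbove) = -T'.o.sign (p ∘ (2 : Fin 6).succAbove) :=
    T'.o.sign_succAbove hp 1 (hKnew 1 (by decide)) (hKnew 2 (by decide))
  have hor := h.orientation_new
  rw [← hs5, ← hs0] at hor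
  rw [hor, eq_comm, neg_eq_iff_eq_neg] at hs1
  rw [hs1, eq_comm, neg_inj] at hs2
  rw [hs4, neg_neg] at hs3
  have hcell : ∀ {S : FlatManifold V v₀} {m : Fin 6},
      (Finset.univ.image p).erase (p m) ∈ S.K →
        S.volF ((Finset.univ.image p).erase (p m)) ≠ 0 ∧
          Nondegenerate ((Finset.univ.image p).erase (p m)) (S.sq S.L₀) := fun {S m} hm => by
    have hc : ((Finset.univ.image p).erase (p m)).card = 4 + 1 := by
      rw [himg]
      refine h.card_erase ?_
      rw [← himg]
      exact Finset.mem_image_of_mem _ (Finset.mem_univ m)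
    exact ⟨by rw [S.volF_cell ⟨_, hm, hc⟩]; exact S.vol_ne_zero _, S.nondegenerate_sq ⟨_, hm, hc⟩⟩
  have hβnew : ∀ m : Fin 6, m < 3 → T.volDiff T' (Finset.univ.image p) (p m) =
      T'.volF ((Finset.univ.image p).erase (p m)) := fun m hm => by
    rw [himg]
    exact h.volDiff_new (hnew m hm)
  have hβold : ∀ m : Fin 6, 3 ≤ m → T.volDiff T' (Finset.univ.image p) (p m) =
      -T.volF ((Finset.univ.image p).erase (p m)) := fun m hm => by
    rw [himg]
    exact h.volDiff_old (hold m hm)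
  rw [← himg]
  refine isSixPoints_of_signedVolume hp (y := fun k => T.f (neighbour x (p k)))
    (ε := T.o.sign (p ∘ (Fin.last 5).succAbove)) ?_ (T.isDist_sq _) (fun k l => ?_) (fun k => ?_)
    fun k => ?_
  · intro k
    fin_cases k
    · change T.volDiff T' _ (p 0) = _ * ((-1) ^ 0 * signedVolume (_ ∘ (0 : Fin 6).succAbove))
      rw [hβnew 0 (by decide), hvol' 0 (by decide), hor]
      ring
    · change T.volDiff T' _ (p 1) = _ * ((-1) ^ 1 * signedVolume (_ ∘ (1 : Fin 6).succAbove))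
      rw [hβnew 1 (by decide), hvol' 1 (by decide), hs1]
      push_cast
      ring
    · change T.volDiff T' _ (p 2) = _ * ((-1) ^ 2 * signedVolume (_ ∘ (2 : Fin 6).succAbove))
      rw [hβnew 2 (by decide), hvol' 2 (by decide), hs2]
      push_cast
      ring
    · change T.volDiff T' _ (p 3) = _ * ((-1) ^ 3 * signedVolume (_ ∘ (3 : Fin 6).succAbove))
      rw [hβold 3 (by decide), hvol 3 (by decide), hs3]
      ring
    · change T.volDiff T' _ (p 4) = _ * ((-1) ^ 4 * signedVolume (_ ∘ (4 : Fin 6).succAbove))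
      rw [hβold 4 (by decide), hvol 4 (by decide), hs4]
      push_cast
      ring
    · change T.volDiff T' _ (p 5) = _ * ((-1) ^ 5 * signedVolume (_ ∘ (5 : Fin 6).succAbove))
      rw [hβold 5 (by decide), hvol 5 (by decide)]
      change -(((T.o.sign (p ∘ (Fin.last 5).succAbove) : ℤ) : ℝ) * _) = _
      ring_nf
  · rcases eq_or_ne k l with rfl | hkl
    · simp [(T.isDist_sq _).self]
    · rw [← T.sq_L₀ (hadj k l hkl), hfst, hfst]
  · rcases lt_or_ge k 3 with hk | hk
    · rw [hβnew k hk]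
      exact (hcell (hKnew k hk)).1
    · rw [hβold k hk]
      exact neg_ne_zero.mpr (hcell (hKold k hk)).1
  · rcases lt_or_ge k 3 with hk | hk
    · rw [← h.sq_L₀_eq]
      exact (hcell (hKnew k hk)).2
    · exact (hcell (hKold k hk)).2

end IsMove

end FlatManifold

/-! ### The change of the deficit angles under a move -/

namespace FlatManifold

open Matrix

variable {V : Type*} [Fintype V] [DecidableEq V] {v₀ : V}

/-- The variation of the signed sum of the dihedral angles around a triangle. -/
noncomputable def angleSum (T : FlatManifold V v₀) (i : Finset V) (x : V → V → ℝ) : ℝ :=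
  ∑ s : Finset V with i ⊆ s, Real.sign (T.volF s) * fderiv ℝ (angleOf s i) (T.sq T.L₀) x

theorem dωdL_apply (T : FlatManifold V v₀) (i : T.Face) (a : T.Edge) :
    T.dωdL i a = -T.angleSum i.1 (T.sq (Pi.single a 1)) := by
  classical
  rw [dωdL, of_apply, fderiv_deficit, angleSum, neg_inj]
  simp only [← volF_cell, Finset.sum_filter]
  rw [← Finset.sum_subtype (Finset.univ.filter fun s : Finset V => s ∈ T.K ∧ s.card = 4 + 1)
    (by simp) fun s => if i.1 ⊆ s then Real.sign (T.volF s) *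
      fderiv ℝ (angleOf s i.1) (T.sq T.L₀) (T.sq (Pi.single a 1)) else 0]
  refine Finset.sum_subset (Finset.filter_subset _ _) fun s _ hs => ?_
  -- Sets that are not 4-simplices have volume zero and hence sign zero, so the sum may run over all
  -- sets of vertices and the two triangulations can be compared term by term.
  have hs' : T.volF s = 0 := dif_neg fun h => hs (Finset.mem_filter.mpr ⟨Finset.mem_univ s, h⟩)
  simp [hs']

variable {T T' : FlatManifold V v₀} {A B C D E F : V}

namespace IsMove

theorem volF_eq (h : T.IsMove T' A B C D E F) {s : Finset V}
    (hs : ∀ r ∈ ({A, B, C} : Finset V) ∪ {D, E, F},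
      s ≠ (({A, B, C} : Finset V) ∪ {D, E, F}).erase r) :
    T'.volF s = T.volF s := by
  by_cases hc : s.card = 4 + 1
  · by_cases hX : {A, B, C} ⊆ s
    · rw [T'.volF_of_not_mem (h.not_mem_new hX), T.volF_of_not_mem]
      intro hT
      obtain ⟨r, hr, hsr⟩ := h.exists_eq_erase_old hX hT hc
      exact hs r (Finset.mem_union_right _ hr) hsr
    · by_cases hY : {D, E, F} ⊆ s
      · rw [T.volF_of_not_mem (h.not_mem_old hY), T'.volF_of_not_mem]
        intro hT
        obtain ⟨r, hr, hsr⟩ := h.exists_eq_erase_new hY hT hc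
        exact hs r (Finset.mem_union_left _ hr) hsr
      · by_cases hT : s ∈ T.K
        · have hT' := (h.mem_iff hX hY).mpr hT
          rw [T.volF_cell ⟨s, hT, hc⟩, T'.volF_cell ⟨s, hT', hc⟩, h.vol_eq]
        · rw [T.volF_of_not_mem hT, T'.volF_of_not_mem fun hT' => hT ((h.mem_iff hX hY).mp hT')]
  · rw [volF, volF, dif_neg fun h' => hc h'.2, dif_neg fun h' => hc h'.2]

/-- Each of the six 4-simplices belongs to only one of the triangulations, so one of the two signs
is zero. -/
theorem sign_volDiff (h : T.IsMove T' A B C D E F) {r : V}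
    (hr : r ∈ ({A, B, C} : Finset V) ∪ {D, E, F}) :
    Real.sign (T'.volF ((({A, B, C} : Finset V) ∪ {D, E, F}).erase r)) -
        Real.sign (T.volF ((({A, B, C} : Finset V) ∪ {D, E, F}).erase r)) =
      Real.sign (T.volDiff T' ({A, B, C} ∪ {D, E, F}) r) := by
  rcases Finset.mem_union.mp hr with hr | hr
  · rw [h.volDiff_new hr, h.volF_erase_eq_zero hr, Real.sign_zero, sub_zero]
  · rw [h.volDiff_old hr, h.volF_erase_eq_zero' hr, Real.sign_zero, zero_sub, Real.sign_neg]

/-- Only 4-simplices on the six points change, and the one that omits `r` contributes at `i` exactly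
if `r` is not in `i`. -/
theorem angleSum_sub (h : T.IsMove T' A B C D E F) (i : Finset V) (x : V → V → ℝ) :
    T'.angleSum i x - T.angleSum i x = if i ⊆ {A, B, C} ∪ {D, E, F} then
      ∑ r ∈ (({A, B, C} : Finset V) ∪ {D, E, F}) \ i,
        Real.sign (T.volDiff T' ({A, B, C} ∪ {D, E, F}) r) *
          fderiv ℝ (angleOf ((({A, B, C} : Finset V) ∪ {D, E, F}).erase r) i) (T.sq T.L₀) x
      else 0 := by
  rw [angleSum, angleSum, h.sq_L₀_eq, ← Finset.sum_sub_distrib]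
  simp only [← sub_mul]
  split_ifs with hi
  · rw [← Finset.sum_subset (s₁ := ((({A, B, C} : Finset V) ∪ {D, E, F}) \ i).image
      fun r => (({A, B, C} : Finset V) ∪ {D, E, F}).erase r), Finset.sum_image]
    · refine Finset.sum_congr rfl fun r hr => ?_
      rw [h.sign_volDiff (Finset.mem_sdiff.mp hr).1]
    · intro r hr r' hr' hrr
      exact Finset.erase_injOn _ (Finset.mem_sdiff.mp hr).1 (Finset.mem_sdiff.mp hr').1 hrr
    · intro s hs
      obtain ⟨r, hr, rfl⟩ := Finset.mem_image.mp hs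
      exact Finset.mem_filter.mpr ⟨Finset.mem_univ _,
        Finset.subset_erase.mpr ⟨hi, (Finset.mem_sdiff.mp hr).2⟩⟩
    · intro s hs hs'
      rw [h.volF_eq, sub_self, zero_mul]
      rintro r hr rfl
      exact hs' (Finset.mem_image_of_mem _ (Finset.mem_sdiff.mpr ⟨hr, fun hri =>
        Finset.notMem_erase r _ ((Finset.mem_filter.mp hs).2 hri)⟩))
  · refine Finset.sum_eq_zero fun s hs => ?_
    rw [h.volF_eq, sub_self, zero_mul]
    rintro r hr rfl
    exact hi ((Finset.mem_filter.mp hs).2.trans (Finset.erase_subset _ _))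

/-- The factor between the change of the deficit angle at a triangle and the variation of the
Cayley–Menger determinant of the six vertices. -/
noncomputable def factor (_ : T.IsMove T' A B C D E F) (i : Finset V) : ℝ :=
  if i ⊆ {A, B, C} ∪ {D, E, F} then areaOf i (T.sq T.L₀) /
    (48 * ∏ r ∈ (({A, B, C} : Finset V) ∪ {D, E, F}) \ i,
      T.volDiff T' ({A, B, C} ∪ {D, E, F}) r) else 0

/-- The variation of the Cayley–Menger determinant of the six vertices, up to a constant. -/
noncomputable def sixForm (_ : T.IsMove T' A B C D E F) (x : V → V → ℝ) : ℝ :=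
  ∑ s ∈ ({A, B, C} : Finset V) ∪ {D, E, F}, ∑ t ∈ ({A, B, C} : Finset V) ∪ {D, E, F},
    T.volDiff T' ({A, B, C} ∪ {D, E, F}) s * T.volDiff T' ({A, B, C} ∪ {D, E, F}) t * x s t

theorem angleSum_eq (h : T.IsMove T' A B C D E F) {i : Finset V} (hi : i.card = 3)
    {x : V → V → ℝ} (hx : IsDist x) :
    T'.angleSum i x = T.angleSum i x + h.factor i * h.sixForm x := by
  rw [← sub_eq_iff_eq_add', h.angleSum_sub, factor]
  split_ifs with hP
  · rw [h.isSixPoints.sum_sign_angle hP hi hx, sixForm]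
    ring
  · rw [zero_mul]

/-- No 4-simplex contains `ABC` after the move, so the old angle sum is the whole change with the
opposite sign. -/
theorem angleSum_old (h : T.IsMove T' A B C D E F) {x : V → V → ℝ} (hx : IsDist x) :
    T.angleSum {A, B, C} x = -(h.factor {A, B, C} * h.sixForm x) := by
  have h0 : T'.angleSum {A, B, C} x = 0 := Finset.sum_eq_zero fun s hs => by
    rw [T'.volF_of_not_mem (h.not_mem_new (Finset.mem_filter.mp hs).2), Real.sign_zero, zero_mul]
  have := h.angleSum_eq h.card_old hx
  linarith

theorem angleSum_new (h : T.IsMove T' A B C D E F) {x : V → V → ℝ} (hx : IsDist x) :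
    T'.angleSum {D, E, F} x = h.factor {D, E, F} * h.sixForm x := by
  have h0 : T.angleSum {D, E, F} x = 0 := Finset.sum_eq_zero fun s hs => by
    rw [T.volF_of_not_mem (h.not_mem_old (Finset.mem_filter.mp hs).2), Real.sign_zero, zero_mul]
  rw [h.angleSum_eq h.card_new hx, h0, zero_add]

theorem areaOf_pos (h : T.IsMove T' A B C D E F) {i : Finset V} (hc : i.card = 3)
    (hi : i ⊆ {A, B, C} ∪ {D, E, F}) : 0 < areaOf i (T.sq T.L₀) := by
  obtain ⟨r, hr, hri⟩ : ∃ r ∈ ({A, B, C} : Finset V) ∪ {D, E, F}, r ∉ i := by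
    by_contra! hcon
    have := Finset.card_le_card hcon
    rw [h.card_union] at this
    omega
  have := (h.isSixPoints.nondegenerate r hr).cm_neg_of_card_three
    (Finset.subset_erase.mpr ⟨hi, hri⟩) hc
  have h2 : 0 < √(-cm i (T.sq T.L₀)) := Real.sqrt_pos.mpr (by linarith)
  rw [areaOf]
  positivity

theorem sdiff_old (h : T.IsMove T' A B C D E F) :
    (({A, B, C} : Finset V) ∪ {D, E, F}) \ {A, B, C} = {D, E, F} :=
  Finset.union_sdiff_cancel_left h.disjoint

theorem sdiff_new (h : T.IsMove T' A B C D E F) :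
    (({A, B, C} : Finset V) ∪ {D, E, F}) \ {D, E, F} = {A, B, C} :=
  Finset.union_sdiff_cancel_right h.disjoint

theorem factor_old (h : T.IsMove T' A B C D E F) : h.factor {A, B, C} =
    areaOf {A, B, C} (T.sq T.L₀) /
      (48 * ∏ r ∈ {D, E, F}, T.volDiff T' ({A, B, C} ∪ {D, E, F}) r) := by
  rw [factor, if_pos Finset.subset_union_left, h.sdiff_old]

theorem factor_new (h : T.IsMove T' A B C D E F) : h.factor {D, E, F} =
    areaOf {D, E, F} (T.sq T.L₀) /
      (48 * ∏ r ∈ {A, B, C}, T.volDiff T' ({A, B, C} ∪ {D, E, F}) r) := by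
  rw [factor, if_pos Finset.subset_union_right, h.sdiff_new]

theorem prod_volDiff_old_ne_zero (h : T.IsMove T' A B C D E F) :
    ∏ r ∈ {D, E, F}, T.volDiff T' ({A, B, C} ∪ {D, E, F}) r ≠ 0 :=
  Finset.prod_ne_zero_iff.mpr fun r hr =>
    h.isSixPoints.ne_zero r (Finset.mem_union_right _ hr)

theorem prod_volDiff_new_ne_zero (h : T.IsMove T' A B C D E F) :
    ∏ r ∈ {A, B, C}, T.volDiff T' ({A, B, C} ∪ {D, E, F}) r ≠ 0 :=
  Finset.prod_ne_zero_iff.mpr fun r hr =>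
    h.isSixPoints.ne_zero r (Finset.mem_union_left _ hr)

theorem factor_old_ne_zero (h : T.IsMove T' A B C D E F) : h.factor {A, B, C} ≠ 0 := by
  rw [factor_old]
  exact div_ne_zero (h.areaOf_pos h.card_old Finset.subset_union_left).ne'
    (mul_ne_zero (by norm_num) h.prod_volDiff_old_ne_zero)

theorem factor_new_ne_zero (h : T.IsMove T' A B C D E F) : h.factor {D, E, F} ≠ 0 := by
  rw [factor_new]
  exact div_ne_zero (h.areaOf_pos h.card_new Finset.subset_union_right).ne'
    (mul_ne_zero (by norm_num) h.prod_volDiff_new_ne_zero)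

/-! ### Correspondence of edges and 2-faces -/

/-- A move does not change the edges. -/
def edgeEquiv (h : T.IsMove T' A B C D E F) : T.Edge ≃ T'.Edge :=
  Equiv.subtypeEquivRight fun _ =>
    and_congr_left fun hc => (h.mem_iff_of_card (by omega)).symm

theorem old_face_mem (h : T.IsMove T' A B C D E F) :
    ({A, B, C} : Finset V) ∈ T.K ∧ ({A, B, C} : Finset V).card = 2 + 1 :=
  ⟨(h.star _ subset_rfl).mpr ⟨∅, Finset.empty_ssubset.mpr ⟨D, by simp⟩, by simp⟩, h.card_old⟩

theorem new_face_mem (h : T.IsMove T' A B C D E F) :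
    ({D, E, F} : Finset V) ∈ T'.K ∧ ({D, E, F} : Finset V).card = 2 + 1 :=
  ⟨(h.faces _).mpr (Or.inr ⟨∅, Finset.empty_ssubset.mpr ⟨A, by simp⟩, by simp⟩), h.card_new⟩

/-- A move replaces the 2-face `ABC` by `DEF`. -/
def faceEquiv (h : T.IsMove T' A B C D E F) : T.Face ≃ T'.Face :=
  (Equiv.swap ({A, B, C} : Finset V) {D, E, F}).subtypeEquiv fun s => by
    by_cases hX : s = {A, B, C}
    · subst hX
      rw [Equiv.swap_apply_left]
      exact iff_of_true h.old_face_mem h.new_face_mem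
    · by_cases hY : s = {D, E, F}
      · subst hY
        rw [Equiv.swap_apply_right]
        exact iff_of_false (fun h' => h.new_face h'.1) fun h' => h.not_mem_new subset_rfl h'.1
      · rw [Equiv.swap_apply_of_ne_of_ne hX hY]
        refine and_congr_left fun hc => (h.mem_iff (fun hs => hX ?_) fun hs => hY ?_).symm
        · exact (Finset.eq_of_subset_of_card_le hs (by rw [hc, h.card_old])).symm
        · exact (Finset.eq_of_subset_of_card_le hs (by rw [hc, h.card_new])).symm

/-- The 2-face `ABC`. -/
abbrev oldFace (h : T.IsMove T' A B C D E F) : T.Face := ⟨{A, B, C}, h.old_face_mem⟩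

/-- The 2-face `DEF`. -/
abbrev newFace (h : T.IsMove T' A B C D E F) : T'.Face := ⟨{D, E, F}, h.new_face_mem⟩

theorem faceEquiv_old (h : T.IsMove T' A B C D E F) : h.faceEquiv h.oldFace = h.newFace :=
  Subtype.ext (Equiv.swap_apply_left _ _)

theorem faceEquiv_val (h : T.IsMove T' A B C D E F) {i : T.Face} (hi : i ≠ h.oldFace) :
    (h.faceEquiv i).1 = i.1 :=
  Equiv.swap_apply_of_ne_of_ne (fun h' => hi (Subtype.ext h')) fun h' =>
    h.new_face (h' ▸ i.2.1)

theorem sq_comp (h : T.IsMove T' A B C D E F) (l : T'.Edge → ℝ) :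
    T'.sq l = T.sq (l ∘ h.edgeEquiv) := by
  ext u v
  by_cases hs : ({u, v} : Finset V) ∈ T.K ∧ ({u, v} : Finset V).card = 1 + 1
  · rw [sq, sq, dif_pos hs, dif_pos ⟨(h.mem_iff_of_card (by omega)).mpr hs.1, hs.2⟩]
    rfl
  · rw [sq, sq, dif_neg hs, dif_neg fun hs' =>
      hs ⟨(h.mem_iff_of_card (by omega)).mp hs'.1, hs'.2⟩]

theorem dωdL_new (h : T.IsMove T' A B C D E F) (i : T'.Face) (a : T.Edge) :
    T'.dωdL i (h.edgeEquiv a) = -T'.angleSum i.1 (T.sq (Pi.single a 1)) := by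
  rw [dωdL_apply, h.sq_comp]
  congr 3
  ext b
  simp [Pi.single_apply]

/-- By `angleSum_eq` each common row changes by a multiple of `sixForm`, and `angleSum_old`
expresses this form through the old row of `ABC`. The new row of `DEF` is a multiple of the same
form. -/
theorem isRowOperation (h : T.IsMove T' A B C D E F) :
    IsRowOperation T.dωdL T'.dωdL h.faceEquiv h.edgeEquiv h.oldFace fun i =>
      if i = h.oldFace then -h.factor {D, E, F} / h.factor {A, B, C}
      else -h.factor i.1 / h.factor {A, B, C} where
  ne_zero := by
    rw [if_pos rfl]
    exact div_ne_zero (neg_ne_zero.mpr h.factor_new_ne_zero) h.factor_old_ne_zero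
  apply_self a := by
    have := h.factor_old_ne_zero
    rw [if_pos rfl, h.faceEquiv_old, h.dωdL_new, dωdL_apply, h.angleSum_new (T.isDist_sq _),
      h.angleSum_old (T.isDist_sq _)]
    field_simp
  apply_ne i hi a := by
    have := h.factor_old_ne_zero
    rw [if_neg hi, h.dωdL_new, h.faceEquiv_val hi, dωdL_apply, dωdL_apply,
      h.angleSum_eq i.2.2 (T.isDist_sq _), h.angleSum_old (T.isDist_sq _)]
    field_simp
    ring

/-- The entry at the edge `DE` is the nonzero factor of `ABC` times `2 β_D β_E`, where the two comes
from the two orders of `D` and `E`. -/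
theorem row_ne_zero (h : T.IsMove T' A B C D E F) : T.dωdL h.oldFace ≠ 0 := by
  have hn := h.nodup
  simp only [List.nodup_cons, List.mem_cons, List.not_mem_nil, not_or] at hn
  have hDE : D ≠ E := by tauto
  have hc : ({D, E} : Finset V) ∈ T.K ∧ ({D, E} : Finset V).card = 1 + 1 :=
    ⟨mem_of_subset (h.erase_mem_old (r := F) (by simp)) (by
      intro v hv
      simp only [Finset.mem_insert, Finset.mem_singleton] at hv
      rcases hv with rfl | rfl <;> simp <;> tauto) ⟨D, by simp⟩, Finset.card_pair hDE⟩
  intro h0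
  have h1 := congrFun h0 ⟨{D, E}, hc⟩
  rw [dωdL_apply, h.angleSum_old (T.isDist_sq _), neg_neg, Pi.zero_apply,
    mul_eq_zero, or_iff_right h.factor_old_ne_zero] at h1
  have hx : ∀ s t, T.sq (Pi.single ⟨{D, E}, hc⟩ 1) s t =
      if ({s, t} : Finset V) = {D, E} then 1 else 0 := fun s t => by
    by_cases hst : ({s, t} : Finset V) = {D, E}
    · rw [sq, dif_pos (hst ▸ hc), if_pos hst]
      simp [hst]
    · rw [sq, if_neg hst]
      split_ifs with h'
      · rw [Pi.single_apply, if_neg fun h'' => hst (congrArg Subtype.val h'')]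
      · rfl
  have hpair : ∀ s t : V, T.sq (Pi.single ⟨{D, E}, hc⟩ 1) s t =
      (if s = D then if t = E then 1 else 0 else 0) +
        if s = E then if t = D then 1 else 0 else 0 := fun s t => by
    rw [hx]
    by_cases hs : s = D
    · subst hs
      have ht : ({s, t} : Finset V) = {s, E} ↔ t = E := by
        refine ⟨fun hst => ?_, fun ht => by rw [ht]⟩
        have : E ∈ ({s, t} : Finset V) := by rw [hst]; simp
        simp only [Finset.mem_insert, Finset.mem_singleton] at this
        exact (this.resolve_left (Ne.symm hDE)).symm
      simp [ht, hDE]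
    · by_cases hs' : s = E
      · subst hs'
        have ht : ({s, t} : Finset V) = {D, s} ↔ t = D := by
          refine ⟨fun hst => ?_, fun ht => by rw [ht, Finset.pair_comm]⟩
          have : D ∈ ({s, t} : Finset V) := by rw [hst]; simp
          simp only [Finset.mem_insert, Finset.mem_singleton] at this
          exact (this.resolve_left hDE).symm
        simp [ht, hs]
      · rw [if_neg hs, if_neg hs', if_neg, add_zero]
        intro hst
        have : s ∈ ({D, E} : Finset V) := by rw [← hst]; simp
        simp [hs, hs'] at this
  have hD : D ∈ ({A, B, C} : Finset V) ∪ {D, E, F} := by simp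
  have hE : E ∈ ({A, B, C} : Finset V) ∪ {D, E, F} := by simp
  rw [sixForm] at h1
  simp only [hpair, mul_add, mul_ite, mul_one, mul_zero, Finset.sum_add_distrib] at h1
  rw [Finset.sum_eq_single_of_mem D hD fun s _ hs => by simp [hs],
    Finset.sum_eq_single_of_mem E hE fun s _ hs => by simp [hs],
    Finset.sum_eq_single_of_mem E hE fun s _ hs => by simp [hs],
    Finset.sum_eq_single_of_mem D hD fun s _ hs => by simp [hs]] at h1
  simp only [if_true] at h1
  have := mul_ne_zero (h.isSixPoints.ne_zero D hD) (h.isSixPoints.ne_zero E hE)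
  exact this (by linarith)

end IsMove

end FlatManifold

/-! ### Deformations before and after a move -/

section RowOperation

open Matrix

variable {F F' E E' : Type*} [Fintype F] [Fintype F'] [DecidableEq F] {A : Matrix F E ℝ}
  {A' : Matrix F' E' ℝ} {eF : F ≃ F'} {eE : E ≃ E'} {i₀ : F} {γ : F → ℝ}

/-- A row operation gives an isomorphism of the left kernels. -/
theorem IsRowOperation.exists_linearEquiv (h : IsRowOperation A A' eF eE i₀ γ) :
    ∃ G : (F' → ℝ) ≃ₗ[ℝ] (F → ℝ), (∀ s i, i ≠ i₀ → G s i = s (eF i)) ∧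
      ∀ s, A'ᵀ *ᵥ s = 0 ↔ Aᵀ *ᵥ G s = 0 := by
  let G : (F' → ℝ) →ₗ[ℝ] (F → ℝ) := LinearMap.pi fun i =>
    if i = i₀ then ∑ j, γ j • LinearMap.proj (eF j) else LinearMap.proj (eF i)
  have hG : ∀ s, G s = fun i => if i = i₀ then ∑ j, γ j * s (eF j) else s (eF i) := fun s => by
    ext i
    by_cases hi : i = i₀ <;> simp [G, hi]
  have hinj : Function.Injective G := by
    rw [injective_iff_map_eq_zero]
    intro s hs
    rw [hG] at hs
    have h1 : ∀ i, i ≠ i₀ → s (eF i) = 0 := fun i hi => by simpa [hi] using congrFun hs i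
    have h2 := congrFun hs i₀
    simp only [if_true, Pi.zero_apply] at h2
    rw [Finset.sum_eq_single_of_mem i₀ (Finset.mem_univ _) fun j _ hj => by rw [h1 j hj, mul_zero],
      mul_eq_zero, or_iff_right h.ne_zero] at h2
    ext i'
    obtain ⟨i, rfl⟩ := eF.surjective i'
    by_cases hi : i = i₀
    · rw [hi, h2, Pi.zero_apply]
    · rw [h1 i hi, Pi.zero_apply]
  have hfr : Module.finrank ℝ (F' → ℝ) = Module.finrank ℝ (F → ℝ) := by
    rw [Module.finrank_fintype_fun_eq_card, Module.finrank_fintype_fun_eq_card,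
      Fintype.card_congr eF]
  refine ⟨G.linearEquivOfInjective hinj hfr, fun s i hi => ?_, fun s => ?_⟩
  · rw [LinearMap.linearEquivOfInjective_apply, hG]
    exact if_neg hi
  · rw [LinearMap.linearEquivOfInjective_apply, hG, funext_iff, ← eE.forall_congr_right,
      funext_iff]
    simp only [h.vecMul_apply, Pi.zero_apply]

/-- A left kernel vector supported on one nonzero row vanishes. This determines the area variation
at `DEF` from those at the common 2-faces. -/
theorem IsRowOperation.eq_zero_of_vecMul (h : IsRowOperation A A' eF eE i₀ γ) (h0 : A i₀ ≠ 0)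
    {s : F' → ℝ} (hs : A'ᵀ *ᵥ s = 0) (hsi : ∀ i, i ≠ i₀ → s (eF i) = 0) : s = 0 := by
  obtain ⟨a, ha⟩ := Function.ne_iff.mp h0
  have h1 := congrFun hs (eE a)
  rw [mulVec, dotProduct, ← eF.sum_comp, Finset.sum_eq_single_of_mem i₀ (Finset.mem_univ _)
    fun j _ hj => by rw [hsi j hj, mul_zero], transpose_apply, h.apply_self, Pi.zero_apply,
    mul_eq_zero, or_iff_right (mul_ne_zero h.ne_zero ha)] at h1
  ext i'
  obtain ⟨i, rfl⟩ := eF.surjective i'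
  by_cases hi : i = i₀
  · rw [hi, h1, Pi.zero_apply]
  · rw [hsi i hi, Pi.zero_apply]

end RowOperation

namespace FlatManifold

open Matrix

variable {V : Type*} [Fintype V] [DecidableEq V] {v₀ : V} {T T' : FlatManifold V v₀}
  {A B C D E F : V}

namespace IsMove

theorem compatible_areas_iff (h : T.IsMove T' A B C D E F)
    (Φ : T.areaDeformations ≃ₗ[ℝ] T'.areaDeformations) :
    Compatible Φ ↔ ∀ w i, i ≠ h.oldFace → (Φ w).1 (h.faceEquiv i) = w.1 i := by
  constructor
  · exact fun hΦ w i hi => hΦ w i _ (h.faceEquiv_val hi).symm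
  · intro hΦ w i i' hii
    have hi : i ≠ h.oldFace := by
      rintro rfl
      exact h.not_mem_new (s := i'.1) hii.subset i'.2.1
    rw [← hΦ w i hi]
    exact congrArg _ (Subtype.ext (hii.symm.trans (h.faceEquiv_val hi).symm))

theorem compatible_lengths_iff (h : T.IsMove T' A B C D E F)
    (Ψ : T.lengthDeformations ≃ₗ[ℝ] T'.lengthDeformations) :
    Compatible Ψ ↔ ∀ w a, (Ψ w).1 (h.edgeEquiv a) = w.1 a := by
  constructor
  · exact fun hΨ w a => hΨ w a _ rfl
  · intro hΨ w a a' haa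
    rw [← hΨ w a]
    exact congrArg _ (Subtype.ext haa.symm)

/-- The row operation supplies an isomorphism of the left kernels that fixes all components but one;
two such isomorphisms differ by left kernel vectors supported at `DEF`. -/
theorem existsUnique_areas (h : T.IsMove T' A B C D E F) (hT : T.AreasDetermineLengths)
    (hT' : T'.AreasDetermineLengths) :
    ∃! Φ : T.areaDeformations ≃ₗ[ℝ] T'.areaDeformations, Compatible Φ := by
  obtain ⟨G, hG, hker⟩ := h.isRowOperation.exists_linearEquiv
  have hmap : T.areaDeformations.map (G.symm : (T.Face → ℝ) →ₗ[ℝ] (T'.Face → ℝ)) =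
      T'.areaDeformations := by
    ext s
    rw [Submodule.mem_map_equiv, LinearEquiv.symm_symm, hT.mem_areaDeformations,
      hT'.mem_areaDeformations, hker]
  have hG' : ∀ (w : T.areaDeformations) i, i ≠ h.oldFace →
      (G.symm.ofSubmodules _ _ hmap w).1 (h.faceEquiv i) = w.1 i := fun w i hi => by
    rw [LinearEquiv.ofSubmodules_apply, ← hG (G.symm w.1) i hi, LinearEquiv.apply_symm_apply]
  refine ⟨G.symm.ofSubmodules _ _ hmap, (h.compatible_areas_iff _).mpr hG', fun Φ hΦ => ?_⟩
  · ext1 w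
    replace hΦ := (h.compatible_areas_iff Φ).mp hΦ
    refine Subtype.ext (sub_eq_zero.mp (h.isRowOperation.eq_zero_of_vecMul h.row_ne_zero ?_
      fun i hi => ?_))
    · exact hT'.mem_areaDeformations.mp (Submodule.sub_mem _ (Φ w).2 (Subtype.mem _))
    · rw [Pi.sub_apply, hΦ w i hi, hG' w i hi, sub_self]

theorem existsUnique_lengths (h : T.IsMove T' A B C D E F) :
    ∃! Ψ : T.lengthDeformations ≃ₗ[ℝ] T'.lengthDeformations, Compatible Ψ := by
  have hmap : T.lengthDeformations.map
      (LinearEquiv.funCongrLeft ℝ ℝ h.edgeEquiv.symm : (T.Edge → ℝ) →ₗ[ℝ] (T'.Edge → ℝ)) =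
      T'.lengthDeformations := by
    ext u
    rw [Submodule.mem_map_equiv, mem_lengthDeformations, mem_lengthDeformations,
      h.isRowOperation.mulVec_eq_zero_iff]
    rfl
  refine ⟨(LinearEquiv.funCongrLeft ℝ ℝ h.edgeEquiv.symm).ofSubmodules _ _ hmap,
    (h.compatible_lengths_iff _).mpr fun w a => ?_, fun Ψ hΨ => ?_⟩
  · rw [LinearEquiv.ofSubmodules_apply, LinearEquiv.funCongrLeft_apply, LinearMap.funLeft_apply,
      Equiv.symm_apply_apply]
  · ext w a'
    replace hΨ := (h.compatible_lengths_iff Ψ).mp hΨ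
    obtain ⟨a, rfl⟩ := h.edgeEquiv.surjective a'
    rw [hΨ, LinearEquiv.ofSubmodules_apply, LinearEquiv.funCongrLeft_apply,
      LinearMap.funLeft_apply, Equiv.symm_apply_apply]

/-- All squared lengths are unchanged, so only the areas of `ABC` and `DEF` distinguish the
products. -/
theorem prod_area (h : T.IsMove T' A B C D E F) :
    areaOf {A, B, C} (T.sq T.L₀) * ∏ i : T'.Face, T'.area i T'.L₀ =
      areaOf {D, E, F} (T.sq T.L₀) * ∏ i : T.Face, T.area i T.L₀ := by
  have h1 : ∀ i : T'.Face, T'.area i T'.L₀ = areaOf i.1 (T.sq T.L₀) := fun i => by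
    rw [← h.sq_L₀_eq]
    rfl
  have h2 : ∀ i : T.Face, T.area i T.L₀ = areaOf i.1 (T.sq T.L₀) := fun i => rfl
  classical
  simp only [h1, h2]
  rw [← h.faceEquiv.prod_comp, ← Finset.mul_prod_erase _ _ (Finset.mem_univ h.oldFace),
    ← Finset.mul_prod_erase Finset.univ (fun i : T.Face => areaOf i.1 (T.sq T.L₀))
      (Finset.mem_univ h.oldFace), h.faceEquiv_old,
    Finset.prod_congr rfl fun i hi => by rw [h.faceEquiv_val (Finset.ne_of_mem_erase hi)]]
  ring

section

open scoped Classical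

/-- The three old volumes on the six points are the negatives of the corresponding coefficients,
whence the sign `(-1) ^ 3`. -/
theorem prod_vol_old (h : T.IsMove T' A B C D E F) : ∏ σ : T.Cell, T.vol σ =
    -((∏ s : Finset V with s.card = 5 ∧ s ∈ T.K ∧ s ∈ T'.K, T.volF s) *
      ∏ r ∈ {D, E, F}, T.volDiff T' ({A, B, C} ∪ {D, E, F}) r) := by
  have h1 : ∏ r ∈ ({D, E, F} : Finset V), T.volF ((({A, B, C} : Finset V) ∪ {D, E, F}).erase r) =
      -∏ r ∈ {D, E, F}, T.volDiff T' ({A, B, C} ∪ {D, E, F}) r := by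
    rw [Finset.prod_congr rfl fun r hr => h.volDiff_old hr, Finset.prod_neg, h.card_new]
    ring
  simp only [← volF_cell]
  rw [← Finset.prod_subtype (Finset.univ.filter fun s : Finset V => s ∈ T.K ∧ s.card = 4 + 1)
    (by simp) T.volF, ← Finset.prod_filter_mul_prod_filter_not _ (· ∈ T'.K), ← mul_neg, ← h1,
    ← Finset.prod_image (f := T.volF) fun r hr r' hr' => Finset.erase_injOn _
      (Finset.mem_union_right _ hr) (Finset.mem_union_right _ hr')]
  congr 2
  · ext s
    simp only [Finset.mem_filter, Finset.mem_univ, true_and]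
    tauto
  · ext s
    simp only [Finset.mem_filter, Finset.mem_univ, true_and, Finset.mem_image]
    constructor
    · rintro ⟨⟨hs, hc⟩, hs'⟩
      by_cases hX : {A, B, C} ⊆ s
      · obtain ⟨r, hr, rfl⟩ := h.exists_eq_erase_old hX hs hc
        exact ⟨r, hr, rfl⟩
      · exact absurd ((h.mem_iff hX fun hY => h.not_mem_old hY hs).mpr hs) hs'
    · rintro ⟨r, hr, rfl⟩
      exact ⟨⟨h.erase_mem_old hr, h.card_erase (Finset.mem_union_right _ hr)⟩,
        h.not_mem_new (Finset.subset_erase.mpr ⟨Finset.subset_union_left,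
          Finset.disjoint_right.mp h.disjoint hr⟩)⟩

theorem prod_vol_new (h : T.IsMove T' A B C D E F) : ∏ σ : T'.Cell, T'.vol σ =
    (∏ s : Finset V with s.card = 5 ∧ s ∈ T.K ∧ s ∈ T'.K, T'.volF s) *
      ∏ r ∈ {A, B, C}, T.volDiff T' ({A, B, C} ∪ {D, E, F}) r := by
  simp only [← volF_cell]
  rw [← Finset.prod_subtype (Finset.univ.filter fun s : Finset V => s ∈ T'.K ∧ s.card = 4 + 1)
    (by simp) T'.volF, ← Finset.prod_filter_mul_prod_filter_not _ (· ∈ T.K),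
    Finset.prod_congr (s₁ := {A, B, C}) rfl fun r hr => h.volDiff_new hr,
    ← Finset.prod_image (f := T'.volF) fun r hr r' hr' => Finset.erase_injOn _
      (Finset.mem_union_left _ hr) (Finset.mem_union_left _ hr')]
  congr 2
  · ext s
    simp only [Finset.mem_filter, Finset.mem_univ, true_and]
    tauto
  · ext s
    simp only [Finset.mem_filter, Finset.mem_univ, true_and, Finset.mem_image]
    constructor
    · rintro ⟨⟨hs, hc⟩, hs'⟩
      by_cases hY : {D, E, F} ⊆ s
      · obtain ⟨r, hr, rfl⟩ := h.exists_eq_erase_new hY hs hc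
        exact ⟨r, hr, rfl⟩
      · exact absurd ((h.mem_iff (fun hX => h.not_mem_new hX hs) hY).mp hs) hs'
    · rintro ⟨r, hr, rfl⟩
      exact ⟨⟨h.erase_mem_new hr, h.card_erase (Finset.mem_union_left _ hr)⟩,
        h.not_mem_old (Finset.subset_erase.mpr ⟨Finset.subset_union_right,
          Finset.disjoint_left.mp h.disjoint hr⟩)⟩

theorem prod_vol (h : T.IsMove T' A B C D E F) :
    (∏ σ : T'.Cell, T'.vol σ) *
        ∏ r ∈ {D, E, F}, T.volDiff T' ({A, B, C} ∪ {D, E, F}) r =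
      -((∏ σ : T.Cell, T.vol σ) *
        ∏ r ∈ {A, B, C}, T.volDiff T' ({A, B, C} ∪ {D, E, F}) r) := by
  rw [h.prod_vol_old, h.prod_vol_new, Finset.prod_congr rfl fun s hs => ?_]
  · ring
  · obtain ⟨hc, hs, hs'⟩ := (Finset.mem_filter.mp hs).2
    rw [T.volF_cell ⟨s, hs, hc⟩, T'.volF_cell ⟨s, hs', hc⟩, h.vol_eq]

end

/-- The value is invariant under a move, up to a sign. -/
theorem value_eq (h : T.IsMove T' A B C D E F) (hT : T.AreasDetermineLengths)
    (hT' : T'.AreasDetermineLengths) {Φ : T.areaDeformations ≃ₗ[ℝ] T'.areaDeformations}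
    {Ψ : T.lengthDeformations ≃ₗ[ℝ] T'.lengthDeformations} (hΦ : Compatible Φ)
    (hΨ : Compatible Ψ) {m k l m' k' l' : ℕ} (χ : T.Choice m k l) (χ' : T'.Choice m' k' l') :
    m' = m ∧ ∃ (hk : k' = k) (hl : l' = l) (ε : ℤˣ),
      ∀ (s : Fin k → T.areaDeformations) (u : Fin l → T.lengthDeformations),
        T'.value χ' (Φ ∘ s ∘ Fin.cast hk) (Ψ ∘ u ∘ Fin.cast hl) =
          ((ε : ℤ) : ℝ) * T.value χ s u := by
  classical
  obtain ⟨hm, hk, hl, ε, hε⟩ := h.isRowOperation.coordDet_ratio_eq h.row_ne_zero χ.rows χ.cols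
    χ'.rows χ'.cols χ.isMaximalMinor χ'.isMaximalMinor
  refine ⟨hm, hk, hl, ε, fun s u => ?_⟩
  have h1 := hε (fun j => (s j).1) (fun j => (u j).1) (fun j => (Φ (s j)).1)
    (fun j => (Ψ (u j)).1) (fun j => hT.mem_areaDeformations.mp (s j).2)
    (fun j => T.mem_lengthDeformations.mp (u j).2)
    (fun j => hT'.mem_areaDeformations.mp (Φ (s j)).2)
    (fun j => T'.mem_lengthDeformations.mp (Ψ (u j)).2)
    (fun j => (h.compatible_areas_iff Φ).mp hΦ (s j))
    fun j => (h.compatible_lengths_iff Ψ).mp hΨ (u j)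
  rw [FlatManifold.value_eq, FlatManifold.value_eq]
  refine (congrArg _ h1).trans ?_
  have hS := h.prod_area
  have hV := h.prod_vol
  have hβ := h.prod_volDiff_old_ne_zero
  have hβ' := h.prod_volDiff_new_ne_zero
  have hS0 := (h.areaOf_pos h.card_old Finset.subset_union_left).ne'
  have hS0' := (h.areaOf_pos h.card_new Finset.subset_union_right).ne'
  have hV0 : ∏ σ : T.Cell, T.vol σ ≠ 0 := Finset.prod_ne_zero_iff.mpr fun σ _ => T.vol_ne_zero σ
  have hV0' : ∏ σ : T'.Cell, T'.vol σ ≠ 0 :=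
    Finset.prod_ne_zero_iff.mpr fun σ _ => T'.vol_ne_zero σ
  -- The pivot factor is the quotient of the two values of `factor`, in which `48` cancels. Its
  -- areas and products of coefficients compensate the changes of `∏ S` and `∏ V`, and its minus
  -- sign compensates the sign in `prod_vol`.
  have key : ∀ {S S' S₁ S₂ v v' b b' : ℝ}, S₁ * S' = S₂ * S → v' * b = -(v * b') →
      b ≠ 0 → b' ≠ 0 → S₁ ≠ 0 → S₂ ≠ 0 → v ≠ 0 → v' ≠ 0 →
        S' / v' / (-(S₂ / (48 * b')) / (S₁ / (48 * b))) = S / v := by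
    intro S S' S₁ S₂ v v' b b' e1 e2 hb hb' h1 h2 hv hv'
    field_simp
    linear_combination (-(b' * v)) * e1 - S₂ * S * e2
  have hc := key hS hV hβ hβ' hS0 hS0' hV0 hV0'
  rw [← h.factor_old, ← h.factor_new] at hc
  rw [← hc, if_pos rfl]
  ring

end IsMove

end FlatManifold

end FlatFour

theorem theorem5 {V : Type*} [Fintype V] [DecidableEq V] {v₀ : V}
    (T : FlatFour.FlatManifold V v₀) (hT : T.AreasDetermineLengths) :
    -- independence of the choice of the row and column sets, up to a sign
    (∀ {m k l m' k' l' : ℕ} (χ : T.Choice m k l) (χ' : T.Choice m' k' l'),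
      m' = m ∧ ∃ (hk : k' = k) (hl : l' = l) (ε : ℤˣ),
        ∀ (s : Fin k → T.areaDeformations) (u : Fin l → T.lengthDeformations),
          T.value χ' (s ∘ Fin.cast hk) (u ∘ Fin.cast hl) = ((ε : ℤ) : ℝ) * T.value χ s u) ∧
    -- invariance under the moves, up to a sign
    (∀ (T' : FlatFour.FlatManifold V v₀) (A B C D E F : V), T'.AreasDetermineLengths →
      T.IsMove T' A B C D E F →
      (∃! Φ : T.areaDeformations ≃ₗ[ℝ] T'.areaDeformations,
        FlatFour.FlatManifold.Compatible Φ) ∧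
      (∃! Ψ : T.lengthDeformations ≃ₗ[ℝ] T'.lengthDeformations,
        FlatFour.FlatManifold.Compatible Ψ) ∧
      ∀ (Φ : T.areaDeformations ≃ₗ[ℝ] T'.areaDeformations)
        (Ψ : T.lengthDeformations ≃ₗ[ℝ] T'.lengthDeformations),
        FlatFour.FlatManifold.Compatible Φ → FlatFour.FlatManifold.Compatible Ψ →
        ∀ {m k l m' k' l' : ℕ} (χ : T.Choice m k l) (χ' : T'.Choice m' k' l'),
          m' = m ∧ ∃ (hk : k' = k) (hl : l' = l) (ε : ℤˣ),
            ∀ (s : Fin k → T.areaDeformations) (u : Fin l → T.lengthDeformations),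
              T'.value χ' (Φ ∘ s ∘ Fin.cast hk) (Ψ ∘ u ∘ Fin.cast hl) =
                ((ε : ℤ) : ℝ) * T.value χ s u) := by
  refine ⟨fun χ χ' => hT.value_choice χ χ', fun T' A B C D E F hT' h =>
    ⟨h.existsUnique_areas hT hT', h.existsUnique_lengths, fun Φ Ψ hΦ hΨ _ _ _ _ _ _ χ χ' =>
      h.value_eq hT hT' hΦ hΨ χ χ'⟩⟩
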